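/- Let $\mathbb K$ be a field (of any characteristic) and let $q\in\mathbb K^\times$ be a primitive $\ell$-th root of unity, with $\ell>1$ an odd integer. **Notation.** For $n\ge 1$ let $V_n=\mathbb K^n$ with basis $e_1,\dots,e_n$, and let $R_n$ be the operator on $V_n\otimes V_n$ given by $$R_n(e_i\otimes e_j)=\begin{cases} e_j\otimes e_i & i<j,\\ q\,e_i\otimes e_i & i=j,\\ (q-q^{-1})\,e_i\otimes e_j+e_j\otimes e_i & i>j.\end{cases}$$ The Hecke algebra $\mathcal H_d$ acts on $V_n^{\otimes d}$, its generator $T_k$ acting as $R_n$ on the factors $k,k+1$. Let $\Gamma_q^d\mathcal V$ be the category with objects $V_n^{\otimes d}$, $n\ge1$, and with the $\mathcal H_d$-linear maps as morphisms; a functor $F$ on it is evaluated as $F(n)=F(V_n^{\otimes d})$. Let $S_q(n)$ be the algebra generated by $e_1,\dots,e_n$ with relations $e_je_i=q\,e_ie_j$ for $i<j$, and $\Lambda_q(n)$ the algebra generated by $e_1,\dots,e_n$ with relations $e_i\wedge e_i=0$ and $e_j\wedge e_i=-q^{-1}e_i\wedge e_j$ for $i<j$. They are graded quotients of the tensor algebra,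 and their graded pieces $S^d_q,\Lambda^d_q$ are functors on $\Gamma_q^d\mathcal V$. Put $\Omega^i_d=S_q^{d-i}\otimes\Lambda_q^i$ for $0\le i\le d$, zero for $i>d$, and $\Omega=\bigoplus_{d,i}\Omega^i_d$. Then $\Omega(n)$ is an algebra bigraded by $(d,i)$ with product $(a\otimes b)(c\otimes d)=(\mu\otimes\mu)(a\otimes R(b\otimes c)\otimes d)$, where $\mu$ denotes multiplication and $R$ the braiding induced by the $R_n$ (the action of $T_w$ with $w$ the block transposition). The quantum de Rham differential is $$\delta:\ S_q^{d-i}\otimes\Lambda_q^i\longrightarrow S_q^{d-i-1}\otimes V_n\otimes\Lambda_q^i\xrightarrow{\ 1\otimes\mu\ }S_q^{d-i-1}\otimes\Lambda_q^{i+1},$$ whose first map is induced by $\sum_\sigma q^{l(\sigma)}T_\sigma$ acting on the first $d-i$ factors, the sum being over the $(d-i-1,1)$-shuffles. It satisfies $\delta^2=0$, the maps $\delta$ are natural in $V_n^{\otimes d}$, and the product of $\Omega(n)$ makes $H^\bullet(\Omega(n))=\bigoplus_{d,i}H^i(\Omega_d(n))$ a bigraded algebra. The quantum Frobenius functor $\mathrm{Fr}:\Gamma_q^{d\ell}\mathcal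 V\to\Gamma_1^d\mathcal V$ sends $V_n^{\otimes d\ell}$ to $V_n^{\otimes d}$ and a morphism $f$ to the map $\mathrm{Fr}(f)$ whose coefficient at $(e_{j_1}\otimes\cdots\otimes e_{j_d},\ e_{i_1}\otimes\cdots\otimes e_{i_d})$ is the coefficient of $f$ at $(e_{j_1}^{\otimes\ell}\otimes\cdots\otimes e_{j_d}^{\otimes\ell},\ e_{i_1}^{\otimes\ell}\otimes\cdots\otimes e_{i_d}^{\otimes\ell})$ (it is the dual of the map $x_{ji}\mapsto x_{ji}^\ell$ on coordinate functions). For a functor $F$ on $\Gamma^d_1\mathcal V$ let $F^{(1)_q}=F\circ\mathrm{Fr}$. In particular $\Omega_d^{i\,(1)_q}$ is the twist of the classical functor $S^{d-i}\otimes\Lambda^i$ (the case $q=1$ of $\Omega^i_d$), and $\Omega^{(1)_q}(n)=\bigoplus_{d,i}\Omega^{i\,(1)_q}_d(n)$ is, as an algebra, the classical de Rham algebra $S(V_n)\otimes\Lambda(V_n)$. **Theorem.** For every $n\ge 1$ there is an isomorphism of $\mathbb K$-algebras $$c(n):\ \Omega^{(1)_q}(n)\longrightarrow H^\bullet(\Omega(n)),$$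 mapping $\Omega^{i\,(1)_q}_d(n)$ into $H^i(\Omega_{d\ell}(n))$ for all $d,i\ge 0$, such that for $1\le i\le n$ the elements $e_i^\ell\otimes1$ and $e_i^{\ell-1}\otimes e_i$ are cycles and $$c(n)(e_i\otimes 1)=[e_i^\ell\otimes 1]\in H^0(\Omega_\ell(n)),\qquad c(n)(1\otimes e_i)=[e_i^{\ell-1}\otimes e_i]\in H^1(\Omega_\ell(n)).$$ Moreover, for all $d,i\ge0$, the components of the $c(n)$, $n\ge 1$, are the components of an isomorphism of functors on $\Gamma_q^{d\ell}\mathcal V$ $$c^i_d:\ \Omega_d^{i\,(1)_q}\xrightarrow{\ \cong\ }H^i(\Omega_{d\ell}).$$ -/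

import Mathlib

namespace QuantumDeRham

section Braid

variable {M : Type*} [Monoid M] (T : ℕ → M)

/-- A sequence of elements of a monoid satisfying the braid relations. -/
structure BraidRel : Prop where
  far : ∀ j k, j + 1 < k → T j * T k = T k * T j
  braid : ∀ k, T k * T (k + 1) * T k = T (k + 1) * T k * T (k + 1)

/-- `up T s m = T (s+m-1) * ⋯ * T s`: the positive lift of the cycle that moves the strand at
position `s` to position `s + m`. -/
def up (s : ℕ) : ℕ → M
  | 0 => 1
  | m + 1 => T (s + m) * up s m

/-- `down T s m = T s * ⋯ * T (s+m-1)`: the positive lift of the cycle that moves the strand at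
position `s + m` to position `s`. -/
def down (s : ℕ) : ℕ → M
  | 0 => 1
  | m + 1 => down s m * T (s + m)

/-- The positive lift of the block transposition that exchanges the block of `i` strands at
positions `s, …, s+i-1` with the block of the `b` following strands. -/
def blk (s i : ℕ) : ℕ → M
  | 0 => 1
  | b + 1 => down T (s + b) i * blk s i b

variable {T}

theorem BraidRel.comm (h : BraidRel T) {j k : ℕ} (hjk : j + 1 < k ∨ k + 1 < j) :
    Commute (T j) (T k) := by
  rcases hjk with hjk | hjk
  · exact h.far j k hjk
  · exact (h.far k j hjk).symm

theorem commute_up {x : M} {s m : ℕ} (hx : ∀ j, s ≤ j → j < s + m → Commute x (T j)) :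
    Commute x (up T s m) := by
  induction m with
  | zero => exact Commute.one_right x
  | succ m ih =>
    exact (hx (s + m) (by omega) (by omega)).mul_right (ih fun j h1 h2 => hx j h1 (by omega))

theorem commute_down {x : M} {s m : ℕ} (hx : ∀ j, s ≤ j → j < s + m → Commute x (T j)) :
    Commute x (down T s m) := by
  induction m with
  | zero => exact Commute.one_right x
  | succ m ih =>
    exact (ih fun j h1 h2 => hx j h1 (by omega)).mul_right (hx (s + m) (by omega) (by omega))

theorem commute_blk {x : M} {s i b : ℕ}
    (hx : ∀ j, s ≤ j → j + 1 < s + i + b → Commute x (T j)) :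
    Commute x (blk T s i b) := by
  induction b with
  | zero => exact Commute.one_right x
  | succ b ih =>
    exact (commute_down fun j h1 h2 => hx j (by omega) (by omega)).mul_right
      (ih fun j h1 h2 => hx j h1 (by omega))

theorem up_conj (h : BraidRel T) {s k m : ℕ} (h1 : s ≤ k) (h2 : k + 1 < s + m) :
    T k * up T s m = up T s m * T (k + 1) := by
  induction m with
  | zero => omega
  | succ m ih =>
    rcases Nat.lt_or_ge (k + 1) (s + m) with h3 | h3
    · have e := (h.comm (j := k) (k := s + m) (Or.inl h3)).eq
      simp only [up]
      rw [← mul_assoc, e, mul_assoc, ih h3, mul_assoc]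
    · obtain ⟨m, rfl⟩ : ∃ m', m = m' + 1 := ⟨m - 1, by omega⟩
      obtain rfl : k = s + m := by omega
      have e : Commute (T (s + m + 1)) (up T s m) :=
        commute_up fun j _ _ => h.comm (by omega)
      simp only [up]
      rw [← add_assoc, ← mul_assoc, ← mul_assoc, h.braid, mul_assoc, e.eq]
      simp only [mul_assoc]

theorem down_conj (h : BraidRel T) {s k m : ℕ} (h1 : s ≤ k) (h2 : k + 1 < s + m) :
    T (k + 1) * down T s m = down T s m * T k := by
  induction m with
  | zero => omega
  | succ m ih =>
    rcases Nat.lt_or_ge (k + 1) (s + m) with h3 | h3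
    · have e := (h.comm (j := k) (k := s + m) (Or.inl h3)).eq
      simp only [down]
      rw [← mul_assoc, ih h3, mul_assoc, e, mul_assoc]
    · obtain ⟨m, rfl⟩ : ∃ m', m = m' + 1 := ⟨m - 1, by omega⟩
      obtain rfl : k = s + m := by omega
      have e : Commute (T (s + m + 1)) (down T s m) :=
        commute_down fun j _ _ => h.comm (by omega)
      have b := h.braid (s + m)
      simp only [down]
      rw [← add_assoc, ← mul_assoc, ← mul_assoc, e.eq]
      simp only [mul_assoc] at b ⊢
      rw [b]

theorem down_down (h : BraidRel T) (k i : ℕ) :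
    T k * (down T (k + 1) i * down T k i) = down T (k + 1) i * down T k i * T (k + i) := by
  induction i with
  | zero => simp [down]
  | succ i ih =>
    have e : Commute (T (k + 1 + i)) (down T k i) :=
      commute_down fun j _ _ => h.comm (by omega)
    have b := h.braid (k + i)
    have e2 : down T (k + 1) (i + 1) * down T k (i + 1)
        = down T (k + 1) i * down T k i * (T (k + i + 1) * T (k + i)) := by
      simp only [down]
      calc _ = down T (k + 1) i * (T (k + 1 + i) * down T k i) * T (k + i) := by
            simp only [mul_assoc]
        _ = _ := by rw [e.eq, show k + 1 + i = k + i + 1 by omega]; simp only [mul_assoc]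
    rw [e2, ← mul_assoc, ih]
    simp only [mul_assoc, ← add_assoc] at b ⊢
    rw [b]

theorem blk_conj_left (h : BraidRel T) {s i b k : ℕ} (h1 : s ≤ k) (h2 : k + 1 < s + i) :
    T (k + b) * blk T s i b = blk T s i b * T k := by
  induction b with
  | zero => simp [blk]
  | succ b ih =>
    simp only [blk]
    rw [← mul_assoc, ← add_assoc, down_conj h (by omega) (by omega), mul_assoc, ih, mul_assoc]

theorem blk_conj_right (h : BraidRel T) {s i b k : ℕ} (h1 : s ≤ k) (h2 : k + 1 < s + b) :
    T k * blk T s i b = blk T s i b * T (k + i) := by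
  induction b with
  | zero => omega
  | succ b ih =>
    rcases Nat.lt_or_ge (k + 1) (s + b) with h3 | h3
    · have e : Commute (T k) (down T (s + b) i) :=
        commute_down fun j _ _ => h.comm (by omega)
      simp only [blk]
      rw [← mul_assoc, e.eq, mul_assoc, ih h3, mul_assoc]
    · obtain ⟨b, rfl⟩ : ∃ m', b = m' + 1 := ⟨b - 1, by omega⟩
      obtain rfl : k = s + b := by omega
      have e : Commute (T (s + b + i)) (blk T s i b) :=
        commute_blk fun j _ _ => h.comm (by omega)
      have d := down_down h (s + b) i
      simp only [blk, ← add_assoc]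
      calc T (s + b) * (down T (s + b + 1) i * (down T (s + b) i * blk T s i b))
          = T (s + b) * (down T (s + b + 1) i * down T (s + b) i) * blk T s i b := by
            simp only [mul_assoc]
        _ = _ := by rw [d, mul_assoc, e.eq]; simp only [mul_assoc]

theorem up_add (s m m' : ℕ) : up T s (m + m') = up T (s + m) m' * up T s m := by
  induction m' with
  | zero => simp [up]
  | succ m' ih => rw [← add_assoc]; simp only [up]; rw [ih, mul_assoc, add_assoc]

theorem down_add (s m m' : ℕ) : down T s (m + m') = down T s m * down T (s + m) m' := by
  induction m' with
  | zero => simp [down]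
  | succ m' ih => rw [← add_assoc]; simp only [down]; rw [ih, mul_assoc, add_assoc]

theorem blk_add_right (s i b b' : ℕ) :
    blk T s i (b + b') = blk T (s + b) i b' * blk T s i b := by
  induction b' with
  | zero => simp [blk]
  | succ b' ih => rw [← add_assoc]; simp only [blk]; rw [ih, mul_assoc, add_assoc]

theorem blk_add_left (h : BraidRel T) (s i i' b : ℕ) :
    blk T s (i + i') b = blk T s i b * blk T (s + i) i' b := by
  induction b with
  | zero => simp [blk]
  | succ b ih =>
    have e : Commute (down T (s + b + i) i') (blk T s i b) :=
      commute_blk fun j _ _ => Commute.symm <| commute_down fun j' _ _ => h.comm (by omega)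
    simp only [blk]
    rw [ih, down_add, show s + i + b = s + b + i by omega]
    simp only [mul_assoc]
    rw [← mul_assoc (down T (s + b + i) i'), e.eq]
    simp only [mul_assoc]

theorem blk_one (s b : ℕ) : blk T s 1 b = up T s b := by
  induction b with
  | zero => rfl
  | succ b ih => simp [blk, up, down, ih]

theorem blk_zero_left (s b : ℕ) : blk T s 0 b = 1 := by
  induction b with
  | zero => rfl
  | succ b ih => simp [blk, down, ih]

end Braid
end QuantumDeRham

namespace QuantumDeRham

noncomputable section Hecke

variable {K : Type*} [Field K]

/-- The tensor power `V_n^{⊗d}` of `V_n = K^n`, through its basis `e_{I 0} ⊗ ⋯ ⊗ e_{I (d-1)}`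
indexed by the words `I : Fin d → Fin n`. -/
abbrev TensorPow (K : Type*) [Field K] (n d : ℕ) : Type _ := (Fin d → Fin n) →₀ K

/-- The basis vector `e_{I 0} ⊗ ⋯ ⊗ e_{I (d-1)}`. -/
abbrev tens (K : Type*) [Field K] {n d : ℕ} (I : Fin d → Fin n) : TensorPow K n d :=
  Finsupp.single I 1

/-- The word `I` with the letters at positions `k` and `k + 1` exchanged. -/
def swapAt {n d k : ℕ} (h : k + 1 < d) (I : Fin d → Fin n) : Fin d → Fin n :=
  I ∘ Equiv.swap ⟨k, Nat.lt_of_succ_lt h⟩ ⟨k + 1, h⟩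

/-- The operator `R_n` acting on the tensor factors `k` and `k + 1` (counted from `0`) of
`V_n^{⊗d}`: `e_i ⊗ e_j ↦ e_j ⊗ e_i` for `i < j`, `e_i ⊗ e_i ↦ q e_i ⊗ e_i`, and
`e_i ⊗ e_j ↦ e_j ⊗ e_i + (q - q⁻¹) e_i ⊗ e_j` for `i > j`. These are the generators of the Hecke
algebra action (and `0` when there is no factor `k + 1`). -/
def heckeT (q : K) (n d k : ℕ) : Module.End K (TensorPow K n d) :=
  if h : k + 1 < d then
    Finsupp.linearCombination K fun I : Fin d → Fin n =>
      if I ⟨k, Nat.lt_of_succ_lt h⟩ < I ⟨k + 1, h⟩ then tens K (swapAt h I)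
      else if I ⟨k, Nat.lt_of_succ_lt h⟩ = I ⟨k + 1, h⟩ then q • tens K I
      else (q - q⁻¹) • tens K I + tens K (swapAt h I)
  else 0

theorem heckeT_tens (q : K) {n d k : ℕ} (h : k + 1 < d) (I : Fin d → Fin n) :
    heckeT q n d k (tens K I) =
      if I ⟨k, Nat.lt_of_succ_lt h⟩ < I ⟨k + 1, h⟩ then tens K (swapAt h I)
      else if I ⟨k, Nat.lt_of_succ_lt h⟩ = I ⟨k + 1, h⟩ then q • tens K I
      else (q - q⁻¹) • tens K I + tens K (swapAt h I) := by
  simp [heckeT, h]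

theorem heckeT_of_not (q : K) {n d k : ℕ} (h : ¬ k + 1 < d) : heckeT q n d k = 0 := by
  simp [heckeT, h]

theorem end_ext {n d : ℕ} {N : Type*} [AddCommMonoid N] [Module K N]
    {f g : TensorPow K n d →ₗ[K] N} (h : ∀ I, f (tens K I) = g (tens K I)) : f = g :=
  Finsupp.lhom_ext' fun I => LinearMap.ext_ring (h I)

theorem swapAt_swapAt {n d k : ℕ} (h : k + 1 < d) (I : Fin d → Fin n) :
    swapAt h (swapAt h I) = I := by
  funext p; simp [swapAt]

theorem swapAt_eq {n d k : ℕ} (h : k + 1 < d) (I : Fin d → Fin n)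
    (e : I ⟨k, Nat.lt_of_succ_lt h⟩ = I ⟨k + 1, h⟩) : swapAt h I = I := by
  funext p
  simp only [swapAt, Function.comp_apply, Equiv.swap_apply_def]
  split_ifs with h1 h2
  · rw [h1, e]
  · rw [h2, e]
  · rfl

theorem swapAt_left {n d k : ℕ} (h : k + 1 < d) (I : Fin d → Fin n) :
    swapAt h I ⟨k, Nat.lt_of_succ_lt h⟩ = I ⟨k + 1, h⟩ := by
  simp [swapAt]

theorem swapAt_right {n d k : ℕ} (h : k + 1 < d) (I : Fin d → Fin n) :
    swapAt h I ⟨k + 1, h⟩ = I ⟨k, Nat.lt_of_succ_lt h⟩ := by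
  simp [swapAt]

theorem swapAt_ne {n d k : ℕ} (h : k + 1 < d) (I : Fin d → Fin n) (p : Fin d)
    (h1 : (p : ℕ) ≠ k) (h2 : (p : ℕ) ≠ k + 1) : swapAt h I p = I p := by
  have e1 : p ≠ ⟨k, Nat.lt_of_succ_lt h⟩ := fun e => h1 (by simp [e])
  have e2 : p ≠ ⟨k + 1, h⟩ := fun e => h2 (by simp [e])
  simp [swapAt, Equiv.swap_apply_of_ne_of_ne e1 e2]

theorem heckeT_quad (q : K) (hq : q ≠ 0) {n d k : ℕ} (h : k + 1 < d) :
    (heckeT q n d k - q • 1) * (heckeT q n d k + q⁻¹ • 1) = 0 := by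
  apply end_ext
  intro I
  have e1 := swapAt_left h I
  have e2 := swapAt_right h I
  have e3 := swapAt_swapAt h I
  rcases lt_trichotomy (I ⟨k, Nat.lt_of_succ_lt h⟩) (I ⟨k + 1, h⟩) with h1 | h1 | h1
  · simp [heckeT_tens q h, h1, e1, e2, e3, h1.not_gt, h1.ne', -Finsupp.smul_single, smul_smul,
      sub_smul, smul_add]
    simp only [mul_inv_cancel₀ hq]
    module
  · simp [heckeT_tens q h, h1, -Finsupp.smul_single, smul_smul, mul_comm]
  · simp [heckeT_tens q h, h1, e1, e2, e3, h1.not_gt, h1.ne', -Finsupp.smul_single, smul_smul,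
      sub_smul, smul_sub, smul_add]
    simp only [mul_inv_cancel₀ hq, inv_mul_cancel₀ hq]
    module

def upd3 {n d : ℕ} (k : ℕ) (I : Fin d → Fin n) (a b c : Fin n) : Fin d → Fin n :=
  fun p => if (p : ℕ) = k then a else if (p : ℕ) = k + 1 then b else
    if (p : ℕ) = k + 2 then c else I p

theorem heckeT_upd3_left (q : K) {n d k : ℕ} (h : k + 2 < d) (I : Fin d → Fin n)
    (a b c : Fin n) :
    heckeT q n d k (tens K (upd3 k I a b c)) =
      if a < b then tens K (upd3 k I b a c)
      else if a = b then q • tens K (upd3 k I a b c)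
      else (q - q⁻¹) • tens K (upd3 k I a b c) + tens K (upd3 k I b a c) := by
  have h' : k + 1 < d := by omega
  have e : swapAt h' (upd3 k I a b c) = upd3 k I b a c := by
    funext p
    by_cases h1 : (p : ℕ) = k
    · obtain rfl : p = ⟨k, Nat.lt_of_succ_lt h'⟩ := Fin.ext h1
      rw [swapAt_left]; simp [upd3]
    · by_cases h2 : (p : ℕ) = k + 1
      · obtain rfl : p = ⟨k + 1, h'⟩ := Fin.ext h2
        rw [swapAt_right]; simp [upd3]
      · rw [swapAt_ne h' _ p h1 h2]; simp [upd3, h1, h2]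
  rw [heckeT_tens q h', e]
  simp [upd3]

theorem heckeT_upd3_right (q : K) {n d k : ℕ} (h : k + 2 < d) (I : Fin d → Fin n)
    (a b c : Fin n) :
    heckeT q n d (k + 1) (tens K (upd3 k I a b c)) =
      if b < c then tens K (upd3 k I a c b)
      else if b = c then q • tens K (upd3 k I a b c)
      else (q - q⁻¹) • tens K (upd3 k I a b c) + tens K (upd3 k I a c b) := by
  have h' : k + 1 + 1 < d := by omega
  have hk : k + 1 + 1 ≠ k := by omega
  have e : swapAt h' (upd3 k I a b c) = upd3 k I a c b := by
    funext p
    by_cases h1 : (p : ℕ) = k + 1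
    · obtain rfl : p = ⟨k + 1, Nat.lt_of_succ_lt h'⟩ := Fin.ext h1
      rw [swapAt_left]; simp [upd3, hk]
    · by_cases h2 : (p : ℕ) = k + 1 + 1
      · obtain rfl : p = ⟨k + 1 + 1, h'⟩ := Fin.ext h2
        rw [swapAt_right]; simp [upd3, hk]
      · rw [swapAt_ne h' _ p h1 h2]; simp [upd3, h1, h2]
  rw [heckeT_tens q h', e]
  simp [upd3, hk]

theorem heckeT_braid (q : K) (hq : q ≠ 0) (n d k : ℕ) :
    heckeT q n d k * heckeT q n d (k + 1) * heckeT q n d k =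
      heckeT q n d (k + 1) * heckeT q n d k * heckeT q n d (k + 1) := by
  by_cases h : k + 2 < d
  swap
  · rw [heckeT_of_not q (k := k + 1) (by omega)]; simp
  apply end_ext
  intro I
  obtain ⟨a, b, c, e⟩ : ∃ a b c, I = upd3 k I a b c := by
    refine ⟨I ⟨k, by omega⟩, I ⟨k + 1, by omega⟩, I ⟨k + 2, h⟩, ?_⟩
    funext p
    simp only [upd3]
    split_ifs with h1 h2 h3
    · exact congrArg I (Fin.ext h1)
    · exact congrArg I (Fin.ext h2)
    · exact congrArg I (Fin.ext h3)
    · rfl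
  rw [e]
  clear e
  have L := heckeT_upd3_left q h I
  have R := heckeT_upd3_right q h I
  simp only [Module.End.mul_apply]
  rcases lt_trichotomy a b with h1 | h1 | h1 <;>
  rcases lt_trichotomy b c with h2 | h2 | h2 <;>
  rcases lt_trichotomy a c with h3 | h3 | h3 <;>
  first
  | (exfalso; omega)
  | (subst_vars
     simp only [L, R, *, map_add, map_smul, if_true, if_false, lt_irrefl, not_lt_of_gt, ne_of_gt, ne_of_lt,
      smul_add, smul_smul]
     try (match_scalars <;> field_simp <;> ring))

theorem heckeT_far (q : K) (n d j k : ℕ) (hjk : j + 1 < k) :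
    heckeT q n d j * heckeT q n d k = heckeT q n d k * heckeT q n d j := by
  by_cases h : k + 1 < d
  swap
  · rw [heckeT_of_not q (k := k) (by omega)]; simp
  have hj : j + 1 < d := by omega
  apply end_ext
  intro I
  have e1 : ∀ I : Fin d → Fin n, swapAt hj I ⟨k, Nat.lt_of_succ_lt h⟩ = I ⟨k, Nat.lt_of_succ_lt h⟩ :=
    fun I => swapAt_ne hj I _ (by simp; omega) (by simp; omega)
  have e2 : ∀ I : Fin d → Fin n, swapAt hj I ⟨k + 1, h⟩ = I ⟨k + 1, h⟩ :=
    fun I => swapAt_ne hj I _ (by simp; omega) (by simp; omega)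
  have e3 : ∀ I : Fin d → Fin n, swapAt h I ⟨j, Nat.lt_of_succ_lt hj⟩ = I ⟨j, Nat.lt_of_succ_lt hj⟩ :=
    fun I => swapAt_ne h I _ (by simp; omega) (by simp; omega)
  have e4 : ∀ I : Fin d → Fin n, swapAt h I ⟨j + 1, hj⟩ = I ⟨j + 1, hj⟩ :=
    fun I => swapAt_ne h I _ (by simp; omega) (by simp; omega)
  have e5 : swapAt h (swapAt hj I) = swapAt hj (swapAt h I) := by
    funext p
    by_cases p1 : (p : ℕ) = j
    · obtain rfl : p = ⟨j, Nat.lt_of_succ_lt hj⟩ := Fin.ext p1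
      rw [swapAt_left, e3, e4, swapAt_left]
    by_cases p2 : (p : ℕ) = j + 1
    · obtain rfl : p = ⟨j + 1, hj⟩ := Fin.ext p2
      rw [swapAt_right, e4, e3, swapAt_right]
    by_cases p3 : (p : ℕ) = k
    · obtain rfl : p = ⟨k, Nat.lt_of_succ_lt h⟩ := Fin.ext p3
      rw [swapAt_left, e1, e2, swapAt_left]
    by_cases p4 : (p : ℕ) = k + 1
    · obtain rfl : p = ⟨k + 1, h⟩ := Fin.ext p4
      rw [swapAt_right, e2, e1, swapAt_right]
    rw [swapAt_ne h _ p p3 p4, swapAt_ne hj _ p p1 p2, swapAt_ne hj _ p p1 p2, swapAt_ne h _ p p3 p4]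
  simp only [Module.End.mul_apply, heckeT_tens q h, heckeT_tens q hj, apply_ite (heckeT q n d j),
    apply_ite (heckeT q n d k), map_add, map_smul, e1, e2, e3, e4, e5]
  split_ifs <;> module

theorem heckeT_rel (q : K) (hq : q ≠ 0) (n d : ℕ) : BraidRel (heckeT q n d) :=
  ⟨fun j k h => heckeT_far q n d j k h, heckeT_braid q hq n d⟩

end Hecke
end QuantumDeRham

namespace QuantumDeRham

noncomputable section Forms

variable {K : Type*} [Field K]

/-- The kernel of `V_n^{⊗d} → S_q^{d-i}(V_n) ⊗ Λ_q^i(V_n)`. In the first `d - i` factors the relations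
are `R x = q x`, that is `e_j e_i = q e_i e_j` for `i < j`; in the last `i` factors the kernel of
`R - q` is killed, which is spanned by the `e_a ⊗ e_a` and the `e_j ⊗ e_i + q⁻¹ e_i ⊗ e_j` for
`i < j`. Everything is killed when `i > d`. -/
def relSub (q : Kˣ) (n d i : ℕ) : Submodule K (TensorPow K n d) :=
  if i ≤ d then
    (⨆ (k : ℕ) (_ : k + 1 < d - i), LinearMap.range (heckeT (q : K) n d k - (q : K) • 1)) ⊔
    (⨆ (k : ℕ) (_ : d - i ≤ k ∧ k + 1 < d), LinearMap.ker (heckeT (q : K) n d k - (q : K) • 1))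
  else ⊤

theorem relSub_of_lt (q : Kˣ) (n : ℕ) {d i : ℕ} (h : d < i) : relSub q n d i = ⊤ :=
  if_neg (by omega)

theorem sym_mem (q : Kˣ) {n d i k : ℕ} (hk : k + 1 < d - i) (x : TensorPow K n d) :
    heckeT (q : K) n d k x - (q : K) • x ∈ relSub q n d i := by
  rw [relSub, if_pos (by omega)]
  exact Submodule.mem_sup_left (Submodule.mem_iSup_of_mem k (Submodule.mem_iSup_of_mem hk ⟨x, rfl⟩))

theorem ext_mem (q : Kˣ) {n d i k : ℕ} (hk : d - i ≤ k) (hk' : k + 1 < d) (x : TensorPow K n d)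
    (hx : heckeT (q : K) n d k x = (q : K) • x) : x ∈ relSub q n d i := by
  by_cases h : i ≤ d
  · rw [relSub, if_pos h]
    refine Submodule.mem_sup_right (Submodule.mem_iSup_of_mem k
      (Submodule.mem_iSup_of_mem ⟨hk, hk'⟩ ?_))
    simp [hx]
  · rw [relSub_of_lt q n (by omega)]; trivial

theorem relSub_le (q : Kˣ) {n d i : ℕ} (h : i ≤ d) (P : Submodule K (TensorPow K n d))
    (h1 : ∀ k x, k + 1 < d - i → heckeT (q : K) n d k x - (q : K) • x ∈ P)
    (h2 : ∀ k x, d - i ≤ k → k + 1 < d → heckeT (q : K) n d k x = (q : K) • x → x ∈ P) :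
    relSub q n d i ≤ P := by
  rw [relSub, if_pos h]
  refine sup_le (iSup₂_le fun k hk => ?_) (iSup₂_le fun k hk => ?_)
  · rintro _ ⟨x, rfl⟩
    exact h1 k x hk
  · intro x hx
    exact h2 k x hk.1 hk.2 (sub_eq_zero.mp hx)

theorem ext_mem' (q : Kˣ) {n d i k : ℕ} (hk : d - i ≤ k) (hk' : k + 1 < d) (x : TensorPow K n d) :
    heckeT (q : K) n d k x + (q : K)⁻¹ • x ∈ relSub q n d i := by
  refine ext_mem q hk hk' _ ?_
  have := LinearMap.congr_fun (heckeT_quad (q : K) q.ne_zero (n := n) hk') x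
  simpa [sub_eq_zero] using this

/-- `Ω^i_d(n) = S_q^{d-i}(V_n) ⊗ Λ_q^i(V_n)` (zero for `i > d`). -/
def Omega (q : Kˣ) (n d i : ℕ) : Type _ := TensorPow K n d ⧸ relSub q n d i

instance (q : Kˣ) (n d i : ℕ) : AddCommGroup (Omega q n d i) :=
  inferInstanceAs (AddCommGroup (TensorPow K n d ⧸ relSub q n d i))

instance (q : Kˣ) (n d i : ℕ) : Module K (Omega q n d i) :=
  inferInstanceAs (Module K (TensorPow K n d ⧸ relSub q n d i))

/-- The projection of `V_n^{⊗d}` onto `S_q^{d-i}(V_n) ⊗ Λ_q^i(V_n)`: it sends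
`e_{a_1} ⊗ ⋯ ⊗ e_{a_d}` to `(e_{a_1} ⋯ e_{a_{d-i}}) ⊗ (e_{a_{d-i+1}} ∧ ⋯ ∧ e_{a_d})`. -/
def Omega.mk (q : Kˣ) (n d i : ℕ) : TensorPow K n d →ₗ[K] Omega q n d i :=
  (relSub q n d i).mkQ

theorem Omega.mk_surjective (q : Kˣ) (n d i : ℕ) : Function.Surjective (Omega.mk q n d i) :=
  Submodule.mkQ_surjective _

theorem Omega.mk_eq_zero (q : Kˣ) {n d i : ℕ} {x : TensorPow K n d} :
    Omega.mk q n d i x = 0 ↔ x ∈ relSub q n d i :=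
  Submodule.Quotient.mk_eq_zero _

theorem Omega.mk_eq (q : Kˣ) {n d i : ℕ} {x y : TensorPow K n d} :
    Omega.mk q n d i x = Omega.mk q n d i y ↔ x - y ∈ relSub q n d i :=
  Submodule.Quotient.eq _

theorem Omega.eq_zero_of_lt (q : Kˣ) {n d i : ℕ} (h : d < i) (x : Omega q n d i) : x = 0 := by
  obtain ⟨x, rfl⟩ := Omega.mk_surjective q n d i x
  rw [Omega.mk_eq_zero, relSub_of_lt q n h]; trivial

/-- The sum over the `(m-1,1)`-shuffles `σ` of `q^{length σ} T_σ`, acting on the first `m` tensor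
factors. It induces the component `S_q^m → S_q^{m-1} ⊗ V_n` of the comultiplication. -/
def shuffle (q : K) (n d m : ℕ) : Module.End K (TensorPow K n d) :=
  ∑ p ∈ Finset.range m, q ^ (m - 1 - p) • up (heckeT q n d) p (m - 1 - p)

theorem up_cons {M : Type*} [Monoid M] (T : ℕ → M) (s m : ℕ) :
    up T s (m + 1) = up T (s + 1) m * T s := by
  have := up_add (T := T) s 1 m
  rw [add_comm m 1, this]; simp [up]

theorem shuffle_sym_mem (q : Kˣ) {n d i k : ℕ} (hk : k + 1 < d - i) (x : TensorPow K n d) :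
    shuffle (q : K) n d (d - i) (heckeT (q : K) n d k x - (q : K) • x) ∈
      relSub q n d (i + 1) := by
  have hB := heckeT_rel (q : K) q.ne_zero n d
  obtain ⟨m, hm⟩ : ∃ m, d - i = m + 1 := ⟨d - i - 1, by omega⟩
  have key : ∀ p, p ≤ m → p ≠ k → p ≠ k + 1 →
      up (heckeT (q : K) n d) p (m - p) (heckeT (q : K) n d k x - (q : K) • x) ∈
        relSub q n d (i + 1) := by
    intro p hp h1 h2
    rcases lt_or_gt_of_ne h1 with h3 | h3
    · obtain ⟨k, rfl⟩ : ∃ k', k = k' + 1 := ⟨k - 1, by omega⟩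
      have e := LinearMap.congr_fun (up_conj hB (s := p) (k := k) (m := m - p) (by omega) (by omega)) x
      simp only [Module.End.mul_apply] at e
      rw [map_sub, map_smul, ← e]
      exact sym_mem q (by omega) _
    · have e : Commute (heckeT (q : K) n d k) (up (heckeT (q : K) n d) p (m - p)) :=
        commute_up fun j _ _ => hB.comm (by omega)
      have e' := LinearMap.congr_fun e.eq x
      simp only [Module.End.mul_apply] at e'
      rw [map_sub, map_smul, ← e']
      exact sym_mem q (by omega) _
  rw [shuffle, LinearMap.sum_apply, hm]
  simp only [Nat.add_sub_cancel]
  rw [← Finset.sum_filter_add_sum_filter_not _ (fun p => p = k ∨ p = k + 1)]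
  refine Submodule.add_mem _ ?_ (Submodule.sum_mem _ fun p hp => ?_)
  · have : (Finset.range (m + 1)).filter (fun p => p = k ∨ p = k + 1) = {k, k + 1} := by
      ext p; simp; omega
    rw [this, Finset.sum_pair (by omega)]
    convert Submodule.zero_mem _
    obtain ⟨r, rfl⟩ : ∃ r, m = k + 1 + r := ⟨m - k - 1, by omega⟩
    rw [show k + 1 + r - k = r + 1 by omega, show k + 1 + r - (k + 1) = r by omega, up_cons]
    have hquad := LinearMap.congr_fun (heckeT_quad (q : K) q.ne_zero (n := n) (d := d) (k := k)
      (by omega)) x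
    simp only [Module.End.mul_apply, LinearMap.sub_apply, LinearMap.add_apply,
      LinearMap.smul_apply, Module.End.one_apply, LinearMap.zero_apply, map_add, map_smul] at hquad
    have h2 : heckeT (q : K) n d k (heckeT (q : K) n d k x) =
        ((q : K) - (q : K)⁻¹) • heckeT (q : K) n d k x + x := by
      have e : (q : K)⁻¹ * (q : K) = 1 := inv_mul_cancel₀ q.ne_zero
      rw [← sub_eq_zero, ← hquad, smul_sub, smul_smul, e]; module
    simp only [LinearMap.smul_apply, Module.End.mul_apply, map_sub, map_smul, h2, map_add]
    match_scalars <;> field_simp <;> ring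
  · simp only [Finset.mem_filter, Finset.mem_range, not_or] at hp
    exact Submodule.smul_mem _ _ (key p (by omega) hp.2.1 hp.2.2)

theorem commute_shuffle {q : Kˣ} {n d m : ℕ} (x : Module.End K (TensorPow K n d))
    (hx : ∀ j, j + 1 < m → Commute x (heckeT (q : K) n d j)) :
    Commute x (shuffle (q : K) n d m) := by
  refine Commute.sum_right _ _ _ fun p hp => ?_
  refine Commute.smul_right (commute_up fun j _ _ => hx j ?_) _
  simp at hp; omega

theorem shuffle_mem (q : Kˣ) {n d i : ℕ} :
    relSub q n d i ≤ (relSub q n d (i + 1)).comap (shuffle (q : K) n d (d - i)) := by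
  rcases Nat.lt_or_ge i d with h | h
  · refine relSub_le q h.le _ (fun k x hk => shuffle_sym_mem q hk x) fun k x hk hk' hx => ?_
    have hB := heckeT_rel (q : K) q.ne_zero n d
    refine ext_mem q (k := k) (by omega) hk' _ ?_
    have e : Commute (heckeT (q : K) n d k) (shuffle (q : K) n d (d - i)) :=
      commute_shuffle _ fun j _ => hB.comm (by omega)
    have e' := LinearMap.congr_fun e.eq x
    simp only [Module.End.mul_apply] at e'
    rw [e', hx, map_smul]
  · rw [relSub_of_lt q n (i := i + 1) (by omega)]
    simp

/-- The quantum de Rham differential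
`S_q^{d-i} ⊗ Λ_q^i → S_q^{d-i-1} ⊗ V_n ⊗ Λ_q^i → S_q^{d-i-1} ⊗ Λ_q^{i+1}`: comultiplication followed
by exterior multiplication. -/
def delta (q : Kˣ) (n d i : ℕ) : Omega q n d i →ₗ[K] Omega q n d (i + 1) :=
  Submodule.mapQ _ _ (shuffle (q : K) n d (d - i)) (shuffle_mem q)

theorem delta_mk (q : Kˣ) (n d i : ℕ) (x : TensorPow K n d) :
    delta q n d i (Omega.mk q n d i x) = Omega.mk q n d (i + 1) (shuffle (q : K) n d (d - i) x) :=
  rfl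

/-- The Hecke algebra linear maps `V_n^{⊗d} → V_m^{⊗d}`. -/
def schur (q : Kˣ) (n m d : ℕ) : Submodule K (TensorPow K n d →ₗ[K] TensorPow K m d) where
  carrier := {f | ∀ k, k + 1 < d → f ∘ₗ heckeT (q : K) n d k = heckeT (q : K) m d k ∘ₗ f}
  add_mem' hf hg k hk := by rw [LinearMap.add_comp, LinearMap.comp_add, hf k hk, hg k hk]
  zero_mem' k hk := by rw [LinearMap.zero_comp, LinearMap.comp_zero]
  smul_mem' c f hf k hk := by rw [LinearMap.smul_comp, LinearMap.comp_smul, hf k hk]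

theorem schur_apply {q : Kˣ} {n m d : ℕ} {f : TensorPow K n d →ₗ[K] TensorPow K m d}
    (hf : f ∈ schur q n m d) {k : ℕ} (x : TensorPow K n d) :
    f (heckeT (q : K) n d k x) = heckeT (q : K) m d k (f x) := by
  by_cases hk : k + 1 < d
  · exact LinearMap.congr_fun (hf k hk) x
  · simp [heckeT_of_not _ hk]

theorem schur_relSub {q : Kˣ} {n m d i : ℕ} {f : TensorPow K n d →ₗ[K] TensorPow K m d}
    (hf : f ∈ schur q n m d) : relSub q n d i ≤ (relSub q m d i).comap f := by
  rcases Nat.lt_or_ge d i with h | h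
  · rw [relSub_of_lt q m h]; simp
  · refine relSub_le q h _ (fun k x hk => ?_) fun k x hk hk' hx => ?_
    · rw [Submodule.mem_comap, map_sub, map_smul, schur_apply hf]
      exact sym_mem q hk _
    · refine ext_mem q hk hk' _ ?_
      rw [← schur_apply hf, hx, map_smul]

/-- Functoriality of `Ω^i_d`. -/
def Omega.map {q : Kˣ} {n m d : ℕ} (i : ℕ) (f : schur q n m d) :
    Omega q n d i →ₗ[K] Omega q m d i :=
  Submodule.mapQ _ _ f.1 (schur_relSub f.2)

theorem Omega.map_mk {q : Kˣ} {n m d : ℕ} (i : ℕ) (f : schur q n m d) (x : TensorPow K n d) :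
    Omega.map i f (Omega.mk q n d i x) = Omega.mk q m d i (f.1 x) := rfl

theorem schur_up {q : Kˣ} {n m d : ℕ} (f : schur q n m d) (s r : ℕ) (x : TensorPow K n d) :
    f.1 (up (heckeT (q : K) n d) s r x) = up (heckeT (q : K) m d) s r (f.1 x) := by
  induction r with
  | zero => rfl
  | succ r ih => simp only [up, Module.End.mul_apply]; rw [schur_apply f.2, ih]

theorem delta_map {q : Kˣ} {n m d : ℕ} (i : ℕ) (f : schur q n m d) (x : Omega q n d i) :
    delta q m d i (Omega.map i f x) = Omega.map (i + 1) f (delta q n d i x) := by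
  obtain ⟨x, rfl⟩ := Omega.mk_surjective q n d i x
  rw [Omega.map_mk, delta_mk, delta_mk, Omega.map_mk]
  congr 1
  simp only [shuffle, LinearMap.sum_apply, map_sum, LinearMap.smul_apply, map_smul, schur_up]

end Forms
end QuantumDeRham

namespace QuantumDeRham
noncomputable section Square
variable {K : Type*} [Field K]

theorem up_up {M : Type*} [Monoid M] {T : ℕ → M} (h : BraidRel T) {p p' b c : ℕ} (hp : p ≤ p')
    (hb : p' + b < p + c) : up T p' b * up T p c = up T p c * up T (p' + 1) b := by
  induction b with
  | zero => simp [up]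
  | succ b ih =>
    have e := up_conj h (s := p) (k := p' + b) (m := c) (by omega) (by omega)
    rw [up, up, mul_assoc, ih (by omega), ← mul_assoc, e, mul_assoc, add_right_comm]

theorem sum_pairs {A : Type*} [AddCommMonoid A] (F : ℕ → ℕ → A) (N : ℕ) :
    ∑ a ∈ Finset.range N, ∑ b ∈ Finset.range (N + 1), F a b =
      ∑ a ∈ Finset.range N, ∑ b ∈ Finset.range (a + 1), (F a b + F b (a + 1)) := by
  induction N with
  | zero => simp
  | succ N ih =>
    rw [Finset.sum_range_succ, Finset.sum_range_succ (n := N) (f := fun a => ∑ b ∈ Finset.range (a + 1), (F a b + F b (a + 1))), ← ih]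
    simp only [Finset.sum_range_succ _ (N + 1), Finset.sum_add_distrib]
    rw [Finset.sum_range_succ (fun b => F b (N + 1)) N]
    abel

/-- The quantum de Rham differential squares to zero. -/
theorem delta_delta (q : Kˣ) (n d i : ℕ) : delta q n d (i + 1) ∘ₗ delta q n d i = 0 := by
  refine LinearMap.ext fun x => ?_
  obtain ⟨x, rfl⟩ := Omega.mk_surjective q n d i x
  rw [LinearMap.comp_apply, delta_mk, delta_mk, LinearMap.zero_apply, Omega.mk_eq_zero]
  rcases Nat.lt_or_ge d (i + 2) with h | h
  · rw [relSub_of_lt q n h]; trivial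
  obtain ⟨N, hN⟩ : ∃ N, d = i + 2 + N := ⟨d - (i + 2), by omega⟩
  rw [show d - i = N + 1 + 1 by omega, show d - (i + 1) = N + 1 by omega]
  have hB := heckeT_rel (q : K) q.ne_zero n d
  simp only [shuffle, LinearMap.sum_apply, map_sum, LinearMap.smul_apply, map_smul,
    Finset.smul_sum]
  rw [Finset.sum_comm, sum_pairs]
  refine Submodule.sum_mem _ fun a ha => Submodule.sum_mem _ fun b hb => ?_
  rw [Finset.mem_range] at ha hb
  have e := LinearMap.congr_fun (up_up hB (p := b) (p' := a) (b := N - a) (c := N - b + 1)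
    (by omega) (by omega)) x
  rw [up, mul_assoc] at e
  simp only [Module.End.mul_apply] at e
  rw [show N + 1 - 1 - a = N - a by omega, show N + 1 + 1 - 1 - b = N - b + 1 by omega,
    show N + 1 - 1 - b = N - b by omega, show N + 1 + 1 - 1 - (a + 1) = N - a by omega]
  have hm := Submodule.smul_mem _ ((q : K) ^ (N - a + (N - b) + 1)) (ext_mem' q (i := i + 2)
    (k := b + (N - b)) (by omega) (by omega)
    (up (heckeT (q : K) n d) b (N - b) (up (heckeT (q : K) n d) (a + 1) (N - a) x)))
  rw [show up (heckeT (q : K) n d) b (N - b + 1) = heckeT (q : K) n d (b + (N - b)) *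
    up (heckeT (q : K) n d) b (N - b) from rfl, Module.End.mul_apply, e]
  convert hm using 1
  match_scalars <;> field_simp <;> ring
end Square
end QuantumDeRham

namespace QuantumDeRham

noncomputable section Product

variable {K : Type*} [Field K]

/-- Concatenation `V_n^{⊗d₁} × V_n^{⊗d₂} → V_n^{⊗(d₁+d₂)}`. -/
def tmul (K : Type*) [Field K] (n d₁ d₂ : ℕ) :
    TensorPow K n d₁ →ₗ[K] TensorPow K n d₂ →ₗ[K] TensorPow K n (d₁ + d₂) :=
  Finsupp.linearCombination K fun I => Finsupp.lmapDomain K K (Fin.append I)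

theorem tmul_tens {n d₁ d₂ : ℕ} (I : Fin d₁ → Fin n) (J : Fin d₂ → Fin n) :
    tmul K n d₁ d₂ (tens K I) (tens K J) = tens K (Fin.append I J) := by
  simp [tmul]

theorem bilin_ext {n d₁ d₂ : ℕ} {N : Type*} [AddCommMonoid N] [Module K N]
    {f g : TensorPow K n d₁ →ₗ[K] TensorPow K n d₂ →ₗ[K] N}
    (h : ∀ I J, f (tens K I) (tens K J) = g (tens K I) (tens K J)) : f = g :=
  end_ext fun I => end_ext fun J => h I J

theorem swapAt_append_left {n d₁ d₂ k : ℕ} (h : k + 1 < d₁) (h' : k + 1 < d₁ + d₂)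
    (I : Fin d₁ → Fin n) (J : Fin d₂ → Fin n) :
    swapAt h' (Fin.append I J) = Fin.append (swapAt h I) J := by
  funext p
  induction p using Fin.addCases with
  | left p =>
    rw [Fin.append_left]
    by_cases h1 : (p : ℕ) = k
    · obtain rfl : p = ⟨k, Nat.lt_of_succ_lt h⟩ := Fin.ext h1
      rw [swapAt_left]
      exact (swapAt_left h' _).trans (Fin.append_left I J ⟨k + 1, h⟩)
    · by_cases h2 : (p : ℕ) = k + 1
      · obtain rfl : p = ⟨k + 1, h⟩ := Fin.ext h2
        rw [swapAt_right]
        exact (swapAt_right h' _).trans (Fin.append_left I J ⟨k, Nat.lt_of_succ_lt h⟩)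
      · rw [swapAt_ne h _ p h1 h2, swapAt_ne h' _ _ (by simpa using h1) (by simpa using h2),
          Fin.append_left]
  | right p =>
    rw [Fin.append_right, swapAt_ne h' _ _ (by simp; omega) (by simp; omega), Fin.append_right]

theorem swapAt_append_right {n d₁ d₂ k : ℕ} (h : k + 1 < d₂) (h' : d₁ + k + 1 < d₁ + d₂)
    (I : Fin d₁ → Fin n) (J : Fin d₂ → Fin n) :
    swapAt h' (Fin.append I J) = Fin.append I (swapAt h J) := by
  funext p
  induction p using Fin.addCases with
  | right p =>
    rw [Fin.append_right]
    by_cases h1 : (p : ℕ) = k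
    · obtain rfl : p = ⟨k, Nat.lt_of_succ_lt h⟩ := Fin.ext h1
      rw [swapAt_left]
      exact (swapAt_left h' _).trans (Fin.append_right I J ⟨k + 1, h⟩)
    · by_cases h2 : (p : ℕ) = k + 1
      · obtain rfl : p = ⟨k + 1, h⟩ := Fin.ext h2
        rw [swapAt_right]
        exact (swapAt_right h' _).trans (Fin.append_right I J ⟨k, Nat.lt_of_succ_lt h⟩)
      · rw [swapAt_ne h _ p h1 h2, swapAt_ne h' _ _ (by simp; omega) (by simp; omega),
          Fin.append_right]
  | left p =>
    rw [Fin.append_left, swapAt_ne h' _ _ (by simp; omega) (by simp; omega), Fin.append_left]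

theorem heckeT_tmul_left (q : K) {n d₁ d₂ k : ℕ} (h : k + 1 < d₁) (x : TensorPow K n d₁)
    (y : TensorPow K n d₂) :
    heckeT q n (d₁ + d₂) k (tmul K n d₁ d₂ x y) = tmul K n d₁ d₂ (heckeT q n d₁ k x) y := by
  have h' : k + 1 < d₁ + d₂ := by omega
  have := bilin_ext (f := (tmul K n d₁ d₂).compr₂ (heckeT q n (d₁ + d₂) k))
    (g := (tmul K n d₁ d₂) ∘ₗ heckeT q n d₁ k) (fun I J => by
      have e1 : Fin.append I J ⟨k, Nat.lt_of_succ_lt h'⟩ = I ⟨k, Nat.lt_of_succ_lt h⟩ :=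
        Fin.append_left I J ⟨k, Nat.lt_of_succ_lt h⟩
      have e2 : Fin.append I J ⟨k + 1, h'⟩ = I ⟨k + 1, h⟩ := Fin.append_left I J ⟨k + 1, h⟩
      simp only [LinearMap.compr₂_apply, LinearMap.comp_apply, tmul_tens, heckeT_tens q h,
        heckeT_tens q h', e1, e2, swapAt_append_left h h']
      split_ifs <;>
      simp only [map_add, map_smul, LinearMap.add_apply, LinearMap.smul_apply, tmul_tens])
  exact LinearMap.congr_fun₂ this x y

theorem heckeT_tmul_right (q : K) {n d₁ d₂ k : ℕ} (x : TensorPow K n d₁)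
    (y : TensorPow K n d₂) :
    heckeT q n (d₁ + d₂) (d₁ + k) (tmul K n d₁ d₂ x y) =
      tmul K n d₁ d₂ x (heckeT q n d₂ k y) := by
  by_cases h : k + 1 < d₂
  swap
  · rw [heckeT_of_not q h, heckeT_of_not q (by omega)]; simp
  have h' : d₁ + k + 1 < d₁ + d₂ := by omega
  have := bilin_ext (f := (tmul K n d₁ d₂).compr₂ (heckeT q n (d₁ + d₂) (d₁ + k)))
    (g := (tmul K n d₁ d₂).compl₂ (heckeT q n d₂ k)) (fun I J => by
      have e1 : Fin.append I J ⟨d₁ + k, Nat.lt_of_succ_lt h'⟩ = J ⟨k, Nat.lt_of_succ_lt h⟩ :=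
        Fin.append_right I J ⟨k, Nat.lt_of_succ_lt h⟩
      have e2 : Fin.append I J ⟨d₁ + k + 1, h'⟩ = J ⟨k + 1, h⟩ :=
        Fin.append_right I J ⟨k + 1, h⟩
      simp only [LinearMap.compr₂_apply, LinearMap.compl₂_apply, tmul_tens, heckeT_tens q h,
        heckeT_tens q h', e1, e2, swapAt_append_right h h']
      split_ifs <;>
      simp only [map_add, map_smul, tmul_tens])
  exact LinearMap.congr_fun₂ this x y

def castT {n d d' : ℕ} (h : d = d') : TensorPow K n d →ₗ[K] TensorPow K n d' :=
  Finsupp.lmapDomain K K fun I => I ∘ Fin.cast h.symm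

theorem castT_rfl {n d : ℕ} (x : TensorPow K n d) : castT rfl x = x :=
  Finsupp.mapDomain_id

theorem castT_tens {n d d' : ℕ} (h : d = d') (I : Fin d → Fin n) :
    castT h (tens K I) = tens K (I ∘ Fin.cast h.symm) := by
  simp [castT]

theorem castT_blk (q : K) {n d d' : ℕ} (h : d = d') (s i b : ℕ) (x : TensorPow K n d) :
    castT h (blk (heckeT q n d) s i b x) = blk (heckeT q n d') s i b (castT h x) := by
  subst h; simp only [castT_rfl]

theorem castT_tmul_assoc {n d₁ d₂ d₃ : ℕ} (x : TensorPow K n d₁) (y : TensorPow K n d₂)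
    (z : TensorPow K n d₃) :
    castT (Nat.add_assoc d₁ d₂ d₃) (tmul K n _ _ (tmul K n _ _ x y) z) =
      tmul K n _ _ x (tmul K n _ _ y z) := by
  induction x using Finsupp.induction_linear with
  | zero => simp
  | add x x' h h' => simp only [map_add, LinearMap.add_apply, h, h']
  | single I a =>
  induction y using Finsupp.induction_linear with
  | zero => simp
  | add x x' h h' => simp only [map_add, LinearMap.add_apply, h, h']
  | single J b =>
  induction z using Finsupp.induction_linear with
  | zero => simp
  | add x x' h h' => simp only [map_add, h, h']
  | single L c =>
  rw [← Finsupp.smul_single_one I a, ← Finsupp.smul_single_one J b,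
    ← Finsupp.smul_single_one L c]
  simp only [map_smul, LinearMap.smul_apply, tmul_tens, castT_tens, Fin.append_assoc]
  rfl

theorem blk_tmul_left (q : K) {n d₁ d₂ s i b : ℕ} (h : s + i + b ≤ d₁) (x : TensorPow K n d₁)
    (y : TensorPow K n d₂) :
    blk (heckeT q n (d₁ + d₂)) s i b (tmul K n d₁ d₂ x y) =
      tmul K n d₁ d₂ (blk (heckeT q n d₁) s i b x) y := by
  have hdown : ∀ s i (x : TensorPow K n d₁), s + i + 1 ≤ d₁ →
      down (heckeT q n (d₁ + d₂)) s i (tmul K n d₁ d₂ x y) =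
      tmul K n d₁ d₂ (down (heckeT q n d₁) s i x) y := by
    intro s i
    induction i with
    | zero => intro x _; rfl
    | succ i ih =>
      intro x h
      simp only [down, Module.End.mul_apply]
      rw [heckeT_tmul_left q (by omega), ih _ (by omega)]
  induction b with
  | zero => rfl
  | succ b ih =>
    simp only [blk, Module.End.mul_apply]
    rw [ih (by omega), hdown _ _ _ (by omega)]

theorem blk_tmul_right (q : K) {n d₁ d₂ s i b : ℕ} (x : TensorPow K n d₁)
    (y : TensorPow K n d₂) :
    blk (heckeT q n (d₁ + d₂)) (d₁ + s) i b (tmul K n d₁ d₂ x y) =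
      tmul K n d₁ d₂ x (blk (heckeT q n d₂) s i b y) := by
  have hdown : ∀ s i (y : TensorPow K n d₂),
      down (heckeT q n (d₁ + d₂)) (d₁ + s) i (tmul K n d₁ d₂ x y) =
      tmul K n d₁ d₂ x (down (heckeT q n d₂) s i y) := by
    intro s i
    induction i with
    | zero => intro x; rfl
    | succ i ih =>
      intro y
      simp only [down, Module.End.mul_apply]
      rw [add_assoc, heckeT_tmul_right q, ih _]
  induction b with
  | zero => rfl
  | succ b ih =>
    simp only [blk, Module.End.mul_apply]
    rw [ih, add_assoc, hdown _ _ _]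

/-- Concatenate and braid the exterior part of the first argument past the symmetric part of the
second one. -/
def mulRep (q : Kˣ) (n d₁ i d₂ j : ℕ) :
    TensorPow K n d₁ →ₗ[K] TensorPow K n d₂ →ₗ[K] TensorPow K n (d₁ + d₂) :=
  (tmul K n d₁ d₂).compr₂ (blk (heckeT (q : K) n (d₁ + d₂)) (d₁ - i) i (d₂ - j))

theorem mulRep_apply (q : Kˣ) (n d₁ i d₂ j : ℕ) (x : TensorPow K n d₁) (y : TensorPow K n d₂) :
    mulRep q n d₁ i d₂ j x y =
      blk (heckeT (q : K) n (d₁ + d₂)) (d₁ - i) i (d₂ - j) (tmul K n d₁ d₂ x y) := rfl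

theorem mulRep_left_mem (q : Kˣ) {n d₁ i d₂ j : ℕ} (hi : i ≤ d₁) (hj : j ≤ d₂)
    (x : TensorPow K n d₁) (y : TensorPow K n d₂) (hx : x ∈ relSub q n d₁ i) :
    mulRep q n d₁ i d₂ j x y ∈ relSub q n (d₁ + d₂) (i + j) := by
  have hB := heckeT_rel (q : K) q.ne_zero n (d₁ + d₂)
  suffices h : relSub q n d₁ i ≤
      (relSub q n (d₁ + d₂) (i + j)).comap ((mulRep q n d₁ i d₂ j).flip y) from h hx
  refine relSub_le q hi _ (fun k x hk => ?_) fun k x hk hk' hx => ?_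
  · have e : Commute (heckeT (q : K) n (d₁ + d₂) k)
        (blk (heckeT (q : K) n (d₁ + d₂)) (d₁ - i) i (d₂ - j)) :=
      commute_blk fun j _ _ => hB.comm (by omega)
    have e' := LinearMap.congr_fun e.eq (tmul K n d₁ d₂ x y)
    simp only [Module.End.mul_apply] at e'
    rw [Submodule.mem_comap, LinearMap.flip_apply, map_sub, map_smul, LinearMap.sub_apply,
      LinearMap.smul_apply, mulRep_apply, mulRep_apply, ← heckeT_tmul_left _ (by omega), ← e']
    exact sym_mem q (by omega) _
  · have e' := LinearMap.congr_fun (blk_conj_left hB (s := d₁ - i) (i := i) (b := d₂ - j)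
      hk (by omega)) (tmul K n d₁ d₂ x y)
    simp only [Module.End.mul_apply] at e'
    rw [Submodule.mem_comap, LinearMap.flip_apply, mulRep_apply]
    refine ext_mem q (k := k + (d₂ - j)) (by omega) (by omega) _ ?_
    rw [e', heckeT_tmul_left _ (by omega), hx]
    simp only [map_smul, LinearMap.smul_apply]

theorem mulRep_right_mem (q : Kˣ) {n d₁ i d₂ j : ℕ} (hi : i ≤ d₁) (hj : j ≤ d₂)
    (x : TensorPow K n d₁) (y : TensorPow K n d₂) (hy : y ∈ relSub q n d₂ j) :
    mulRep q n d₁ i d₂ j x y ∈ relSub q n (d₁ + d₂) (i + j) := by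
  have hB := heckeT_rel (q : K) q.ne_zero n (d₁ + d₂)
  suffices h : relSub q n d₂ j ≤
      (relSub q n (d₁ + d₂) (i + j)).comap (mulRep q n d₁ i d₂ j x) from h hy
  refine relSub_le q hj _ (fun k y hk => ?_) fun k y hk hk' hy => ?_
  · have e' := LinearMap.congr_fun (blk_conj_right hB (s := d₁ - i) (i := i) (b := d₂ - j)
      (k := d₁ - i + k) (by omega) (by omega)) (tmul K n d₁ d₂ x y)
    rw [show d₁ - i + k + i = d₁ + k by omega] at e'
    simp only [Module.End.mul_apply] at e'
    rw [Submodule.mem_comap, map_sub, map_smul, mulRep_apply, mulRep_apply,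
      ← heckeT_tmul_right, ← e']
    exact sym_mem q (by omega) _
  · have e : Commute (heckeT (q : K) n (d₁ + d₂) (d₁ + k))
        (blk (heckeT (q : K) n (d₁ + d₂)) (d₁ - i) i (d₂ - j)) :=
      commute_blk fun j _ _ => hB.comm (by omega)
    have e' := LinearMap.congr_fun e.eq (tmul K n d₁ d₂ x y)
    simp only [Module.End.mul_apply] at e'
    rw [Submodule.mem_comap, mulRep_apply]
    refine ext_mem q (k := d₁ + k) (by omega) (by omega) _ ?_
    rw [e', heckeT_tmul_right, hy]
    simp only [map_smul]

def Omega.mulAux (q : Kˣ) (n d₁ i d₂ j : ℕ) (hi : i ≤ d₁) (hj : j ≤ d₂) :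
    Omega q n d₁ i →ₗ[K] Omega q n d₂ j →ₗ[K] Omega q n (d₁ + d₂) (i + j) :=
  (relSub q n d₁ i).liftQ
    ((relSub q n d₂ j).liftQ
      ((mulRep q n d₁ i d₂ j).compr₂ (Omega.mk q n (d₁ + d₂) (i + j))).flip
      (fun y hy => LinearMap.ext fun x =>
        (Omega.mk_eq_zero q).2 (mulRep_right_mem q hi hj x y hy))).flip
    (fun x hx => LinearMap.ext fun y => by
      obtain ⟨y, rfl⟩ := Omega.mk_surjective q n d₂ j y
      exact (Omega.mk_eq_zero q).2 (mulRep_left_mem q hi hj x y hx))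

/-- The product `(S_q^{d₁-i} ⊗ Λ_q^i) ⊗ (S_q^{d₂-j} ⊗ Λ_q^j) → S_q^{d₁+d₂-i-j} ⊗ Λ_q^{i+j}`,
`(a ⊗ b)(c ⊗ d) = (μ ⊗ μ)(a ⊗ R(b ⊗ c) ⊗ d)` with `R` the braiding (see `Omega.mul_mk`). -/
def Omega.mul (q : Kˣ) (n d₁ i d₂ j : ℕ) :
    Omega q n d₁ i →ₗ[K] Omega q n d₂ j →ₗ[K] Omega q n (d₁ + d₂) (i + j) :=
  if h : i ≤ d₁ ∧ j ≤ d₂ then Omega.mulAux q n d₁ i d₂ j h.1 h.2 else 0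

theorem Omega.mul_mk (q : Kˣ) {n d₁ i d₂ j : ℕ} (hi : i ≤ d₁) (hj : j ≤ d₂)
    (x : TensorPow K n d₁) (y : TensorPow K n d₂) :
    Omega.mul q n d₁ i d₂ j (Omega.mk q n d₁ i x) (Omega.mk q n d₂ j y) =
      Omega.mk q n (d₁ + d₂) (i + j) (mulRep q n d₁ i d₂ j x y) := by
  have e : Omega.mul q n d₁ i d₂ j = Omega.mulAux q n d₁ i d₂ j hi hj := dif_pos ⟨hi, hj⟩
  rw [e]; rfl

/-- `Ω^i_d(n)` indexed by the pair `(d, i)`. -/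
abbrev OmegaGr (q : Kˣ) (n : ℕ) (p : ℕ × ℕ) : Type _ := Omega q n p.1 p.2

theorem Omega.mk_cast (q : Kˣ) {n d d' i i' : ℕ} (h : d = d') (hi : i = i')
    (x : TensorPow K n d) (x' : TensorPow K n d') (hx : castT h x = x') :
    GradedMonoid.mk (A := OmegaGr q n) (d, i) (Omega.mk q n d i x) =
      GradedMonoid.mk (A := OmegaGr q n) (d', i') (Omega.mk q n d' i' x') := by
  subst h hi; rw [castT_rfl] at hx; rw [hx]

theorem Omega.zero_cast (q : Kˣ) {n : ℕ} {p p' : ℕ × ℕ} (h : p = p') :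
    GradedMonoid.mk (A := OmegaGr q n) p 0 = GradedMonoid.mk (A := OmegaGr q n) p' 0 := by
  subst h; rfl

theorem Omega.gmul_assoc (q : Kˣ) (n : ℕ) {p₁ p₂ p₃ : ℕ × ℕ} (x : OmegaGr q n p₁)
    (y : OmegaGr q n p₂) (z : OmegaGr q n p₃) :
    GradedMonoid.mk (A := OmegaGr q n) (p₁ + p₂ + p₃)
      (Omega.mul q n _ _ _ _ (Omega.mul q n _ _ _ _ x y) z) =
    GradedMonoid.mk (A := OmegaGr q n) (p₁ + (p₂ + p₃))
      (Omega.mul q n _ _ _ _ x (Omega.mul q n _ _ _ _ y z)) := by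
  obtain ⟨d₁, i₁⟩ := p₁
  obtain ⟨d₂, i₂⟩ := p₂
  obtain ⟨d₃, i₃⟩ := p₃
  rcases Nat.lt_or_ge d₁ i₁ with h1 | h1
  · rw [Omega.eq_zero_of_lt q h1 x]
    simp only [map_zero, LinearMap.zero_apply]
    exact Omega.zero_cast q (add_assoc _ _ _)
  rcases Nat.lt_or_ge d₂ i₂ with h2 | h2
  · rw [Omega.eq_zero_of_lt q h2 y]
    simp only [map_zero, LinearMap.zero_apply]
    exact Omega.zero_cast q (add_assoc _ _ _)
  rcases Nat.lt_or_ge d₃ i₃ with h3 | h3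
  · rw [Omega.eq_zero_of_lt q h3 z]
    simp only [map_zero]
    exact Omega.zero_cast q (add_assoc _ _ _)
  obtain ⟨x, rfl⟩ := Omega.mk_surjective q n d₁ i₁ x
  obtain ⟨y, rfl⟩ := Omega.mk_surjective q n d₂ i₂ y
  obtain ⟨z, rfl⟩ := Omega.mk_surjective q n d₃ i₃ z
  change GradedMonoid.mk (A := OmegaGr q n) (d₁ + d₂ + d₃, i₁ + i₂ + i₃)
      (Omega.mul q n (d₁ + d₂) (i₁ + i₂) d₃ i₃ (Omega.mul q n d₁ i₁ d₂ i₂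
        (Omega.mk q n d₁ i₁ x) (Omega.mk q n d₂ i₂ y)) (Omega.mk q n d₃ i₃ z)) =
    GradedMonoid.mk (A := OmegaGr q n) (d₁ + (d₂ + d₃), i₁ + (i₂ + i₃))
      (Omega.mul q n d₁ i₁ (d₂ + d₃) (i₂ + i₃) (Omega.mk q n d₁ i₁ x) (Omega.mul q n d₂ i₂ d₃ i₃
        (Omega.mk q n d₂ i₂ y) (Omega.mk q n d₃ i₃ z)))
  rw [Omega.mul_mk q h1 h2, Omega.mul_mk q h2 h3, Omega.mul_mk q (by omega) h3,
    Omega.mul_mk q h1 (by omega)]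
  refine Omega.mk_cast q (add_assoc _ _ _) (add_assoc _ _ _) _ _ ?_
  have hB := heckeT_rel (q : K) q.ne_zero n (d₁ + (d₂ + d₃))
  simp only [mulRep_apply]
  rw [castT_blk, ← blk_tmul_left _ (by omega), castT_blk, castT_tmul_assoc, ← blk_tmul_right]
  rw [show d₁ + d₂ - (i₁ + i₂) = (d₁ - i₁) + (d₂ - i₂) by omega, blk_add_left hB,
    show d₂ + d₃ - (i₂ + i₃) = (d₂ - i₂) + (d₃ - i₃) by omega, blk_add_right,
    show d₁ - i₁ + (d₂ - i₂) + i₁ = d₁ + (d₂ - i₂) by omega]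
  simp only [Module.End.mul_apply]
  congr 1
  have e : Commute (blk (heckeT (q : K) n (d₁ + (d₂ + d₃))) (d₁ + (d₂ - i₂)) i₂ (d₃ - i₃))
      (blk (heckeT (q : K) n (d₁ + (d₂ + d₃))) (d₁ - i₁) i₁ (d₂ - i₂)) :=
    commute_blk fun j _ _ => Commute.symm <| commute_blk fun j' _ _ => hB.comm (by omega)
  exact LinearMap.congr_fun e.eq _

/-- The unit of `⨁ Ω^i_d(n)`. -/
def Omega.one (q : Kˣ) (n : ℕ) : Omega q n 0 0 := Omega.mk q n 0 0 (tens K Fin.elim0)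

theorem Omega.one_gmul (q : Kˣ) (n : ℕ) {p : ℕ × ℕ} (x : OmegaGr q n p) :
    GradedMonoid.mk (A := OmegaGr q n) (0 + p) (Omega.mul q n 0 0 _ _ (Omega.one q n) x) =
    GradedMonoid.mk (A := OmegaGr q n) p x := by
  obtain ⟨d, i⟩ := p
  rcases Nat.lt_or_ge d i with h | h
  · rw [Omega.eq_zero_of_lt q h x, map_zero]
    exact Omega.zero_cast q (zero_add _)
  obtain ⟨x, rfl⟩ := Omega.mk_surjective q n d i x
  rw [Omega.one, Omega.mul_mk q le_rfl h]
  refine Omega.mk_cast q (zero_add _) (zero_add _) _ _ ?_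
  rw [mulRep_apply, blk_zero_left, Module.End.one_apply]
  induction x using Finsupp.induction_linear with
  | zero => simp
  | add x x' h h' => simp only [map_add, h, h']
  | single I a =>
    rw [← Finsupp.smul_single_one I a, map_smul, map_smul, tmul_tens, castT_tens]
    congr 2
    rw [Fin.elim0_append]; rfl

theorem Omega.gmul_one (q : Kˣ) (n : ℕ) {p : ℕ × ℕ} (x : OmegaGr q n p) :
    GradedMonoid.mk (A := OmegaGr q n) (p + 0) (Omega.mul q n _ _ 0 0 x (Omega.one q n)) =
    GradedMonoid.mk (A := OmegaGr q n) p x := by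
  obtain ⟨d, i⟩ := p
  rcases Nat.lt_or_ge d i with h | h
  · rw [Omega.eq_zero_of_lt q h x, map_zero, LinearMap.zero_apply]
    exact Omega.zero_cast q (add_zero _)
  obtain ⟨x, rfl⟩ := Omega.mk_surjective q n d i x
  rw [Omega.one, Omega.mul_mk q h le_rfl]
  refine Omega.mk_cast q (add_zero _) (add_zero _) _ _ ?_
  rw [mulRep_apply]
  change (castT _) ((tmul K n d 0) x (tens K Fin.elim0)) = x
  induction x using Finsupp.induction_linear with
  | zero => simp
  | add x x' h h' => simp only [map_add, LinearMap.add_apply, h, h']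
  | single I a =>
    rw [← Finsupp.smul_single_one I a, map_smul, LinearMap.smul_apply, map_smul, tmul_tens, castT_tens]
    congr 2
    rw [Fin.append_elim0]; rfl

instance (q : Kˣ) (n : ℕ) : GradedMonoid.GMul (OmegaGr q n) where
  mul x y := Omega.mul q n _ _ _ _ x y

instance (q : Kˣ) (n : ℕ) : GradedMonoid.GOne (OmegaGr q n) where
  one := Omega.one q n

instance (q : Kˣ) (n : ℕ) : DirectSum.GRing (OmegaGr q n) where
  mul_zero x := map_zero _
  zero_mul y := LinearMap.map_zero₂ (Omega.mul q n _ _ _ _) y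
  mul_add x y z := map_add _ _ _
  add_mul x y z := LinearMap.map_add₂ (Omega.mul q n _ _ _ _) x y z
  one_mul := fun ⟨_, x⟩ => Omega.one_gmul q n x
  mul_one := fun ⟨_, x⟩ => Omega.gmul_one q n x
  mul_assoc := fun ⟨_, x⟩ ⟨_, y⟩ ⟨_, z⟩ => Omega.gmul_assoc q n x y z
  natCast m := m • Omega.one q n
  natCast_zero := zero_smul _ _
  natCast_succ m := succ_nsmul _ _
  intCast m := m • Omega.one q n
  intCast_ofNat m := natCast_zsmul _ _
  intCast_negSucc_ofNat m := negSucc_zsmul _ _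

theorem Omega.smul_cast (q : Kˣ) {n : ℕ} (r : K) {p p' : ℕ × ℕ} {x : OmegaGr q n p}
    {x' : OmegaGr q n p'} (h : GradedMonoid.mk p x = GradedMonoid.mk p' x') :
    GradedMonoid.mk p (r • x) = GradedMonoid.mk p' (r • x') := by
  cases h; rfl

instance (q : Kˣ) (n : ℕ) : DirectSum.GAlgebra K (OmegaGr q n) where
  toFun := (LinearMap.toSpanSingleton K (Omega q n 0 0) (Omega.one q n)).toAddMonoidHom
  map_one := one_smul K (Omega.one q n)
  map_mul r s := by
    refine Eq.symm (Eq.trans ?_ (Omega.smul_cast q (r * s) (Omega.one_gmul q n (p := 0)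
      (Omega.one q n))))
    change GradedMonoid.mk (A := OmegaGr q n) (0 + 0)
      (Omega.mul q n 0 0 0 0 (r • Omega.one q n) (s • Omega.one q n)) = _
    rw [map_smul, map_smul, LinearMap.smul_apply, smul_smul, mul_comm]
    rfl
  commutes := fun r ⟨p, x⟩ => by
    change GradedMonoid.mk (A := OmegaGr q n) (0 + p)
      (Omega.mul q n 0 0 _ _ (r • Omega.one q n) x) = GradedMonoid.mk (A := OmegaGr q n) (p + 0)
      (Omega.mul q n _ _ 0 0 x (r • Omega.one q n))
    rw [map_smul, map_smul, LinearMap.smul_apply]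
    exact Omega.smul_cast q r ((Omega.one_gmul q n x).trans (Omega.gmul_one q n x).symm)
  smul_def := fun r ⟨p, x⟩ => by
    change GradedMonoid.mk (A := OmegaGr q n) p (r • x) = GradedMonoid.mk (A := OmegaGr q n) (0 + p)
      (Omega.mul q n 0 0 _ _ (r • Omega.one q n) x)
    rw [map_smul, LinearMap.smul_apply]
    exact Omega.smul_cast q r (Omega.one_gmul q n x).symm

end Product
end QuantumDeRham

namespace QuantumDeRham

noncomputable section Homol

variable {K : Type*} [Field K]

theorem up_tmul_left (q : K) {n d₁ d₂ s m : ℕ} (h : s + m < d₁) (x : TensorPow K n d₁)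
    (y : TensorPow K n d₂) :
    up (heckeT q n (d₁ + d₂)) s m (tmul K n d₁ d₂ x y) =
      tmul K n d₁ d₂ (up (heckeT q n d₁) s m x) y := by
  induction m with
  | zero => rfl
  | succ m ih =>
    simp only [up, Module.End.mul_apply]
    rw [ih (by omega), heckeT_tmul_left q (by omega)]

theorem up_tmul_right (q : K) {n d₁ d₂ s m : ℕ} (x : TensorPow K n d₁) (y : TensorPow K n d₂) :
    up (heckeT q n (d₁ + d₂)) (d₁ + s) m (tmul K n d₁ d₂ x y) =
      tmul K n d₁ d₂ x (up (heckeT q n d₂) s m y) := by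
  induction m with
  | zero => rfl
  | succ m ih =>
    simp only [up, Module.End.mul_apply]
    rw [ih, add_assoc, heckeT_tmul_right q]

theorem up_blk {M : Type*} [Monoid M] {T : ℕ → M} (h : BraidRel T) {s i b r m : ℕ}
    (hr : r + m < b) :
    up T (s + r) m * blk T s i b = blk T s i b * up T (s + i + r) m := by
  induction m with
  | zero => simp [up]
  | succ m ih =>
    simp only [up]
    rw [mul_assoc, ih (by omega), ← mul_assoc, blk_conj_right h (by omega) (by omega), mul_assoc,
      show s + r + m + i = s + i + r + m by omega]

theorem down_mem (q : Kˣ) {n d i s : ℕ} (hs : d - i ≤ s) (m : ℕ) (hm : s + m < d)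
    (z : TensorPow K n d) :
    down (heckeT (q : K) n d) s m z - (-(q : K)⁻¹) ^ m • z ∈ relSub q n d i := by
  induction m generalizing z with
  | zero => simp [down]
  | succ m ih =>
    have h1 := ih (by omega) (heckeT (q : K) n d (s + m) z)
    have h2 := Submodule.smul_mem _ ((-(q : K)⁻¹) ^ m)
      (ext_mem' q (i := i) (k := s + m) (by omega) (by omega) z)
    have h3 := Submodule.add_mem _ h1 h2
    convert h3 using 1
    simp only [down, Module.End.mul_apply]
    rw [pow_succ]
    module

theorem leibniz (q : Kˣ) {n d₁ i d₂ j : ℕ} (hi : i ≤ d₁) (hj : j ≤ d₂) (x : TensorPow K n d₁)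
    (y : TensorPow K n d₂) :
    shuffle (q : K) n (d₁ + d₂) (d₁ + d₂ - (i + j)) (mulRep q n d₁ i d₂ j x y) -
      ((q : K) ^ (d₂ - j) • mulRep q n d₁ (i + 1) d₂ j (shuffle (q : K) n d₁ (d₁ - i) x) y +
      (-(q : K)⁻¹) ^ i • mulRep q n d₁ i d₂ (j + 1) x (shuffle (q : K) n d₂ (d₂ - j) y)) ∈
      relSub q n (d₁ + d₂) (i + j + 1) := by
  have hB := heckeT_rel (q : K) q.ne_zero n (d₁ + d₂)
  have first : ∑ p ∈ Finset.range (d₁ - i), (q : K) ^ (d₁ - i + (d₂ - j) - 1 - p) •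
      up (heckeT (q : K) n (d₁ + d₂)) p (d₁ - i + (d₂ - j) - 1 - p) (mulRep q n d₁ i d₂ j x y) =
      (q : K) ^ (d₂ - j) • mulRep q n d₁ (i + 1) d₂ j (shuffle (q : K) n d₁ (d₁ - i) x) y := by
    simp only [shuffle, LinearMap.sum_apply, map_sum, LinearMap.smul_apply, map_smul,
      Finset.smul_sum, smul_smul]
    refine Finset.sum_congr rfl fun p hp => ?_
    rw [Finset.mem_range] at hp
    obtain ⟨a, ha⟩ : ∃ a, d₁ - i = a + 1 := ⟨d₁ - i - 1, by omega⟩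
    rw [← pow_add, ha, show d₂ - j + (a + 1 - 1 - p) = a + 1 + (d₂ - j) - 1 - p by omega]
    congr 1
    rw [mulRep_apply, mulRep_apply, ← up_tmul_left _ (by omega),
      show a + 1 + (d₂ - j) - 1 - p = (a - p) + (d₂ - j) by omega, up_add, ha,
      show d₁ - (i + 1) = a by omega, add_comm i 1, blk_add_left hB, blk_one,
      show p + (a - p) = a by omega, show a + 1 - 1 - p = a - p by omega]
    have e : Commute (up (heckeT (q : K) n (d₁ + d₂)) p (a - p))
        (blk (heckeT (q : K) n (d₁ + d₂)) (a + 1) i (d₂ - j)) :=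
      commute_blk fun j _ _ => Commute.symm <| commute_up fun j' _ _ => hB.comm (by omega)
    have e' := LinearMap.congr_fun e.eq (tmul K n d₁ d₂ x y)
    simp only [Module.End.mul_apply] at e' ⊢
    rw [e']
  have second : ∑ r ∈ Finset.range (d₂ - j),
      (q : K) ^ (d₁ - i + (d₂ - j) - 1 - (d₁ - i + r)) •
      up (heckeT (q : K) n (d₁ + d₂)) (d₁ - i + r) (d₁ - i + (d₂ - j) - 1 - (d₁ - i + r))
        (mulRep q n d₁ i d₂ j x y) =
      mulRep q n d₁ i d₂ j x (shuffle (q : K) n d₂ (d₂ - j) y) := by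
    simp only [shuffle, LinearMap.sum_apply, map_sum, LinearMap.smul_apply, map_smul]
    refine Finset.sum_congr rfl fun r hr => ?_
    rw [Finset.mem_range] at hr
    rw [show d₁ - i + (d₂ - j) - 1 - (d₁ - i + r) = d₂ - j - 1 - r by omega]
    congr 1
    rw [mulRep_apply, mulRep_apply, ← up_tmul_right]
    have e' := LinearMap.congr_fun (up_blk hB (s := d₁ - i) (i := i) (b := d₂ - j) (r := r)
      (m := d₂ - j - 1 - r) (by omega)) (tmul K n d₁ d₂ x y)
    rw [show d₁ - i + i + r = d₁ + r by omega] at e'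
    exact e'
  have total : shuffle (q : K) n (d₁ + d₂) (d₁ + d₂ - (i + j)) (mulRep q n d₁ i d₂ j x y) =
      (q : K) ^ (d₂ - j) • mulRep q n d₁ (i + 1) d₂ j (shuffle (q : K) n d₁ (d₁ - i) x) y +
      mulRep q n d₁ i d₂ j x (shuffle (q : K) n d₂ (d₂ - j) y) := by
    rw [← first, ← second, show d₁ + d₂ - (i + j) = d₁ - i + (d₂ - j) by omega, shuffle,
      LinearMap.sum_apply, Finset.sum_range_add]
    rfl
  rw [total, add_sub_add_left_eq_sub]
  rcases Nat.eq_zero_or_pos (d₂ - j) with h0 | h0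
  · rw [h0]; simp [shuffle]
  · obtain ⟨b, hb⟩ : ∃ b, d₂ - j = b + 1 := ⟨d₂ - j - 1, by omega⟩
    rw [mulRep_apply, mulRep_apply, hb, show d₂ - (j + 1) = b by omega]
    simp only [blk, Module.End.mul_apply]
    exact down_mem q (by omega) i (by omega) _

theorem shuffle_zero (q : K) (n d : ℕ) : shuffle q n d 0 = 0 := by simp [shuffle]

theorem mulRep_shuffle_left_mem (q : Kˣ) {n d₁ i d₂ j : ℕ} (hi : i ≤ d₁) (hj : j ≤ d₂)
    (x : TensorPow K n d₁) (y : TensorPow K n d₂)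
    (hx : shuffle (q : K) n d₁ (d₁ - i) x ∈ relSub q n d₁ (i + 1)) :
    mulRep q n d₁ (i + 1) d₂ j (shuffle (q : K) n d₁ (d₁ - i) x) y ∈
      relSub q n (d₁ + d₂) (i + j + 1) := by
  rcases Nat.eq_or_lt_of_le hi with h | h
  · rw [h, Nat.sub_self, shuffle_zero]; simp
  · rw [show i + j + 1 = i + 1 + j by omega]
    exact mulRep_left_mem q h hj _ y hx

theorem mulRep_shuffle_right_mem (q : Kˣ) {n d₁ i d₂ j : ℕ} (hi : i ≤ d₁) (hj : j ≤ d₂)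
    (x : TensorPow K n d₁) (y : TensorPow K n d₂)
    (hy : shuffle (q : K) n d₂ (d₂ - j) y ∈ relSub q n d₂ (j + 1)) :
    mulRep q n d₁ i d₂ (j + 1) x (shuffle (q : K) n d₂ (d₂ - j) y) ∈
      relSub q n (d₁ + d₂) (i + j + 1) := by
  rcases Nat.eq_or_lt_of_le hj with h | h
  · rw [h, Nat.sub_self, shuffle_zero]; simp
  · exact mulRep_right_mem q hi h x _ hy

/-- The cycles of the quantum de Rham complex `Ω_d(n)` in degree `i`. -/
def cycles (q : Kˣ) (n d i : ℕ) : Submodule K (Omega q n d i) := LinearMap.ker (delta q n d i)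

/-- The boundaries of the quantum de Rham complex `Ω_d(n)` in degree `i`. -/
def boundaries (q : Kˣ) (n d : ℕ) : (i : ℕ) → Submodule K (Omega q n d i)
  | 0 => ⊥
  | i + 1 => LinearMap.range (delta q n d i)

theorem mk_mem_cycles (q : Kˣ) {n d i : ℕ} {x : TensorPow K n d} :
    Omega.mk q n d i x ∈ cycles q n d i ↔
      shuffle (q : K) n d (d - i) x ∈ relSub q n d (i + 1) := by
  rw [cycles, LinearMap.mem_ker, delta_mk, Omega.mk_eq_zero]

theorem mem_boundaries (q : Kˣ) {n d i k : ℕ} (h : i + 1 = k) {z w : TensorPow K n d}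
    (hz : shuffle (q : K) n d (d - i) w - z ∈ relSub q n d k) :
    Omega.mk q n d k z ∈ boundaries q n d k := by
  subst h
  exact ⟨Omega.mk q n d i w, by rw [delta_mk, Omega.mk_eq]; exact hz⟩

theorem mul_mem_cycles (q : Kˣ) {n d₁ i d₂ j : ℕ} {x : Omega q n d₁ i} {y : Omega q n d₂ j}
    (hx : x ∈ cycles q n d₁ i) (hy : y ∈ cycles q n d₂ j) :
    Omega.mul q n d₁ i d₂ j x y ∈ cycles q n (d₁ + d₂) (i + j) := by
  rcases Nat.lt_or_ge d₁ i with hi | hi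
  · rw [Omega.eq_zero_of_lt q hi x, LinearMap.map_zero₂]; exact Submodule.zero_mem _
  rcases Nat.lt_or_ge d₂ j with hj | hj
  · rw [Omega.eq_zero_of_lt q hj y, map_zero]; exact Submodule.zero_mem _
  obtain ⟨x, rfl⟩ := Omega.mk_surjective q n d₁ i x
  obtain ⟨y, rfl⟩ := Omega.mk_surjective q n d₂ j y
  rw [mk_mem_cycles] at hx hy
  rw [Omega.mul_mk q hi hj, mk_mem_cycles]
  have h1 := Submodule.smul_mem _ ((q : K) ^ (d₂ - j)) (mulRep_shuffle_left_mem q hi hj x y hx)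
  have h2 := Submodule.smul_mem _ ((-(q : K)⁻¹) ^ i) (mulRep_shuffle_right_mem q hi hj x y hy)
  exact (Submodule.sub_mem_iff_left _ (Submodule.add_mem _ h1 h2)).1 (leibniz q hi hj x y)

theorem mul_left_mem_boundaries (q : Kˣ) {n d₁ i d₂ j : ℕ} {x : Omega q n d₁ i}
    {y : Omega q n d₂ j} (hx : x ∈ boundaries q n d₁ i) (hy : y ∈ cycles q n d₂ j) :
    Omega.mul q n d₁ i d₂ j x y ∈ boundaries q n (d₁ + d₂) (i + j) := by
  rcases Nat.lt_or_ge d₁ i with hi | hi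
  · rw [Omega.eq_zero_of_lt q hi x, LinearMap.map_zero₂]; exact Submodule.zero_mem _
  rcases Nat.lt_or_ge d₂ j with hj | hj
  · rw [Omega.eq_zero_of_lt q hj y, map_zero]; exact Submodule.zero_mem _
  cases i with
  | zero =>
    rw [boundaries, Submodule.mem_bot] at hx
    rw [hx, LinearMap.map_zero₂]; exact Submodule.zero_mem _
  | succ i =>
    obtain ⟨x, rfl⟩ := hx
    obtain ⟨x, rfl⟩ := Omega.mk_surjective q n d₁ i x
    obtain ⟨y, rfl⟩ := Omega.mk_surjective q n d₂ j y
    rw [mk_mem_cycles] at hy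
    rw [delta_mk, Omega.mul_mk q hi hj]
    have hc : (q : K) ^ (d₂ - j) ≠ 0 := pow_ne_zero _ q.ne_zero
    refine mem_boundaries q (i := i + j) (by omega)
      (w := ((q : K) ^ (d₂ - j))⁻¹ • mulRep q n d₁ i d₂ j x y) ?_
    have h2 := Submodule.smul_mem _ ((-(q : K)⁻¹) ^ i)
      (mulRep_shuffle_right_mem q (i := i) (by omega) hj x y hy)
    have h3 := Submodule.smul_mem _ ((q : K) ^ (d₂ - j))⁻¹
      (Submodule.add_mem _ (leibniz q (i := i) (by omega) hj x y) h2)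
    rw [show i + 1 + j = i + j + 1 by omega]
    convert h3 using 1
    rw [map_smul]
    match_scalars <;> field_simp <;> ring

theorem mul_right_mem_boundaries (q : Kˣ) {n d₁ i d₂ j : ℕ} {x : Omega q n d₁ i}
    {y : Omega q n d₂ j} (hx : x ∈ cycles q n d₁ i) (hy : y ∈ boundaries q n d₂ j) :
    Omega.mul q n d₁ i d₂ j x y ∈ boundaries q n (d₁ + d₂) (i + j) := by
  rcases Nat.lt_or_ge d₁ i with hi | hi
  · rw [Omega.eq_zero_of_lt q hi x, LinearMap.map_zero₂]; exact Submodule.zero_mem _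
  rcases Nat.lt_or_ge d₂ j with hj | hj
  · rw [Omega.eq_zero_of_lt q hj y, map_zero]; exact Submodule.zero_mem _
  cases j with
  | zero =>
    rw [boundaries, Submodule.mem_bot] at hy
    rw [hy, map_zero]; exact Submodule.zero_mem _
  | succ j =>
    obtain ⟨y, rfl⟩ := hy
    obtain ⟨x, rfl⟩ := Omega.mk_surjective q n d₁ i x
    obtain ⟨y, rfl⟩ := Omega.mk_surjective q n d₂ j y
    rw [mk_mem_cycles] at hx
    rw [delta_mk, Omega.mul_mk q hi hj]
    have hc : (-(q : K)⁻¹) ^ i ≠ 0 := pow_ne_zero _ (neg_ne_zero.2 (inv_ne_zero q.ne_zero))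
    refine mem_boundaries q (i := i + j) (by omega)
      (w := ((-(q : K)⁻¹) ^ i)⁻¹ • mulRep q n d₁ i d₂ j x y) ?_
    have h2 := Submodule.smul_mem _ ((q : K) ^ (d₂ - j))
      (mulRep_shuffle_left_mem q (j := j) hi (by omega) x y hx)
    have h3 := Submodule.smul_mem _ ((-(q : K)⁻¹) ^ i)⁻¹
      (Submodule.add_mem _ (leibniz q (j := j) hi (by omega) x y) h2)
    rw [← add_assoc]
    convert h3 using 1
    rw [map_smul, ← sub_eq_zero]
    generalize (-(q : K)⁻¹) ^ i = c at hc
    match_scalars <;> field_simp <;> ring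

/-- The homology `H^i(Ω_d(n))`. -/
def Homology (q : Kˣ) (n d i : ℕ) : Type _ :=
  cycles q n d i ⧸ (boundaries q n d i).submoduleOf (cycles q n d i)

instance (q : Kˣ) (n d i : ℕ) : AddCommGroup (Homology q n d i) :=
  inferInstanceAs
    (AddCommGroup (cycles q n d i ⧸ (boundaries q n d i).submoduleOf (cycles q n d i)))

instance (q : Kˣ) (n d i : ℕ) : Module K (Homology q n d i) :=
  inferInstanceAs
    (Module K (cycles q n d i ⧸ (boundaries q n d i).submoduleOf (cycles q n d i)))

/-- The class of a cycle. -/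
def Homology.mk (q : Kˣ) (n d i : ℕ) : cycles q n d i →ₗ[K] Homology q n d i :=
  ((boundaries q n d i).submoduleOf (cycles q n d i)).mkQ

theorem Homology.mk_surjective (q : Kˣ) (n d i : ℕ) : Function.Surjective (Homology.mk q n d i) :=
  Submodule.mkQ_surjective _

theorem Homology.mk_eq_zero (q : Kˣ) {n d i : ℕ} {x : cycles q n d i} :
    Homology.mk q n d i x = 0 ↔ (x : Omega q n d i) ∈ boundaries q n d i :=
  Submodule.Quotient.mk_eq_zero _

def cyclesMul (q : Kˣ) (n d₁ i d₂ j : ℕ) :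
    cycles q n d₁ i →ₗ[K] cycles q n d₂ j →ₗ[K] cycles q n (d₁ + d₂) (i + j) :=
  LinearMap.mk₂ K (fun x y => ⟨Omega.mul q n d₁ i d₂ j x y, mul_mem_cycles q x.2 y.2⟩)
    (fun _ _ _ => Subtype.ext (LinearMap.map_add₂ _ _ _ _))
    (fun _ _ _ => Subtype.ext (LinearMap.map_smul₂ _ _ _ _))
    (fun _ _ _ => Subtype.ext (map_add _ _ _))
    (fun _ _ _ => Subtype.ext (map_smul _ _ _))

/-- The product of classes, induced by the product of cycles. -/
def Homology.mul (q : Kˣ) (n d₁ i d₂ j : ℕ) :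
    Homology q n d₁ i →ₗ[K] Homology q n d₂ j →ₗ[K] Homology q n (d₁ + d₂) (i + j) :=
  ((boundaries q n d₁ i).submoduleOf (cycles q n d₁ i)).liftQ
    (((boundaries q n d₂ j).submoduleOf (cycles q n d₂ j)).liftQ
      ((cyclesMul q n d₁ i d₂ j).compr₂ (Homology.mk q n (d₁ + d₂) (i + j))).flip
      (fun y hy => LinearMap.ext fun x =>
        (Homology.mk_eq_zero q).2 (mul_right_mem_boundaries q x.2 hy))).flip
    (fun x hx => LinearMap.ext fun y => by
      obtain ⟨y, rfl⟩ := Homology.mk_surjective q n d₂ j y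
      exact (Homology.mk_eq_zero q).2 (mul_left_mem_boundaries q hx y.2))

theorem Homology.mul_mk (q : Kˣ) {n d₁ i d₂ j : ℕ} (x : cycles q n d₁ i) (y : cycles q n d₂ j) :
    Homology.mul q n d₁ i d₂ j (Homology.mk q n d₁ i x) (Homology.mk q n d₂ j y) =
      Homology.mk q n (d₁ + d₂) (i + j) (cyclesMul q n d₁ i d₂ j x y) := rfl

/-- `H^i(Ω_d(n))` indexed by the pair `(d, i)`. -/
abbrev HomologyGr (q : Kˣ) (n : ℕ) (p : ℕ × ℕ) : Type _ := Homology q n p.1 p.2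

theorem Homology.mk_cast (q : Kˣ) {n : ℕ} {p p' : ℕ × ℕ} (hp : p = p')
    (x : cycles q n p.1 p.2) (x' : cycles q n p'.1 p'.2)
    (hx : GradedMonoid.mk (A := OmegaGr q n) p x.1 = GradedMonoid.mk (A := OmegaGr q n) p' x'.1) :
    GradedMonoid.mk (A := HomologyGr q n) p (Homology.mk q n _ _ x) =
      GradedMonoid.mk (A := HomologyGr q n) p' (Homology.mk q n _ _ x') := by
  subst hp
  have : x = x' := Subtype.ext (eq_of_heq (Sigma.mk.inj hx).2)
  rw [this]

theorem Homology.smul_cast (q : Kˣ) {n : ℕ} (r : K) {p p' : ℕ × ℕ} {x : HomologyGr q n p}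
    {x' : HomologyGr q n p'} (h : GradedMonoid.mk p x = GradedMonoid.mk p' x') :
    GradedMonoid.mk p (r • x) = GradedMonoid.mk p' (r • x') := by
  cases h; rfl

theorem one_mem_cycles (q : Kˣ) (n : ℕ) : Omega.one q n ∈ cycles q n 0 0 := by
  rw [Omega.one, mk_mem_cycles, Nat.sub_self, shuffle_zero]
  exact Submodule.zero_mem _

def Homology.one (q : Kˣ) (n : ℕ) : Homology q n 0 0 :=
  Homology.mk q n 0 0 ⟨Omega.one q n, one_mem_cycles q n⟩

theorem Homology.one_gmul (q : Kˣ) (n : ℕ) {p : ℕ × ℕ} (x : HomologyGr q n p) :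
    GradedMonoid.mk (A := HomologyGr q n) (0 + p)
      (Homology.mul q n 0 0 _ _ (Homology.one q n) x) =
    GradedMonoid.mk (A := HomologyGr q n) p x := by
  obtain ⟨x, rfl⟩ := Homology.mk_surjective q n _ _ x
  exact Homology.mk_cast q (zero_add p) (cyclesMul q n 0 0 p.1 p.2 _ x) x (Omega.one_gmul q n x.1)

theorem Homology.gmul_one (q : Kˣ) (n : ℕ) {p : ℕ × ℕ} (x : HomologyGr q n p) :
    GradedMonoid.mk (A := HomologyGr q n) (p + 0)
      (Homology.mul q n _ _ 0 0 x (Homology.one q n)) =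
    GradedMonoid.mk (A := HomologyGr q n) p x := by
  obtain ⟨x, rfl⟩ := Homology.mk_surjective q n _ _ x
  exact Homology.mk_cast q (add_zero p) (cyclesMul q n p.1 p.2 0 0 x _) x (Omega.gmul_one q n x.1)

theorem Homology.gmul_assoc (q : Kˣ) (n : ℕ) {p₁ p₂ p₃ : ℕ × ℕ} (x : HomologyGr q n p₁)
    (y : HomologyGr q n p₂) (z : HomologyGr q n p₃) :
    GradedMonoid.mk (A := HomologyGr q n) (p₁ + p₂ + p₃)
      (Homology.mul q n _ _ _ _ (Homology.mul q n _ _ _ _ x y) z) =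
    GradedMonoid.mk (A := HomologyGr q n) (p₁ + (p₂ + p₃))
      (Homology.mul q n _ _ _ _ x (Homology.mul q n _ _ _ _ y z)) := by
  obtain ⟨x, rfl⟩ := Homology.mk_surjective q n _ _ x
  obtain ⟨y, rfl⟩ := Homology.mk_surjective q n _ _ y
  obtain ⟨z, rfl⟩ := Homology.mk_surjective q n _ _ z
  exact Homology.mk_cast q (add_assoc p₁ p₂ p₃)
    (cyclesMul q n _ _ _ _ (cyclesMul q n _ _ _ _ x y) z)
    (cyclesMul q n _ _ _ _ x (cyclesMul q n _ _ _ _ y z)) (Omega.gmul_assoc q n x.1 y.1 z.1)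

instance (q : Kˣ) (n : ℕ) : GradedMonoid.GMul (HomologyGr q n) where
  mul x y := Homology.mul q n _ _ _ _ x y

instance (q : Kˣ) (n : ℕ) : GradedMonoid.GOne (HomologyGr q n) where
  one := Homology.one q n

instance (q : Kˣ) (n : ℕ) : DirectSum.GRing (HomologyGr q n) where
  mul_zero x := map_zero _
  zero_mul y := LinearMap.map_zero₂ (Homology.mul q n _ _ _ _) y
  mul_add x y z := map_add _ _ _
  add_mul x y z := LinearMap.map_add₂ (Homology.mul q n _ _ _ _) x y z
  one_mul := fun ⟨_, x⟩ => Homology.one_gmul q n x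
  mul_one := fun ⟨_, x⟩ => Homology.gmul_one q n x
  mul_assoc := fun ⟨_, x⟩ ⟨_, y⟩ ⟨_, z⟩ => Homology.gmul_assoc q n x y z
  natCast m := m • Homology.one q n
  natCast_zero := zero_smul _ _
  natCast_succ m := succ_nsmul _ _
  intCast m := m • Homology.one q n
  intCast_ofNat m := natCast_zsmul _ _
  intCast_negSucc_ofNat m := negSucc_zsmul _ _

instance (q : Kˣ) (n : ℕ) : DirectSum.GAlgebra K (HomologyGr q n) where
  toFun := (LinearMap.toSpanSingleton K (Homology q n 0 0) (Homology.one q n)).toAddMonoidHom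
  map_one := one_smul K (Homology.one q n)
  map_mul r s := by
    refine Eq.symm (Eq.trans ?_ (Homology.smul_cast q (r * s) (Homology.one_gmul q n (p := 0)
      (Homology.one q n))))
    change GradedMonoid.mk (A := HomologyGr q n) (0 + 0)
      (Homology.mul q n 0 0 0 0 (r • Homology.one q n) (s • Homology.one q n)) = _
    rw [map_smul, map_smul, LinearMap.smul_apply, smul_smul, mul_comm]
    rfl
  commutes := fun r ⟨p, x⟩ => by
    change GradedMonoid.mk (A := HomologyGr q n) (0 + p)
      (Homology.mul q n 0 0 _ _ (r • Homology.one q n) x) =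
      GradedMonoid.mk (A := HomologyGr q n) (p + 0)
      (Homology.mul q n _ _ 0 0 x (r • Homology.one q n))
    rw [map_smul, map_smul, LinearMap.smul_apply]
    exact Homology.smul_cast q r ((Homology.one_gmul q n x).trans (Homology.gmul_one q n x).symm)
  smul_def := fun r ⟨p, x⟩ => by
    change GradedMonoid.mk (A := HomologyGr q n) p (r • x) =
      GradedMonoid.mk (A := HomologyGr q n) (0 + p)
      (Homology.mul q n 0 0 _ _ (r • Homology.one q n) x)
    rw [map_smul, LinearMap.smul_apply]
    exact Homology.smul_cast q r (Homology.one_gmul q n x).symm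

theorem map_mem_cycles {q : Kˣ} {n m d i : ℕ} (f : schur q n m d) :
    cycles q n d i ≤ (cycles q m d i).comap (Omega.map i f) := by
  intro x hx
  rw [cycles, LinearMap.mem_ker] at hx
  rw [Submodule.mem_comap, cycles, LinearMap.mem_ker, delta_map, hx, map_zero]

theorem map_mem_boundaries {q : Kˣ} {n m d i : ℕ} (f : schur q n m d) :
    boundaries q n d i ≤ (boundaries q m d i).comap (Omega.map i f) := by
  cases i with
  | zero => exact bot_le
  | succ i =>
    rintro _ ⟨x, rfl⟩
    exact ⟨Omega.map i f x, delta_map i f x⟩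

/-- Functoriality of `H^i(Ω_d)`. -/
def Homology.map {q : Kˣ} {n m d : ℕ} (i : ℕ) (f : schur q n m d) :
    Homology q n d i →ₗ[K] Homology q m d i :=
  Submodule.mapQ _ _ ((Omega.map i f).restrict (map_mem_cycles f))
    (fun _ hx => map_mem_boundaries f hx)

end Homol
end QuantumDeRham

namespace QuantumDeRham

noncomputable section Frob

variable {K : Type*} [Field K]

/-- The word in which every letter of `I` is repeated `l` times. -/
def rep {n d : ℕ} (l : ℕ) (I : Fin d → Fin n) : Fin (d * l) → Fin n := fun p => I p.divNat

/-- `e_I ↦ e_{I^l}`, where `I^l` repeats each letter `l` times. -/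
def inflate (K : Type*) [Field K] (n d l : ℕ) : TensorPow K n d →ₗ[K] TensorPow K n (d * l) :=
  Finsupp.lmapDomain K K (rep l)

/-- The linear map reading off the coordinates at the words `J^l`. -/
def deflate (K : Type*) [Field K] (n d l : ℕ) : TensorPow K n (d * l) →ₗ[K] TensorPow K n d :=
  (Finsupp.linearEquivFunOnFinite K K (Fin d → Fin n)).symm.toLinearMap ∘ₗ
    LinearMap.pi fun J => Finsupp.lapply (rep l J)

theorem inflate_tens {n d l : ℕ} (I : Fin d → Fin n) :
    inflate K n d l (tens K I) = tens K (rep l I) := by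
  simp [inflate]

theorem deflate_apply {n d l : ℕ} (v : TensorPow K n (d * l)) (J : Fin d → Fin n) :
    deflate K n d l v J = v (rep l J) := rfl

def pair (K : Type*) [Field K] (n d : ℕ) : TensorPow K n d →ₗ[K] TensorPow K n d →ₗ[K] K :=
  Finsupp.linearCombination K fun I => Finsupp.lapply I

theorem pair_tens {n d : ℕ} (I : Fin d → Fin n) (v : TensorPow K n d) :
    pair K n d (tens K I) v = v I := by
  simp [pair]

theorem pair_tens_right {n d : ℕ} (v : TensorPow K n d) (I : Fin d → Fin n) :
    pair K n d v (tens K I) = v I := by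
  have : (pair K n d).flip (tens K I) = Finsupp.lapply I :=
    end_ext fun J => by simp [pair_tens, Finsupp.single_apply, eq_comm]
  exact LinearMap.congr_fun this v

theorem pair_heckeT (q : K) {n d k : ℕ} (x y : TensorPow K n d) :
    pair K n d (heckeT q n d k x) y = pair K n d x (heckeT q n d k y) := by
  by_cases h : k + 1 < d
  swap
  · simp [heckeT_of_not q h]
  have := bilin_ext (f := (pair K n d) ∘ₗ heckeT q n d k)
    (g := (pair K n d).compl₂ (heckeT q n d k)) (fun I J => by
      simp only [LinearMap.compl₂_apply, LinearMap.comp_apply, pair_tens, pair_tens_right]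
      by_cases e : I = J
      · rw [e]
      · have e1 : swapAt h I = J ↔ swapAt h J = I :=
          ⟨fun h' => by rw [← h', swapAt_swapAt], fun h' => by rw [← h', swapAt_swapAt]⟩
        have e2 := swapAt_left h I
        have e3 := swapAt_right h I
        by_cases e4 : swapAt h I = J
        · have e5 := e1.1 e4
          rw [e4] at e2 e3
          have ne : I ⟨k, Nat.lt_of_succ_lt h⟩ ≠ I ⟨k + 1, h⟩ := fun h' =>
            e ((swapAt_eq h I h').symm.trans e4)
          simp only [heckeT_tens q h, e2, e3, e4, e5]
          rcases lt_or_gt_of_ne ne with h1 | h1 <;>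
            simp [h1, h1.not_gt, h1.ne', e, Ne.symm e]
        · have e5 : ¬ swapAt h J = I := fun h' => e4 (e1.2 h')
          simp only [heckeT_tens q h]
          split_ifs <;> simp [Finsupp.single_apply, e, Ne.symm e, e4, e5])
  exact LinearMap.congr_fun₂ this x y

theorem pair_down (q : K) {n d s m : ℕ} (x y : TensorPow K n d) :
    pair K n d (down (heckeT q n d) s m x) y = pair K n d x (up (heckeT q n d) s m y) := by
  induction m generalizing x y with
  | zero => rfl
  | succ m ih =>
    simp only [up, down, Module.End.mul_apply]
    rw [ih, pair_heckeT]

theorem pair_blk (q : K) (hq : q ≠ 0) {n d s i b : ℕ} (x y : TensorPow K n d) :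
    pair K n d (blk (heckeT q n d) s i b x) y = pair K n d x (blk (heckeT q n d) s b i y) := by
  induction b generalizing x y with
  | zero => rw [blk_zero_left]; rfl
  | succ b ih =>
    rw [blk_add_left (heckeT_rel q hq n d), blk_one]
    simp only [blk, Module.End.mul_apply]
    rw [pair_down, ih]

theorem schur_down {q : Kˣ} {n m d : ℕ} (f : schur q n m d) (s r : ℕ) (x : TensorPow K n d) :
    f.1 (down (heckeT (q : K) n d) s r x) = down (heckeT (q : K) m d) s r (f.1 x) := by
  induction r generalizing x with
  | zero => rfl
  | succ r ih => simp only [down, Module.End.mul_apply]; rw [ih, schur_apply f.2]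

theorem schur_blk {q : Kˣ} {n m d : ℕ} (f : schur q n m d) (s i b : ℕ) (x : TensorPow K n d) :
    f.1 (blk (heckeT (q : K) n d) s i b x) = blk (heckeT (q : K) m d) s i b (f.1 x) := by
  induction b with
  | zero => rfl
  | succ b ih => simp only [blk, Module.End.mul_apply]; rw [schur_down, ih]

/- Auxiliary computations for the quantum Frobenius map. -/

theorem down_inv (q : K) (hq : q ≠ 0) {n d s l : ℕ} (hl : q ^ l = 1)
    (φ : TensorPow K n d →ₗ[K] K) (v : TensorPow K n d)
    (hφ : ∀ k x, s + 1 ≤ k → k < s + l → φ (heckeT q n d k x) = q * φ x)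
    (hv : ∀ k, s ≤ k → k + 1 < s + l → heckeT q n d k v = q • v) :
    φ (down (heckeT q n d) s l v) =
      φ (down (fun k => heckeT q n d k - (q - q⁻¹) • (1 : Module.End K (TensorPow K n d))) s l v) := by
  set T := heckeT q n d with hT
  set S : ℕ → Module.End K (TensorPow K n d) := fun k => T k - (q - q⁻¹) • 1 with hS
  have hB := heckeT_rel q hq n d
  have hSv : ∀ t, t + 1 ≤ l → down S s t v = (q⁻¹) ^ t • v := by
    intro t
    induction t with
    | zero => intro _; simp [down]
    | succ t ih =>
      intro ht
      have : S (s + t) v = q⁻¹ • v := by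
        simp only [hS, LinearMap.sub_apply, LinearMap.smul_apply, Module.End.one_apply]
        rw [hv _ (by omega) (by omega)]; module
      simp only [down, Module.End.mul_apply]
      rw [this, map_smul, ih (by omega), smul_smul, pow_succ']
  have hφd : ∀ m u x, s + 1 ≤ u → u + m ≤ s + l → φ (down T u m x) = q ^ m * φ x := by
    intro m
    induction m with
    | zero => intro u x _ _; simp [down]
    | succ m ih =>
      intro u x h1 h2
      simp only [down, Module.End.mul_apply]
      rw [ih _ _ h1 (by omega), hφ _ _ (by omega) (by omega)]; ring
  let g : ℕ → K := fun t => φ ((down S s t * down T (s + t) (l - t)) v)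
  let e : ℕ → K := fun t => q ^ (l - t) * (q⁻¹) ^ t * φ v
  have step : ∀ t ∈ Finset.range l, g (t + 1) - g t = e (t + 1) - e t := by
    intro t ht
    rw [Finset.mem_range] at ht
    obtain ⟨r, hr⟩ : ∃ r, l - t = r + 1 := ⟨l - t - 1, by omega⟩
    have hd : down T (s + t) (l - t) = T (s + t) * down T (s + t + 1) r := by
      rw [hr, add_comm r 1, down_add]; simp [down]
    have hcomm : Commute (down S s t) (down T (s + t + 1) r) := by
      refine commute_down fun j _ _ => Commute.symm (commute_down fun j' _ _ => ?_)
      exact Commute.sub_right (b := T j') (hB.comm (by omega))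
        ((Commute.one_right (T j)).smul_right (q - q⁻¹))
    have hc := LinearMap.congr_fun hcomm.eq v
    simp only [Module.End.mul_apply] at hc
    have h1 : g (t + 1) - g t = -(q - q⁻¹) * φ (down S s t (down T (s + t + 1) r v)) := by
      simp only [g]
      rw [hd, show l - (t + 1) = r by omega, ← add_assoc, ← map_sub]
      simp only [down, Module.End.mul_apply]
      rw [← map_sub, hS]
      simp only [LinearMap.sub_apply, LinearMap.smul_apply, Module.End.one_apply]
      rw [sub_sub_cancel_left, map_neg, map_smul, map_neg, map_smul, smul_eq_mul, neg_mul]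
    rw [h1, hc, hφd _ _ _ (by omega) (by omega), hSv _ (by omega), map_smul, smul_eq_mul]
    simp only [e]
    rw [hr, show l - (t + 1) = r by omega, pow_succ, pow_succ]
    ring
  have tot := Finset.sum_congr rfl step
  rw [Finset.sum_range_sub, Finset.sum_range_sub] at tot
  have : e l - e 0 = 0 := by simp [e, hl]
  rw [this, sub_eq_zero] at tot
  simp only [g, Nat.sub_self, Nat.sub_zero, add_zero] at tot
  simpa [down] using tot.symm

def slide {n d : ℕ} (Y : Fin d → Fin n) (a b : Fin n) (u l r : ℕ) : Fin d → Fin n :=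
  fun p => if (p : ℕ) = r then b else if u ≤ p ∧ (p : ℕ) ≤ u + l then a else Y p

theorem swapAt_slide {n d : ℕ} (Y : Fin d → Fin n) (a b : Fin n) {u l k : ℕ} (h : k + 1 < d)
    (h1 : u ≤ k) (h2 : k + 1 ≤ u + l) :
    swapAt h (slide Y a b u l (k + 1)) = slide Y a b u l k := by
  funext p
  by_cases p1 : (p : ℕ) = k
  · obtain rfl : p = ⟨k, Nat.lt_of_succ_lt h⟩ := Fin.ext p1
    rw [swapAt_left]; simp [slide]
  · by_cases p2 : (p : ℕ) = k + 1
    · obtain rfl : p = ⟨k + 1, h⟩ := Fin.ext p2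
      rw [swapAt_right]
      simp [slide, h1, show k ≤ u + l by omega, show u ≤ k + 1 by omega, show k < u + l by omega]
    · rw [swapAt_ne h _ p p1 p2]; simp [slide, p1, p2]

theorem down_slide (q : K) (hq : q ≠ 0) {n d u l : ℕ} (hl : q ^ l = 1) (hd : u + l < d)
    (φ : TensorPow K n d →ₗ[K] K)
    (hφ : ∀ k x, u + 1 ≤ k → k < u + l → φ (heckeT q n d k x) = q * φ x)
    (Y : Fin d → Fin n) (a b : Fin n) :
    φ (down (heckeT q n d) u l (tens K (slide Y a b u l (u + l)))) =
      φ (tens K (slide Y a b u l u)) := by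
  have val1 : ∀ k (hk : k + 1 < d), u ≤ k → k + 1 ≤ u + l →
      slide Y a b u l (k + 1) ⟨k, Nat.lt_of_succ_lt hk⟩ = a := by
    intro k hk h1 h2; simp [slide]; omega
  have val2 : ∀ k (hk : k + 1 < d), slide Y a b u l (k + 1) ⟨k + 1, hk⟩ = b := by
    intro k hk; simp [slide]
  rcases lt_trichotomy a b with hab | hab | hab
  · have : ∀ m, m ≤ l → down (heckeT q n d) u m (tens K (slide Y a b u l (u + m))) =
        tens K (slide Y a b u l u) := by
      intro m
      induction m with
      | zero => intro _; rfl
      | succ m ih =>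
        intro hm
        have hk : u + m + 1 < d := by omega
        simp only [down, Module.End.mul_apply, ← add_assoc]
        rw [heckeT_tens q hk, val1 _ hk (by omega) (by omega), val2,
          if_pos hab, swapAt_slide Y a b _ (by omega) (by omega), ih (by omega)]
    rw [this l le_rfl]
  · subst hab
    have hs : ∀ r, u ≤ r → r ≤ u + l → slide Y a a u l r = slide Y a a u l u := by
      intro r h1 h2; funext p; simp only [slide]; grind
    have : ∀ m, m ≤ l → down (heckeT q n d) u m (tens K (slide Y a a u l u)) =
        q ^ m • tens K (slide Y a a u l u) := by
      intro m
      induction m with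
      | zero => intro _; simp [down]
      | succ m ih =>
        intro hm
        have hk : u + m + 1 < d := by omega
        simp only [down, Module.End.mul_apply]
        nth_rewrite 1 [← hs (u + m + 1) (by omega) (by omega)]
        rw [heckeT_tens q hk, val1 _ hk (by omega) (by omega), val2,
          if_neg (lt_irrefl _), if_pos rfl, hs _ (by omega) (by omega), map_smul, ih (by omega),
          smul_smul, pow_succ']
    rw [hs _ (by omega) le_rfl, this l le_rfl, hl, one_smul]
  · rw [down_inv q hq hl φ _ hφ]
    · have : ∀ m, m ≤ l →
          down (fun k => heckeT q n d k - (q - q⁻¹) • (1 : Module.End K (TensorPow K n d))) u m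
            (tens K (slide Y a b u l (u + m))) = tens K (slide Y a b u l u) := by
        intro m
        induction m with
        | zero => intro _; rfl
        | succ m ih =>
          intro hm
          have hk : u + m + 1 < d := by omega
          simp only [down, Module.End.mul_apply, ← add_assoc, LinearMap.sub_apply,
            LinearMap.smul_apply, Module.End.one_apply]
          rw [heckeT_tens q hk, val1 _ hk (by omega) (by omega), val2,
            if_neg hab.not_gt, if_neg hab.ne', swapAt_slide Y a b _ (by omega) (by omega),
            add_sub_cancel_left, ih (by omega)]
      rw [this l le_rfl]
    · intro k h1 h2
      rw [heckeT_tens q (k := k) (by omega)]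
      have e1 : slide Y a b u l (u + l) ⟨k, by omega⟩ = a := by
        simp only [slide]; rw [if_neg (by omega), if_pos (by omega)]
      have e2 : slide Y a b u l (u + l) ⟨k + 1, by omega⟩ = a := by
        simp only [slide]; rw [if_neg (by omega), if_pos (by omega)]
      rw [e1, e2, if_neg (lt_irrefl _), if_pos rfl]

def slab {n d : ℕ} (Y : Fin d → Fin n) (a b : Fin n) (s l c : ℕ) : Fin d → Fin n :=
  fun p => if s + c ≤ p ∧ (p : ℕ) < s + c + l then a
    else if s ≤ p ∧ (p : ℕ) < s + 2 * l then b else Y p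

theorem blk_slab (q : K) (hq : q ≠ 0) {n d s l : ℕ} (hl : q ^ l = 1) (hd : s + 2 * l ≤ d)
    (φ : TensorPow K n d →ₗ[K] K)
    (hφ : ∀ k x, s + l ≤ k → k + 1 < s + 2 * l → φ (heckeT q n d k x) = q * φ x)
    (Y : Fin d → Fin n) (a b : Fin n) :
    φ (blk (heckeT q n d) s l l (tens K (slab Y a b s l 0))) = φ (tens K (slab Y a b s l l)) := by
  have hB := heckeT_rel q hq n d
  have : ∀ r c, c + r = l →
      φ (blk (heckeT q n d) (s + c) l r (tens K (slab Y a b s l c))) =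
        φ (tens K (slab Y a b s l l)) := by
    intro r
    induction r with
    | zero => intro c hc; obtain rfl : c = l := by omega
              rfl
    | succ r ih =>
      intro c hc
      rw [← ih (c + 1) (by omega), add_comm r 1, blk_add_right]
      have e1 : slab Y a b s l c = slide (slab Y a b s l c) a b (s + c) l (s + c + l) := by
        funext p; simp only [slab, slide]; grind
      have e2 : slab Y a b s l (c + 1) = slide (slab Y a b s l c) a b (s + c) l (s + c) := by
        funext p; simp only [slab, slide]; grind
      have := down_slide q hq hl (u := s + c) (by omega)
        (φ ∘ₗ blk (heckeT q n d) (s + c + 1) l r) (fun k x h1 h2 => by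
          have e := LinearMap.congr_fun (blk_conj_left hB (s := s + c + 1) (i := l) (b := r)
            (k := k) h1 (by omega)) x
          simp only [Module.End.mul_apply] at e
          rw [LinearMap.comp_apply, LinearMap.comp_apply, ← e, hφ _ _ (by omega) (by omega)])
        (slab Y a b s l c) a b
      rw [← e1, ← e2] at this
      simpa [blk, ← add_assoc] using this
  simpa using this l 0 (by omega)

theorem heckeT_rep (q : K) {n d l k : ℕ} (I : Fin d → Fin n) (t : ℕ) (h1 : t * l ≤ k)
    (h2 : k + 1 < (t + 1) * l) (h3 : t < d) :
    heckeT q n (d * l) k (tens K (rep l I)) = q • tens K (rep l I) := by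
  have hk : k + 1 < d * l := h2.trans_le (Nat.mul_le_mul_right l h3)
  have hl : 0 < l := by
    rcases Nat.eq_zero_or_pos l with h | h
    · subst h; omega
    · exact h
  have e1 : k / l = t := by
    rw [Nat.div_eq_iff hl]; grind
  have e2 : (k + 1) / l = t := by
    rw [Nat.div_eq_iff hl]; grind
  rw [heckeT_tens q hk]
  have e : rep l I ⟨k, Nat.lt_of_succ_lt hk⟩ = rep l I ⟨k + 1, hk⟩ := by
    simp [rep, Fin.divNat, e1, e2]
  rw [e, if_neg (lt_irrefl _), if_pos rfl]

theorem blk_rep (q : K) (hq : q ≠ 0) {n d l k : ℕ} (hl : q ^ l = 1) (hl0 : 0 < l)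
    (h : k + 1 < d) (φ : TensorPow K n (d * l) →ₗ[K] K)
    (hφ : ∀ j x, (k + 1) * l ≤ j → j + 1 < (k + 2) * l → φ (heckeT q n (d * l) j x) = q * φ x)
    (I : Fin d → Fin n) :
    φ (blk (heckeT q n (d * l)) (k * l) l l (tens K (rep l I))) =
      φ (tens K (rep l (swapAt h I))) := by
  have hd : (k + 2) * l ≤ d * l := Nat.mul_le_mul_right l h
  have := blk_slab q hq (s := k * l) hl (by linarith) φ
    (fun j x h1 h2 => hφ j x (by linarith) (by linarith)) (rep l I)
    (I ⟨k, Nat.lt_of_succ_lt h⟩) (I ⟨k + 1, h⟩)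
  convert this using 4
  · funext p
    simp only [slab, rep]
    have hp : ∀ t : ℕ, (p : ℕ) / l = t ↔ t * l ≤ p ∧ (p : ℕ) < (t + 1) * l := by
      intro t; rw [Nat.div_eq_iff hl0]
      constructor <;> intro h <;> refine ⟨by linarith [h.1], ?_⟩ <;> have := h.2 <;> grind
    split_ifs with h1 h2
    · congr 1; apply Fin.ext; simp only [Fin.divNat]; rw [hp]; constructor <;> linarith [h1.1, h1.2]
    · congr 1; apply Fin.ext; simp only [Fin.divNat]; rw [hp]
      constructor
      · by_contra h3
        exact h1 ⟨by linarith [h2.1], by linarith⟩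
      · linarith [h2.2]
    · rfl
  · funext p
    have hp : ∀ t : ℕ, (p : ℕ) / l = t ↔ t * l ≤ p ∧ (p : ℕ) < (t + 1) * l := by
      intro t; rw [Nat.div_eq_iff hl0]
      constructor <;> intro h <;> refine ⟨by linarith [h.1], ?_⟩ <;> have := h.2 <;> grind
    simp only [slab, rep]
    split_ifs with h1 h2
    · have : p.divNat = ⟨k + 1, h⟩ := by
        apply Fin.ext; simp only [Fin.divNat]; rw [hp]; constructor <;> linarith [h1.1, h1.2]
      rw [this, swapAt_right]
    · have : p.divNat = ⟨k, Nat.lt_of_succ_lt h⟩ := by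
        apply Fin.ext; simp only [Fin.divNat]; rw [hp]
        refine ⟨h2.1, ?_⟩
        by_contra h3
        exact h1 ⟨by linarith, by linarith [h2.2]⟩
      rw [this, swapAt_left]
    · refine swapAt_ne h _ _ ?_ ?_
      · intro h3; simp only [Fin.divNat] at h3; rw [hp] at h3
        exact h2 ⟨h3.1, by linarith [h3.2]⟩
      · intro h3; simp only [Fin.divNat] at h3; rw [hp] at h3
        exact h2 ⟨by linarith [h3.1], by linarith [h3.2]⟩

/-- The quantum Frobenius map `f ↦ Fr f`: the coefficient of `Fr f` at `(J, I)` is that of `f` at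
`(J^l, I^l)`. In terms of coordinate functions, where `x_{JI} = x_{j_1 i_1} ⋯ x_{j_d i_d}` reads off
the coefficient at `(J, I)`, it is the dual of the algebra map `x_{ji} ↦ x_{ji}^l`. -/
def frobLin {n m d l : ℕ} :
    (TensorPow K n (d * l) →ₗ[K] TensorPow K m (d * l)) →ₗ[K]
      (TensorPow K n d →ₗ[K] TensorPow K m d) where
  toFun f := deflate K m d l ∘ₗ f ∘ₗ inflate K n d l
  map_add' f g := by rw [LinearMap.add_comp, LinearMap.comp_add]
  map_smul' c f := by rw [LinearMap.smul_comp, LinearMap.comp_smul]; rfl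

theorem frobLin_apply {n m d l : ℕ} (f : TensorPow K n (d * l) →ₗ[K] TensorPow K m (d * l))
    (I : Fin d → Fin n) (J : Fin d → Fin m) :
    frobLin f (tens K I) J = f (tens K (rep l I)) (rep l J) := by
  simp only [frobLin, LinearMap.coe_mk, AddHom.coe_mk, LinearMap.comp_apply, inflate_tens,
    deflate_apply]

theorem heckeT_one {n d k : ℕ} (h : k + 1 < d) (I : Fin d → Fin n) :
    heckeT (1 : K) n d k (tens K I) = tens K (swapAt h I) := by
  rw [heckeT_tens _ h]
  split_ifs with h1 h2
  · rfl
  · rw [swapAt_eq h I h2, one_smul]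
  · simp

theorem coord_eigen (q : Kˣ) {n m d l k : ℕ} (f : schur q n m (d * l)) (J : Fin d → Fin m)
    (t : ℕ) (h1 : t * l ≤ k) (h2 : k + 1 < (t + 1) * l) (h3 : t < d)
    (x : TensorPow K n (d * l)) :
    f.1 (heckeT (q : K) n (d * l) k x) (rep l J) = q * f.1 x (rep l J) := by
  rw [schur_apply f.2, ← pair_tens, ← pair_heckeT, heckeT_rep _ J t h1 h2 h3, map_smul,
    LinearMap.smul_apply, pair_tens, smul_eq_mul]

/-- The quantum Frobenius maps `S_q(n, m; dl)` to `S_1(n, m; d)`. -/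
theorem frobLin_mem {q : Kˣ} {l : ℕ} (hq : IsPrimitiveRoot q l) (hl0 : 0 < l) {n m d : ℕ}
    (f : schur q n m (d * l)) : frobLin f.1 ∈ schur (1 : Kˣ) n m d := by
  have hl : (q : K) ^ l = 1 := by rw [← Units.val_pow_eq_pow_val, hq.pow_eq_one]; rfl
  intro k h
  have hT : ∀ v : TensorPow K m d, ∀ J, heckeT (1 : K) m d k v J = v (swapAt h J) := by
    intro v J
    rw [← pair_tens, ← pair_heckeT, heckeT_one h, pair_tens]
  refine end_ext fun I => Finsupp.ext fun J => ?_
  rw [LinearMap.comp_apply, LinearMap.comp_apply, Units.val_one, hT, heckeT_one h, frobLin_apply,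
    frobLin_apply]
  have r1 := blk_rep (q : K) q.ne_zero hl hl0 h (Finsupp.lapply (rep l J) ∘ₗ f.1)
    (fun j x h1 h2 => coord_eigen q f J (k + 1) h1 h2 h x) I
  have r2 := blk_rep (q : K) q.ne_zero hl hl0 h ((pair K m (d * l)).flip (f.1 (tens K (rep l I))))
    (fun j x h1 h2 => by
      rw [LinearMap.flip_apply, LinearMap.flip_apply, pair_heckeT, ← schur_apply f.2,
        heckeT_rep _ I (k + 1) h1 h2 h, map_smul, map_smul, smul_eq_mul]) J
  rw [LinearMap.flip_apply, LinearMap.flip_apply, pair_blk _ q.ne_zero, pair_tens, pair_tens,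
    ← schur_blk] at r2
  exact r1.symm.trans r2

end Frob
end QuantumDeRham

namespace QuantumDeRham

noncomputable section FrobComp

variable {K : Type*} [Field K]

theorem sum_pow_card (Q : K) {N : ℕ} (A : Finset (Fin N)) :
    ∑ p ∈ A, Q ^ (A.filter (· < p)).card = ∑ r ∈ Finset.range A.card, Q ^ r := by
  induction A using Finset.induction_on_max with
  | empty => simp
  | insert a A ha ih =>
    have hn : a ∉ A := fun h => lt_irrefl _ (ha a h)
    rw [Finset.sum_insert hn, Finset.card_insert_of_notMem hn, Finset.sum_range_succ, ← ih,
      add_comm]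
    congr 1
    · refine Finset.sum_congr rfl fun p hp => ?_
      rw [Finset.filter_insert, if_neg (ha p hp).not_gt]
    · rw [Finset.filter_insert, if_neg (lt_irrefl _), Finset.filter_true_of_mem ha]

theorem swapAt_comp_card {n N k : ℕ} (h : k + 1 < N) (u : Fin N → Fin n) (x : Fin n) :
    (Finset.univ.filter fun p => swapAt h u p = x).card =
      (Finset.univ.filter fun p => u p = x).card := by
  refine Finset.card_bij (fun p _ => Equiv.swap ⟨k, Nat.lt_of_succ_lt h⟩ ⟨k + 1, h⟩ p) ?_ ?_ ?_
  · intro p hp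
    simp only [Finset.mem_filter, Finset.mem_univ, true_and] at hp ⊢
    exact hp
  · intro p _ p' _ e; exact (Equiv.swap _ _).injective e
  · intro p hp
    simp only [Finset.mem_filter, Finset.mem_univ, true_and] at hp
    refine ⟨Equiv.swap ⟨k, Nat.lt_of_succ_lt h⟩ ⟨k + 1, h⟩ p, ?_, by simp⟩
    simp only [Finset.mem_filter, Finset.mem_univ, true_and]
    simpa [swapAt] using hp

theorem insertNth_sum (Q : K) {n N : ℕ} (w : (Fin (N + 1) → Fin n) → K)
    (hw : ∀ (k : ℕ) (h : k + 1 < N + 1) u, u ⟨k, Nat.lt_of_succ_lt h⟩ < u ⟨k + 1, h⟩ →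
      w (swapAt h u) = Q * w u) (x : Fin n) (R : Fin N → Fin n) (hx : ∀ j, x ≤ R j)
    (p : ℕ) (hp : p < N + 1) :
    Q ^ (Finset.univ.filter fun j : Fin N => (j : ℕ) < p ∧ R j = x).card *
      w (Fin.insertNth (α := fun _ => Fin n) ⟨p, hp⟩ x R) =
      Q ^ p * w (Fin.insertNth (α := fun _ => Fin n) 0 x R) := by
  induction p with
  | zero => simp
  | succ p ih =>
    have hpN : p < N := by omega
    have ih := ih (by omega)
    set u : Fin (N + 1) → Fin n := Fin.insertNth (α := fun _ => Fin n) ⟨p, by omega⟩ x R with hu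
    have u1 : u ⟨p, Nat.lt_of_succ_lt hp⟩ = x := by rw [hu, Fin.insertNth_apply_same]
    have u2 : u ⟨p + 1, hp⟩ = R ⟨p, by omega⟩ := by
      have : (⟨p + 1, hp⟩ : Fin (N + 1)) = Fin.succAbove ⟨p, by omega⟩ ⟨p, by omega⟩ := by
        rw [Fin.succAbove_of_le_castSucc _ _ (by simp)]; rfl
      rw [hu, this, Fin.insertNth_apply_succAbove]
    have e : Fin.insertNth (α := fun _ => Fin n) ⟨p + 1, hp⟩ x R = swapAt hp u := by
      refine (Fin.insertNth_eq_iff).2 ⟨?_, ?_⟩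
      · rw [swapAt_right, u1]
      · funext j
        rw [Fin.removeNth_apply]
        rcases lt_trichotomy (j : ℕ) p with hj | hj | hj
        · rw [Fin.succAbove_of_castSucc_lt _ _ (by simp [Fin.lt_def]; omega),
            swapAt_ne _ _ _ (by simp; omega) (by simp; omega)]
          have : j.castSucc = Fin.succAbove ⟨p, by omega⟩ j := by
            rw [Fin.succAbove_of_castSucc_lt _ _ (by simpa [Fin.lt_def])]
          rw [hu, this, Fin.insertNth_apply_succAbove]
        · obtain rfl : j = ⟨p, hpN⟩ := Fin.ext hj
          rw [Fin.succAbove_of_castSucc_lt _ _ (by simp [Fin.lt_def])]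
          exact ((swapAt_left hp u).trans u2).symm
        · rw [Fin.succAbove_of_le_castSucc _ _ (by simp [Fin.le_def]; omega),
            swapAt_ne _ _ _ (by simp; omega) (by simp; omega)]
          have : j.succ = Fin.succAbove ⟨p, by omega⟩ j := by
            rw [Fin.succAbove_of_le_castSucc _ _ (by simp [Fin.le_def]; omega)]
          rw [hu, this, Fin.insertNth_apply_succAbove]
    rw [e, pow_succ', mul_assoc, ← ih]
    rcases (hx ⟨p, by omega⟩).lt_or_eq with h1 | h1
    · rw [hw p hp u (by rw [u1, u2]; exact h1)]
      have : (Finset.univ.filter fun j : Fin N => (j : ℕ) < p + 1 ∧ R j = x) =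
          (Finset.univ.filter fun j : Fin N => (j : ℕ) < p ∧ R j = x) := by
        ext j
        simp only [Finset.mem_filter, Finset.mem_univ, true_and]
        refine ⟨fun h => ⟨?_, h.2⟩, fun h => ⟨by omega, h.2⟩⟩
        by_contra h3
        obtain rfl : j = ⟨p, hpN⟩ := Fin.ext (show (j : ℕ) = p by have := h.1; omega)
        exact h1.ne h.2.symm
      rw [this]; ring
    · rw [swapAt_eq hp u (by rw [u1, u2]; exact h1)]
      have : (Finset.univ.filter fun j : Fin N => (j : ℕ) < p + 1 ∧ R j = x) =
          insert ⟨p, by omega⟩ (Finset.univ.filter fun j : Fin N => (j : ℕ) < p ∧ R j = x) := by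
        ext j
        simp only [Finset.mem_filter, Finset.mem_univ, true_and, Finset.mem_insert]
        refine ⟨fun h => ?_, fun h => ?_⟩
        · rcases Nat.lt_succ_iff_lt_or_eq.1 h.1 with h3 | h3
          · exact Or.inr ⟨h3, h.2⟩
          · exact Or.inl (Fin.ext h3)
        · rcases h with h | h
          · obtain rfl : j = ⟨p, hpN⟩ := h
            exact ⟨by simp, by rw [← h1]⟩
          · exact ⟨by omega, h.2⟩
      rw [this, Finset.card_insert_of_notMem (by simp), pow_succ']
      ring

theorem sum_block (Q : K) {n N : ℕ} (hQ : IsPrimitiveRoot Q (N + 1))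
    (w : (Fin (N + 1) → Fin n) → K)
    (hw : ∀ (k : ℕ) (h : k + 1 < N + 1) u, u ⟨k, Nat.lt_of_succ_lt h⟩ < u ⟨k + 1, h⟩ →
      w (swapAt h u) = Q * w u) :
    ∑ u, w u = ∑ a : Fin n, w fun _ => a := by
  classical
  rcases Nat.eq_zero_or_pos N with hN | hN
  · subst hN
    refine (Fintype.sum_equiv (Equiv.funUnique (Fin 1) (Fin n)) _ _ fun u => ?_)
    congr 1
    funext p
    rw [Subsingleton.elim p 0]; rfl
  have hQ1 : Q ≠ 1 := hQ.ne_one (by omega)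
  have geom : ∀ a, (∑ r ∈ Finset.range a, Q ^ r) * (Q - 1) = Q ^ a - 1 := fun a => geom_sum_mul Q a
  have geom0 : ∑ r ∈ Finset.range (N + 1), Q ^ r = 0 := by
    have := geom (N + 1)
    rw [hQ.pow_eq_one, sub_self] at this
    exact (mul_eq_zero.1 this).resolve_right (sub_ne_zero.2 hQ1)
  let mn : (Fin (N + 1) → Fin n) → Fin n := fun u => Finset.univ.inf' Finset.univ_nonempty u
  let cnt : (Fin (N + 1) → Fin n) → ℕ := fun u => (Finset.univ.filter fun p => u p = mn u).card
  have mn_swap : ∀ (k : ℕ) (h : k + 1 < N + 1) u, mn (swapAt h u) = mn u := by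
    intro k h u
    refine le_antisymm ?_ ?_
    · refine Finset.le_inf' _ _ fun p _ => ?_
      have := Finset.inf'_le (swapAt h u)
        (Finset.mem_univ (Equiv.swap ⟨k, Nat.lt_of_succ_lt h⟩ ⟨k + 1, h⟩ p))
      rwa [show swapAt h u (Equiv.swap ⟨k, Nat.lt_of_succ_lt h⟩ ⟨k + 1, h⟩ p) = u p by
        simp [swapAt]] at this
    · refine Finset.le_inf' _ _ fun p _ => ?_
      exact Finset.inf'_le u (Finset.mem_univ _)
  have cnt_swap : ∀ (k : ℕ) (h : k + 1 < N + 1) u, cnt (swapAt h u) = cnt u := by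
    intro k h u
    simp only [cnt, mn_swap]
    exact swapAt_comp_card h u _
  have cnt_le : ∀ u, cnt u ≤ N + 1 := fun u => (Finset.card_le_univ _).trans (by simp)
  have cnt_pos : ∀ u, 0 < cnt u := by
    intro u
    obtain ⟨p, _, hp⟩ := Finset.exists_mem_eq_inf' Finset.univ_nonempty u
    exact Finset.card_pos.2 ⟨p, by simp [mn, hp]⟩
  let w' : (Fin (N + 1) → Fin n) → K := fun u =>
    if cnt u = N + 1 then 0 else (∑ r ∈ Finset.range (cnt u), Q ^ r)⁻¹ * w u
  have hw' : ∀ (k : ℕ) (h : k + 1 < N + 1) u, u ⟨k, Nat.lt_of_succ_lt h⟩ < u ⟨k + 1, h⟩ →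
      w' (swapAt h u) = Q * w' u := by
    intro k h u hu
    simp only [w', cnt_swap, hw k h u hu]
    split_ifs <;> ring
  have key : ∑ u, (∑ r ∈ Finset.range (cnt u), Q ^ r) * w' u = 0 := by
    have e1 : ∀ u, (∑ r ∈ Finset.range (cnt u), Q ^ r) * w' u =
        ∑ p : Fin (N + 1), if u p = mn u then
          Q ^ (Finset.univ.filter fun j => j < p ∧ u j = u p).card * w' u else 0 := by
      intro u
      simp only [cnt]
      rw [← sum_pow_card, Finset.sum_mul, ← Finset.sum_filter]
      refine Finset.sum_congr rfl fun p hp => ?_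
      rw [Finset.filter_filter]
      simp only [Finset.mem_filter, Finset.mem_univ, true_and] at hp
      congr 3
      ext j
      simp [hp, and_comm]
    rw [Finset.sum_congr rfl fun u _ => e1 u, Finset.sum_comm]
    have e2 : ∀ p : Fin (N + 1), (∑ u : Fin (N + 1) → Fin n, if u p = mn u then
          Q ^ (Finset.univ.filter fun j => j < p ∧ u j = u p).card * w' u else 0) =
        Q ^ (p : ℕ) * ∑ y : Fin n × (Fin N → Fin n), if ∀ j, y.1 ≤ y.2 j then
          w' (Fin.insertNth (α := fun _ => Fin n) 0 y.1 y.2) else 0 := by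
      intro p
      rw [← Fintype.sum_equiv (Fin.insertNthEquiv (fun _ => Fin n) p) _ _ fun y => rfl,
        Finset.mul_sum]
      refine Finset.sum_congr rfl fun y _ => ?_
      obtain ⟨x, R⟩ := y
      change (if Fin.insertNth (α := fun _ => Fin n) p x R p =
          mn (Fin.insertNth (α := fun _ => Fin n) p x R) then
        Q ^ (Finset.univ.filter fun j => j < p ∧ Fin.insertNth (α := fun _ => Fin n) p x R j =
          Fin.insertNth (α := fun _ => Fin n) p x R p).card *
            w' (Fin.insertNth (α := fun _ => Fin n) p x R) else 0) =
        Q ^ (p : ℕ) * if ∀ j, x ≤ R j then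
          w' (Fin.insertNth (α := fun _ => Fin n) 0 x R) else 0
      simp only [Fin.insertNth_apply_same]
      have c1 : x = mn (Fin.insertNth (α := fun _ => Fin n) p x R) ↔ ∀ j, x ≤ R j := by
        constructor
        · intro h j
          have := Finset.inf'_le (Fin.insertNth (α := fun _ => Fin n) p x R)
            (Finset.mem_univ (p.succAbove j))
          rw [Fin.insertNth_apply_succAbove] at this
          rw [h]; exact this
        · intro h
          refine le_antisymm (Finset.le_inf' _ _ fun j _ => ?_) ?_
          · induction j using Fin.succAboveCases p with
            | x => rw [Fin.insertNth_apply_same]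
            | p j => rw [Fin.insertNth_apply_succAbove]; exact h j
          · have := Finset.inf'_le (Fin.insertNth (α := fun _ => Fin n) p x R) (Finset.mem_univ p)
            rwa [Fin.insertNth_apply_same] at this
      by_cases hx : ∀ j, x ≤ R j
      · rw [if_pos (c1.2 hx), if_pos hx, ← insertNth_sum Q w' hw' x R hx p p.2]
        congr 2
        symm
        refine Finset.card_bij (fun j _ => p.succAbove j) ?_ ?_ ?_
        · intro j hj
          simp only [Finset.mem_filter, Finset.mem_univ, true_and] at hj ⊢
          refine ⟨?_, by rw [Fin.insertNth_apply_succAbove]; exact hj.2⟩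
          rw [Fin.succAbove_of_castSucc_lt _ _ (by simpa [Fin.lt_def] using hj.1), Fin.lt_def]
          exact hj.1
        · intro j _ j' _ e; exact Fin.succAbove_right_injective e
        · intro j hj
          simp only [Finset.mem_filter, Finset.mem_univ, true_and] at hj
          obtain ⟨i, rfl⟩ := Fin.exists_succAbove_eq hj.1.ne
          rw [Fin.insertNth_apply_succAbove] at hj
          refine ⟨i, ?_, rfl⟩
          simp only [Finset.mem_filter, Finset.mem_univ, true_and]
          refine ⟨?_, hj.2⟩
          have := (Fin.succAbove_lt_iff_castSucc_lt p i).1 hj.1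
          simpa [Fin.lt_def] using this
      · rw [if_neg (fun h => hx (c1.1 h)), if_neg hx, mul_zero]
    rw [Finset.sum_congr rfl fun p _ => e2 p, ← Finset.sum_mul, Fin.sum_univ_eq_sum_range
      (fun p => Q ^ p), geom0, zero_mul]
  have e3 : ∀ u, (∑ r ∈ Finset.range (cnt u), Q ^ r) * w' u = if cnt u = N + 1 then 0 else w u := by
    intro u
    simp only [w']
    split_ifs with h
    · simp
    · have : (∑ r ∈ Finset.range (cnt u), Q ^ r) ≠ 0 := by
        intro h0
        have := geom (cnt u)
        rw [h0, zero_mul, eq_comm, sub_eq_zero] at this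
        have hd := Nat.le_of_dvd (cnt_pos u) (hQ.dvd_of_pow_eq_one _ this)
        exact h (le_antisymm (cnt_le u) hd)
      rw [← mul_assoc, mul_inv_cancel₀ this, one_mul]
  rw [Finset.sum_congr rfl fun u _ => e3 u] at key
  have split : ∑ u, w u = (∑ u, if cnt u = N + 1 then w u else 0) +
      ∑ u, (if cnt u = N + 1 then 0 else w u) := by
    rw [← Finset.sum_add_distrib]
    refine Finset.sum_congr rfl fun u _ => ?_
    split_ifs <;> simp
  rw [split, key, add_zero, ← Finset.sum_filter]
  symm
  refine Finset.sum_bij (fun a _ _ => a) ?_ ?_ ?_ ?_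
  · intro a _
    simp [cnt, mn]
  · intro a _ b _ e
    exact congrFun e 0
  · intro u hu
    simp only [Finset.mem_filter, Finset.mem_univ, true_and] at hu
    refine ⟨mn u, Finset.mem_univ _, ?_⟩
    have : (Finset.univ.filter fun p => u p = mn u) = Finset.univ :=
      (Finset.card_eq_iff_eq_univ _).1 (by rw [Fintype.card_fin]; exact hu)
    funext p
    have hp := Finset.mem_univ p
    rw [← this, Finset.mem_filter] at hp
    exact hp.2.symm
  · intro a _; rfl

theorem sum_blocks {X A : Type*} [Fintype X] [Fintype A] (c : A → X) {d : ℕ}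
    (W : (Fin d → X) → K)
    (h : ∀ t F, ∑ x, W (Function.update F t x) = ∑ a, W (Function.update F t (c a))) :
    ∑ F, W F = ∑ L : Fin d → A, W (c ∘ L) := by
  induction d with
  | zero =>
    rw [Fintype.sum_unique, Fintype.sum_unique]
    congr 1
    exact Subsingleton.elim _ _
  | succ d ih =>
    rw [← Fintype.sum_equiv (Fin.consEquiv fun _ => X) _ _ fun y => rfl,
      ← Fintype.sum_equiv (Fin.consEquiv fun _ => A) _ _ fun y => rfl,
      Fintype.sum_prod_type, Fintype.sum_prod_type]
    change ∑ x, ∑ F : Fin d → X, W (Fin.cons (α := fun _ => X) x F) =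
      ∑ a, ∑ L : Fin d → A, W (c ∘ Fin.cons (α := fun _ => A) a L)
    have h1 : ∀ x, ∑ F : Fin d → X, W (Fin.cons (α := fun _ => X) x F) =
        ∑ L : Fin d → A, W (Fin.cons (α := fun _ => X) x (c ∘ L)) := by
      intro x
      refine ih (fun F => W (Fin.cons (α := fun _ => X) x F)) fun t F => ?_
      have := h t.succ (Fin.cons (α := fun _ => X) x F)
      simpa only [Fin.cons_update] using this
    simp only [h1]
    rw [Finset.sum_comm]
    have h2 : ∀ L : Fin d → A, ∑ x, W (Fin.cons (α := fun _ => X) x (c ∘ L)) =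
        ∑ a, W (Fin.cons (α := fun _ => X) (c a) (c ∘ L)) := by
      intro L
      rcases isEmpty_or_nonempty X with hX | ⟨⟨x0⟩⟩
      · have : IsEmpty A := Function.isEmpty c
        simp
      have := h 0 (Fin.cons (α := fun _ => X) x0 (c ∘ L))
      simpa only [Fin.update_cons_zero] using this
    simp only [h2]
    rw [Finset.sum_comm]
    refine Finset.sum_congr rfl fun a _ => Finset.sum_congr rfl fun L _ => ?_
    congr 1
    funext p
    induction p using Fin.cases <;> simp

def blockEquiv (n d l : ℕ) : (Fin d → Fin l → Fin n) ≃ (Fin (d * l) → Fin n) :=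
  (Equiv.curry (Fin d) (Fin l) (Fin n)).symm.trans (finProdFinEquiv.arrowCongr (Equiv.refl _))

theorem blockEquiv_apply {n d l : ℕ} (F : Fin d → Fin l → Fin n) (p : Fin (d * l)) :
    blockEquiv n d l F p = F p.divNat p.modNat := rfl

theorem swapAt_blockEquiv {n d l : ℕ} (F : Fin d → Fin l → Fin n) (t : Fin d) {k : ℕ}
    (h : k + 1 < l) (h' : (t : ℕ) * l + k + 1 < d * l) :
    swapAt h' (blockEquiv n d l F) =
      blockEquiv n d l (Function.update F t (swapAt h (F t))) := by
  have hl : 0 < l := by omega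
  funext p
  rw [blockEquiv_apply]
  have hval : (p : ℕ) = p.divNat * l + p.modNat := (Nat.div_add_mod' p l).symm
  by_cases hp : p.divNat = t
  · rw [hp, Function.update_self]
    by_cases p1 : (p : ℕ) = t * l + k
    · have m : p.modNat = ⟨k, Nat.lt_of_succ_lt h⟩ := Fin.ext (by
          rw [hp] at hval; show (p.modNat : ℕ) = k; omega)
      obtain rfl : p = ⟨t * l + k, Nat.lt_of_succ_lt h'⟩ := Fin.ext p1
      rw [m, swapAt_left, swapAt_left, blockEquiv_apply]
      congr 1
      · congr 1; apply Fin.ext; simp only [Fin.divNat]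
        rw [Nat.div_eq_iff hl]; constructor <;> grind
      · apply Fin.ext; simp only [Fin.modNat]
        rw [add_assoc, Nat.mul_add_mod', Nat.mod_eq_of_lt h]
    · by_cases p2 : (p : ℕ) = t * l + k + 1
      · have m : p.modNat = ⟨k + 1, h⟩ := Fin.ext (by
          rw [hp] at hval; show (p.modNat : ℕ) = k + 1; omega)
        obtain rfl : p = ⟨t * l + k + 1, h'⟩ := Fin.ext p2
        rw [m, swapAt_right, swapAt_right, blockEquiv_apply]
        congr 1
        · congr 1; apply Fin.ext; simp only [Fin.divNat]
          rw [Nat.div_eq_iff hl]; constructor <;> grind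
        · apply Fin.ext; simp only [Fin.modNat]
          rw [Nat.mul_add_mod', Nat.mod_eq_of_lt (by omega)]
      · rw [swapAt_ne h' _ p p1 p2, blockEquiv_apply, hp, swapAt_ne]
        · rw [hp] at hval; intro e; omega
        · rw [hp] at hval; intro e; omega
  · rw [Function.update_of_ne hp, swapAt_ne, blockEquiv_apply]
    · intro e; apply hp; apply Fin.ext; simp only [Fin.divNat]
      rw [e, Nat.div_eq_iff hl]; constructor <;> grind
    · intro e; apply hp; apply Fin.ext; simp only [Fin.divNat]
      rw [e, Nat.div_eq_iff hl]; constructor <;> grind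

theorem sum_rep {q : Kˣ} {l : ℕ} (hq : IsPrimitiveRoot q l) (hodd : Odd l) {r n m d : ℕ}
    (f : schur q n m (d * l)) (g : schur q r n (d * l)) (I : Fin d → Fin r) (J : Fin d → Fin m) :
    ∑ L : Fin (d * l) → Fin n, f.1 (tens K L) (rep l J) * g.1 (tens K (rep l I)) L =
      ∑ L : Fin d → Fin n, f.1 (tens K (rep l L)) (rep l J) * g.1 (tens K (rep l I)) (rep l L) := by
  obtain ⟨N, rfl⟩ : ∃ N, l = N + 1 := ⟨l - 1, by have := hodd.pos; omega⟩
  have hQ : IsPrimitiveRoot ((q : K) ^ 2) (N + 1) :=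
    ((IsPrimitiveRoot.coe_units_iff (ζ := q)).2 hq).pow_of_coprime 2
      (Nat.coprime_two_left.2 hodd)
  set w : (Fin (d * (N + 1)) → Fin n) → K := fun L =>
    f.1 (tens K L) (rep (N + 1) J) * g.1 (tens K (rep (N + 1) I)) L with hwdef
  have hw : ∀ (t : Fin d) (k : ℕ) (hk : k + 1 < N + 1)
      (h' : (t : ℕ) * (N + 1) + k + 1 < d * (N + 1)) L,
      L ⟨t * (N + 1) + k, Nat.lt_of_succ_lt h'⟩ < L ⟨t * (N + 1) + k + 1, h'⟩ →
      w (swapAt h' L) = (q : K) ^ 2 * w L := by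
    intro t k hk h' L hL
    have e : heckeT (q : K) n (d * (N + 1)) (t * (N + 1) + k) (tens K L) = tens K (swapAt h' L) := by
      rw [heckeT_tens _ h', if_pos hL]
    have b1 : (t : ℕ) * (N + 1) + k + 1 < ((t : ℕ) + 1) * (N + 1) := by grind
    have e1 := coord_eigen q f J t (k := t * (N + 1) + k) (by omega) b1 t.2 (tens K L)
    rw [e] at e1
    have e2 : g.1 (tens K (rep (N + 1) I)) (swapAt h' L) = q * g.1 (tens K (rep (N + 1) I)) L := by
      rw [← pair_tens, ← e, pair_heckeT, ← schur_apply g.2,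
        heckeT_rep _ I t (by omega) b1 t.2, map_smul, map_smul, pair_tens, smul_eq_mul]
    simp only [hwdef]
    rw [e1, e2]; ring
  rw [← Fintype.sum_equiv (blockEquiv n d (N + 1)) _ _ fun y => rfl,
    sum_blocks (fun (a : Fin n) (_ : Fin (N + 1)) => a) (fun F => w (blockEquiv n d (N + 1) F))]
  · rfl
  · intro t F
    refine sum_block _ hQ (fun x => w (blockEquiv n d (N + 1) (Function.update F t x)))
      fun k h u hu => ?_
    have h' : (t : ℕ) * (N + 1) + k + 1 < d * (N + 1) := by
      have : ((t : ℕ) + 1) * (N + 1) ≤ d * (N + 1) := Nat.mul_le_mul_right _ t.2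
      have e : ((t : ℕ) + 1) * (N + 1) = t * (N + 1) + (N + 1) := by ring
      omega
    have e := swapAt_blockEquiv (Function.update F t u) t h h'
    rw [Function.update_self, Function.update_idem] at e
    rw [← e]
    refine hw t k h h' _ ?_
    rw [blockEquiv_apply, blockEquiv_apply]
    have d1 : (⟨t * (N + 1) + k, Nat.lt_of_succ_lt h'⟩ : Fin (d * (N + 1))).divNat = t := by
      apply Fin.ext; simp only [Fin.divNat]; rw [Nat.div_eq_iff (by omega)]; constructor <;> grind
    have d2 : (⟨t * (N + 1) + k + 1, h'⟩ : Fin (d * (N + 1))).divNat = t := by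
      apply Fin.ext; simp only [Fin.divNat]; rw [Nat.div_eq_iff (by omega)]; constructor <;> grind
    have m1 : (⟨t * (N + 1) + k, Nat.lt_of_succ_lt h'⟩ : Fin (d * (N + 1))).modNat =
        ⟨k, Nat.lt_of_succ_lt h⟩ := by
      apply Fin.ext; simp only [Fin.modNat]; rw [Nat.mul_add_mod', Nat.mod_eq_of_lt (by omega)]
    have m2 : (⟨t * (N + 1) + k + 1, h'⟩ : Fin (d * (N + 1))).modNat = ⟨k + 1, h⟩ := by
      apply Fin.ext; simp only [Fin.modNat]; rw [add_assoc, Nat.mul_add_mod', Nat.mod_eq_of_lt h]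
    rw [d1, d2, m1, m2, Function.update_self]
    exact hu

theorem map_eq_sum {n m d : ℕ} (f : TensorPow K n d →ₗ[K] TensorPow K m d) (v : TensorPow K n d) :
    f v = ∑ L, v L • f (tens K L) := by
  conv_lhs => rw [← Finsupp.univ_sum_single v]
  rw [map_sum]
  refine Finset.sum_congr rfl fun L _ => ?_
  rw [← Finsupp.smul_single_one, map_smul]

/-- The quantum Frobenius is compatible with composition. -/
theorem frobLin_comp {q : Kˣ} {l : ℕ} (hq : IsPrimitiveRoot q l) (hodd : Odd l) {r n m d : ℕ}
    (f : schur q n m (d * l)) (g : schur q r n (d * l)) :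
    frobLin (d := d) (f.1 ∘ₗ g.1) = frobLin f.1 ∘ₗ frobLin g.1 := by
  refine end_ext fun I => Finsupp.ext fun J => ?_
  rw [frobLin_apply, LinearMap.comp_apply, LinearMap.comp_apply, map_eq_sum f.1,
    map_eq_sum (frobLin f.1)]
  simp only [Finsupp.finsetSum_apply, Finsupp.smul_apply, smul_eq_mul, frobLin_apply]
  have := sum_rep hq hodd f g I J
  simpa only [mul_comm] using this

theorem rep_injective {n d l : ℕ} (hl : 0 < l) :
    Function.Injective (rep l : (Fin d → Fin n) → _) := by
  intro I J h
  funext t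
  have e := congrFun h (finProdFinEquiv (t, ⟨0, hl⟩))
  have e2 : (finProdFinEquiv (t, (⟨0, hl⟩ : Fin l))).divNat = t :=
    congrArg Prod.fst (finProdFinEquiv.symm_apply_apply (t, (⟨0, hl⟩ : Fin l)))
  simp only [rep, e2] at e
  exact e

/-- The quantum Frobenius is compatible with identities. -/
theorem frobLin_id {n d l : ℕ} (hl : 0 < l) :
    frobLin (K := K) (n := n) (m := n) (d := d) (l := l) LinearMap.id = LinearMap.id := by
  refine end_ext fun I => Finsupp.ext fun J => ?_
  rw [frobLin_apply, LinearMap.id_apply, LinearMap.id_apply, Finsupp.single_apply,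
    Finsupp.single_apply]
  simp [(rep_injective hl).eq_iff]

end FrobComp
end QuantumDeRham

namespace QuantumDeRham

universe u

noncomputable section Functors

open CategoryTheory

variable {K : Type u} [Field K]

/-- The category `Γ_q^d V`: its objects are the tensor powers `V_n^{⊗d}`, `n ≥ 1`, and its morphisms
are the linear maps commuting with the action of the Hecke algebra. Functors on it are the
homogeneous quantum polynomial functors of degree `d`. -/
structure GammaCat (q : Kˣ) (d : ℕ) : Type where
  rank : ℕ+

theorem id_mem_schur (q : Kˣ) (n d : ℕ) :
    (LinearMap.id : TensorPow K n d →ₗ[K] TensorPow K n d) ∈ schur q n n d := fun _ _ => rfl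

theorem comp_mem_schur {q : Kˣ} {r n m d : ℕ} (f : schur q r n d) (g : schur q n m d) :
    g.1 ∘ₗ f.1 ∈ schur q r m d := fun k hk => by
  rw [LinearMap.comp_assoc, f.2 k hk, ← LinearMap.comp_assoc, g.2 k hk, LinearMap.comp_assoc]

instance (q : Kˣ) (d : ℕ) : Category.{u} (GammaCat q d) where
  Hom X Y := schur q X.rank Y.rank d
  id X := ⟨LinearMap.id, id_mem_schur q X.rank d⟩
  comp f g := ⟨g.1 ∘ₗ f.1, comp_mem_schur f g⟩

/-- The quantum polynomial functor `Ω^i_d = S_q^{d-i} ⊗ Λ_q^i`. For `q = 1` it is the classical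
`S^{d-i} ⊗ Λ^i`. -/
def omegaFunctor (q : Kˣ) (d i : ℕ) : GammaCat q d ⥤ ModuleCat.{u} K where
  obj X := ModuleCat.of K (Omega q X.rank d i)
  map f := ModuleCat.ofHom (Omega.map i f)
  map_id X := by
    ext x
    obtain ⟨x, rfl⟩ := Omega.mk_surjective q _ d i x
    rfl
  map_comp f g := by
    ext x
    obtain ⟨x, rfl⟩ := Omega.mk_surjective q _ d i x
    rfl

/-- The quantum polynomial functor `H^i(Ω_d)`. -/
def homologyFunctor (q : Kˣ) (d i : ℕ) : GammaCat q d ⥤ ModuleCat.{u} K where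
  obj X := ModuleCat.of K (Homology q X.rank d i)
  map f := ModuleCat.ofHom (Homology.map i f)
  map_id X := by
    ext x
    obtain ⟨⟨x, hx⟩, rfl⟩ := Homology.mk_surjective q _ d i x
    obtain ⟨x, rfl⟩ := Omega.mk_surjective q _ d i x
    rfl
  map_comp f g := by
    ext x
    obtain ⟨⟨x, hx⟩, rfl⟩ := Homology.mk_surjective q _ d i x
    obtain ⟨x, rfl⟩ := Omega.mk_surjective q _ d i x
    rfl

/-- The quantum Frobenius functor `Γ_q^{dl} V ⥤ Γ_1^d V`. The quantum Frobenius twist `F^{(1)_q}` of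
a classical polynomial functor `F` is `frobenius ⋙ F`. -/
def frobenius {q : Kˣ} {l : ℕ} (hq : IsPrimitiveRoot q l) (hodd : Odd l) (d : ℕ) :
    GammaCat q (d * l) ⥤ GammaCat (1 : Kˣ) d where
  obj X := ⟨X.rank⟩
  map f := ⟨frobLin f.1, frobLin_mem hq hodd.pos f⟩
  map_id _ := Subtype.ext (frobLin_id hodd.pos)
  map_comp f g := Subtype.ext (frobLin_comp hq hodd g f)

/-- The bigraded algebra `Ω(n) = ⨁ Ω^i_d(n)`. -/
abbrev OmegaAlg (q : Kˣ) (n : ℕ) : Type _ := DirectSum (ℕ × ℕ) (OmegaGr q n)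

/-- The bigraded homology algebra `⨁ H^i(Ω_d(n))`. -/
abbrev HomologyAlg (q : Kˣ) (n : ℕ) : Type _ := DirectSum (ℕ × ℕ) (HomologyGr q n)

end Functors
end QuantumDeRham

/-! Write x_a for `symGen q a`, ξ_a for `extGen q a` and [m] for 1 + q² + ⋯ + q^(2(m-1)). The sorted
monomials x^a ξ_J form a basis of Ω(n), by a normal form argument (`ofModel_surjective`,
`normalForm_ofModel`). In this basis the differential is a q-deformed Koszul differential: its
component at the letter i lowers a_i by one, puts i into J, and has coefficient [a_i] times plus or
minus a power of q (`diff_ofModel`). It therefore preserves the weight a + 1_J.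

Since ℓ is odd, q² is again a primitive ℓ-th root of unity, and [m] = 0 exactly when ℓ divides m. If
some entry of the weight is not divisible by ℓ, inverting the component of the differential at that
letter gives a contracting homotopy. If all entries are divisible by ℓ, the differential vanishes.
So the homology has as basis the classes of the monomials of weight divisible by ℓ, namely those
with a = ℓb + (ℓ-1)1_J (`homotopy_formula`, `divProj_diffOp`).

The elements x_a^ℓ and x_a^(ℓ-1) ξ_a are cycles and satisfy the relations of the classical de Rham
algebra: the former are central enough because q^ℓ = 1 and [ℓ] = 0, and the latter anticommute
because q^((ℓ-1)²) q⁻¹ = 1. They define an algebra map `cartier`, which sends the monomial (b, J) to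
a nonzero multiple of the monomial (ℓb + (ℓ-1)1_J, J) (`cartier_monomial`). With the description of
the homology this gives the isomorphism of algebras `cartierEquiv`.

For naturality, the cycle attached to a word I is the class of a fixed braid applied to the word I^ℓ
in which every letter is repeated ℓ times (`frobWord_eq_ofTens`). A Hecke-linear f commutes with
that braid, so the class of the same braid applied to f(I^ℓ) must be found. This tensor is
q-symmetric inside every block of ℓ factors. For one block, a q-symmetric tensor without coordinates
at constant words has only weights not divisible by ℓ, so it is a boundary; treating the blocks one
at a time, only the coordinates at the words J^ℓ contribute (`classLin_blocks`). These are the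
matrix entries of Fr(f). -/

namespace QuantumDeRham

/-! ### Words, generators and relations of Ω(n) -/

noncomputable section Words

open DirectSum

variable {K : Type*} [Field K]

/-- The class of a tensor in the summand `Ω^i_d(n)` of the algebra `Ω(n)`. -/
def ofTens (q : Kˣ) (n d i : ℕ) : TensorPow K n d →ₗ[K] OmegaAlg q n :=
  lof K (ℕ × ℕ) (OmegaGr q n) (d, i) ∘ₗ Omega.mk q n d i

/-- The generator `e_a ⊗ 1` of `Ω(n)`. -/
def symGen (q : Kˣ) {n : ℕ} (a : Fin n) : OmegaAlg q n := ofTens q n 1 0 (tens K fun _ => a)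

/-- The generator `1 ⊗ e_a` of `Ω(n)`. -/
def extGen (q : Kˣ) {n : ℕ} (a : Fin n) : OmegaAlg q n := ofTens q n 1 1 (tens K fun _ => a)

theorem ofTens_apply (q : Kˣ) {n d i : ℕ} (x : TensorPow K n d) :
    ofTens q n d i x = of (OmegaGr q n) (d, i) (Omega.mk q n d i x) := rfl

theorem ofTens_of_mem (q : Kˣ) {n d i : ℕ} {x : TensorPow K n d} (hx : x ∈ relSub q n d i) :
    ofTens q n d i x = 0 := by
  rw [ofTens_apply, (Omega.mk_eq_zero q).2 hx, map_zero]

theorem ofTens_mul (q : Kˣ) {n d₁ i d₂ j : ℕ} (hi : i ≤ d₁) (hj : j ≤ d₂) (x : TensorPow K n d₁)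
    (y : TensorPow K n d₂) :
    ofTens q n d₁ i x * ofTens q n d₂ j y =
      ofTens q n (d₁ + d₂) (i + j) (mulRep q n d₁ i d₂ j x y) := by
  rw [ofTens_apply, ofTens_apply, of_mul_of, ofTens_apply, ← Omega.mul_mk q hi hj]
  rfl

theorem ofTens_cast (q : Kˣ) {n d d' i i' : ℕ} (h : d = d') (hi : i = i') (x : TensorPow K n d) :
    ofTens q n d i x = ofTens q n d' i' (castT h x) :=
  of_eq_of_gradedMonoid_eq (Omega.mk_cast q h hi x _ rfl)

theorem ofTens_zero (q : Kˣ) (n : ℕ) (I : Fin 0 → Fin n) :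
    ofTens q n 0 0 (tens K I) = 1 := by
  rw [Subsingleton.elim I Fin.elim0]; rfl

theorem cast_append_cons {n d : ℕ} (a : Fin n) (I : Fin d → Fin n) :
    castT (add_comm 1 d) (tmul K n 1 d (tens K fun _ => a) (tens K I)) =
      tens K (Fin.cons a I : Fin (d + 1) → Fin n) := by
  rw [tmul_tens, castT_tens]
  congr 1
  have := Fin.append_left_eq_cons (fun _ : Fin 1 => a) I
  rw [this]
  rfl

/-- The left factor has no exterior strand, so the braid in the product is trivial. -/
theorem symGen_mul_ofTens (q : Kˣ) {n d i : ℕ} (hi : i ≤ d) (a : Fin n) (I : Fin d → Fin n) :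
    symGen q a * ofTens q n d i (tens K I) =
      ofTens q n (d + 1) i (tens K (Fin.cons a I : Fin (d + 1) → Fin n)) := by
  rw [symGen, ofTens_mul q (by omega) hi, mulRep_apply, blk_zero_left, Module.End.one_apply,
    ofTens_cast q (add_comm 1 d) (zero_add i), cast_append_cons]

/-- The right factor is purely exterior, so there is no symmetric strand to cross. This case
suffices for inductions on words, because the exterior letters stand at the end. -/
theorem extGen_mul_ofTens (q : Kˣ) {n d : ℕ} (a : Fin n) (I : Fin d → Fin n) :
    extGen q a * ofTens q n d d (tens K I) =
      ofTens q n (d + 1) (d + 1) (tens K (Fin.cons a I : Fin (d + 1) → Fin n)) := by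
  rw [extGen, ofTens_mul q le_rfl le_rfl, mulRep_apply, Nat.sub_self, Nat.sub_self]
  change ofTens q n _ _ (tmul K n 1 d _ _) = _
  rw [ofTens_cast q (add_comm 1 d) (add_comm 1 d), cast_append_cons]

/-- The class of a word is the product of its letters. -/
theorem ofTens_tens (q : Kˣ) {n d i : ℕ} (hi : i ≤ d) (I : Fin d → Fin n) :
    ofTens q n d i (tens K I) = (List.ofFn fun k : Fin d =>
      if (k : ℕ) < d - i then symGen q (I k) else extGen q (I k)).prod := by
  induction d generalizing i with
  | zero =>
    obtain rfl : i = 0 := by omega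
    rw [ofTens_zero]; rfl
  | succ d ih =>
    rw [List.ofFn_succ, List.prod_cons]
    rcases Nat.lt_or_ge d i with h | h
    · obtain rfl : i = d + 1 := by omega
      simp only [Nat.sub_self, Nat.not_lt_zero, if_false]
      have := ih le_rfl (fun k => I k.succ)
      simp only [Nat.sub_self, Nat.not_lt_zero, if_false] at this
      rw [← this, extGen_mul_ofTens]
      congr 2
      exact (Fin.cons_self_tail I).symm
    · have e : d + 1 - i = d - i + 1 := by omega
      simp only [e, Fin.val_zero, Nat.succ_pos, if_true, Fin.val_succ, Nat.add_lt_add_iff_right]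
      rw [← ih h, symGen_mul_ofTens q h]
      congr 2
      exact (Fin.cons_self_tail I).symm

theorem ofTens_const (q : Kˣ) {n : ℕ} (l : ℕ) (a : Fin n) :
    ofTens q n l 0 (tens K fun _ => a) = symGen q a ^ l := by
  rw [ofTens_tens q (Nat.zero_le l)]
  have : (fun k : Fin l => if (k : ℕ) < l - 0 then symGen q a else extGen q a) =
      fun _ => symGen q a := by
    funext k; rw [if_pos (by omega)]
  rw [this, List.ofFn_const, List.prod_replicate]

theorem ofTens_const_one (q : Kˣ) {n : ℕ} (l : ℕ) (a : Fin n) :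
    ofTens q n (l + 1) 1 (tens K fun _ => a) = symGen q a ^ l * extGen q a := by
  rw [ofTens_tens q (by omega), List.ofFn_succ', List.concat_eq_append, List.prod_append]
  have : (fun k : Fin l => if ((Fin.castSucc k : Fin (l + 1)) : ℕ) < l + 1 - 1 then symGen q a
      else extGen q a) = fun _ => symGen q a := by
    funext k; rw [if_pos (by simp)]
  rw [this, List.ofFn_const, List.prod_replicate]
  simp

/-- Reduces linear statements about Ω(n) to words, with `P` an equalizer, a range or a preimage. The
summands with `i > d` need no check because they vanish. -/
theorem tens_mem_span (q : Kˣ) {n : ℕ} (P : Submodule K (OmegaAlg q n))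
    (h : ∀ d i, i ≤ d → ∀ I : Fin d → Fin n, ofTens q n d i (tens K I) ∈ P) : P = ⊤ := by
  refine eq_top_iff.2 fun u hu => ?_
  clear hu
  induction u using DirectSum.induction_on with
  | zero => exact zero_mem _
  | add u v hu hv => exact add_mem hu hv
  | of p x =>
    obtain ⟨d, i⟩ := p
    rcases Nat.lt_or_ge d i with hi | hi
    · rw [Omega.eq_zero_of_lt q hi x, map_zero]; exact zero_mem _
    obtain ⟨x, rfl⟩ := Omega.mk_surjective q n d i x
    rw [← ofTens_apply]
    induction x using Finsupp.induction_linear with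
    | zero => rw [map_zero]; exact zero_mem _
    | add x y hx hy => rw [map_add]; exact add_mem hx hy
    | single I a =>
      rw [← Finsupp.smul_single_one I a, map_smul]
      exact P.smul_mem a (h d i hi I)

section Relations

theorem heckeT_two (q : K) {n : ℕ} (a b : Fin n) :
    heckeT q n 2 0 (tens K ![a, b]) = if a < b then tens K ![b, a]
      else if a = b then q • tens K ![a, b] else (q - q⁻¹) • tens K ![a, b] + tens K ![b, a] := by
  have e : swapAt (k := 0) (by omega) ![a, b] = ![b, a] := by
    funext p; fin_cases p <;> rfl
  rw [heckeT_tens q (by omega), e]; rfl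

theorem symGen_mul_symGen (q : Kˣ) {n : ℕ} (a b : Fin n) :
    symGen q a * symGen q b = ofTens q n 2 0 (tens K ![a, b]) := by
  rw [ofTens_tens q (by omega)]; simp [List.ofFn_succ]

theorem symGen_mul_extGen (q : Kˣ) {n : ℕ} (a b : Fin n) :
    symGen q a * extGen q b = ofTens q n 2 1 (tens K ![a, b]) := by
  rw [ofTens_tens q (by omega)]; simp [List.ofFn_succ]

theorem extGen_mul_extGen (q : Kˣ) {n : ℕ} (a b : Fin n) :
    extGen q a * extGen q b = ofTens q n 2 2 (tens K ![a, b]) := by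
  rw [ofTens_tens q (by omega)]; simp [List.ofFn_succ]

theorem symGen_comm (q : Kˣ) {n : ℕ} {a b : Fin n} (h : a < b) :
    symGen q b * symGen q a = (q : K) • (symGen q a * symGen q b) := by
  have := ofTens_of_mem q (sym_mem q (n := n) (d := 2) (i := 0) (k := 0) (by omega) (tens K ![a, b]))
  rw [map_sub, heckeT_two, if_pos h, map_smul, sub_eq_zero, ← symGen_mul_symGen,
    ← symGen_mul_symGen] at this
  exact this

theorem extGen_sq (q : Kˣ) {n : ℕ} (a : Fin n) : extGen q a * extGen q a = 0 := by
  rw [extGen_mul_extGen]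
  refine ofTens_of_mem q (ext_mem q (k := 0) (by omega) (by omega) _ ?_)
  rw [heckeT_two, if_neg (lt_irrefl _), if_pos rfl]

theorem extGen_comm (q : Kˣ) {n : ℕ} {a b : Fin n} (h : a < b) :
    extGen q b * extGen q a = (-(q : K)⁻¹) • (extGen q a * extGen q b) := by
  have := ofTens_of_mem q
    (ext_mem' q (n := n) (d := 2) (i := 2) (k := 0) (by omega) (by omega) (tens K ![a, b]))
  rw [map_add, heckeT_two, if_pos h, map_smul, ← extGen_mul_extGen,
    ← extGen_mul_extGen] at this
  rw [neg_smul, eq_neg_iff_add_eq_zero, this]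

/-- The braid in this product is a single crossing, so the three cases are those of R. The extra
term for `a > b` is the only failure of q-commutation in the algebra. -/
theorem extGen_mul_symGen (q : Kˣ) {n : ℕ} (a b : Fin n) :
    extGen q a * symGen q b = if a < b then symGen q b * extGen q a
      else if a = b then (q : K) • (symGen q a * extGen q b)
      else ((q : K) - (q : K)⁻¹) • (symGen q a * extGen q b) + symGen q b * extGen q a := by
  have e : Fin.append (fun _ : Fin 1 => a) (fun _ : Fin 1 => b) = ![a, b] := by
    funext p; fin_cases p <;> rfl
  have : extGen q a * symGen q b = ofTens q n 2 1 (heckeT (q : K) n 2 0 (tens K ![a, b])) := by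
    rw [extGen, symGen, ofTens_mul q le_rfl (by omega), mulRep_apply, tmul_tens, e]
    simp [blk, down]
  rw [this, heckeT_two]
  split_ifs <;> simp only [map_add, map_smul, symGen_mul_extGen]

end Relations

end Words
end QuantumDeRham

namespace QuantumDeRham

/-! ### The differential of the whole algebra and its twisted Leibniz rule -/

noncomputable section Differential

open DirectSum

variable {K : Type*} [Field K]

/-- The differential of the algebra `Ω(n)`. -/
def diff (q : Kˣ) (n : ℕ) : OmegaAlg q n →ₗ[K] OmegaAlg q n :=
  toModule K (ℕ × ℕ) (OmegaAlg q n) fun p =>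
    lof K (ℕ × ℕ) (OmegaGr q n) (p.1, p.2 + 1) ∘ₗ delta q n p.1 p.2

/-- The operator that multiplies `Ω^i_d(n)` by `c (d, i)`. -/
def gradeSmul (q : Kˣ) (n : ℕ) (c : ℕ × ℕ → K) : OmegaAlg q n →ₗ[K] OmegaAlg q n :=
  toModule K (ℕ × ℕ) (OmegaAlg q n) fun p => c p • lof K (ℕ × ℕ) (OmegaGr q n) p

theorem diff_of (q : Kˣ) {n : ℕ} (p : ℕ × ℕ) (x : OmegaGr q n p) :
    diff q n (of (OmegaGr q n) p x) =
      of (OmegaGr q n) (p.1, p.2 + 1) (delta q n p.1 p.2 x) :=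
  toModule_lof K p x

theorem diff_ofTens (q : Kˣ) {n d i : ℕ} (x : TensorPow K n d) :
    diff q n (ofTens q n d i x) = ofTens q n d (i + 1) (shuffle (q : K) n d (d - i) x) :=
  diff_of q (d, i) _

theorem gradeSmul_of (q : Kˣ) {n : ℕ} (c : ℕ × ℕ → K) (p : ℕ × ℕ) (x : OmegaGr q n p) :
    gradeSmul q n c (of (OmegaGr q n) p x) = c p • of (OmegaGr q n) p x :=
  toModule_lof K p x

theorem gradeSmul_ofTens (q : Kˣ) {n d i : ℕ} (c : ℕ × ℕ → K) (x : TensorPow K n d) :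
    gradeSmul q n c (ofTens q n d i x) = c (d, i) • ofTens q n d i x :=
  gradeSmul_of q c (d, i) _

theorem alg_ext (q : Kˣ) {n : ℕ} {N : Type*} [AddCommMonoid N] [Module K N]
    {f g : OmegaAlg q n →ₗ[K] N}
    (h : ∀ d i, i ≤ d → ∀ x : TensorPow K n d, f (ofTens q n d i x) = g (ofTens q n d i x)) :
    f = g := by
  refine DirectSum.linearMap_ext K fun p => LinearMap.ext fun x => ?_
  obtain ⟨d, i⟩ := p
  rcases Nat.lt_or_ge d i with hi | hi
  · rw [Omega.eq_zero_of_lt q hi x, map_zero, map_zero]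
  obtain ⟨x, rfl⟩ := Omega.mk_surjective q n d i x
  exact h d i hi x

/-- The Leibniz rule of the quantum de Rham differential. -/
theorem diff_mul (q : Kˣ) {n : ℕ} (u v : OmegaAlg q n) :
    diff q n (u * v) = diff q n u * gradeSmul q n (fun p => (q : K) ^ (p.1 - p.2)) v +
      gradeSmul q n (fun p => (-(q : K)⁻¹) ^ p.2) u * diff q n v := by
  have := alg_ext q (n := n) (f := (LinearMap.mul K (OmegaAlg q n)).compr₂ (diff q n))
    (g := (LinearMap.mul K (OmegaAlg q n)).compl₁₂ (diff q n)
        (gradeSmul q n (fun p => (q : K) ^ (p.1 - p.2))) +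
      (LinearMap.mul K (OmegaAlg q n)).compl₁₂ (gradeSmul q n (fun p => (-(q : K)⁻¹) ^ p.2))
        (diff q n)) fun d₁ i hi x => alg_ext q fun d₂ j hj y => ?_
  · exact LinearMap.congr_fun₂ this u v
  simp only [LinearMap.compr₂_apply, LinearMap.add_apply, LinearMap.compl₁₂_apply,
    LinearMap.mul_apply', diff_ofTens, gradeSmul_ofTens]
  rw [ofTens_mul q hi hj, diff_ofTens]
  have h := ofTens_of_mem q (leibniz q hi hj x y)
  rw [map_sub, sub_eq_zero] at h
  rw [h, map_add, map_smul, map_smul, mul_smul_comm, smul_mul_assoc]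
  congr 2
  -- When no symmetric factor is left the shuffle sum is empty. This case is separate because
  -- `ofTens_mul` needs the exterior degree, raised by one, to stay at most `d₁`.
  · rcases Nat.eq_or_lt_of_le hi with h | h
    · rw [h, Nat.sub_self, shuffle_zero]; simp
    · rw [ofTens_mul q h hj]
      exact congrArg (fun k => ofTens q n (d₁ + d₂) k _) (by omega)
  · rcases Nat.eq_or_lt_of_le hj with h | h
    · rw [h, Nat.sub_self, shuffle_zero]; simp
    · rw [ofTens_mul q hi h]; rfl

theorem diff_symGen (q : Kˣ) {n : ℕ} (a : Fin n) : diff q n (symGen q a) = extGen q a := by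
  rw [symGen, diff_ofTens]; simp [shuffle, up, extGen]

theorem diff_extGen (q : Kˣ) {n : ℕ} (a : Fin n) : diff q n (extGen q a) = 0 := by
  rw [extGen, diff_ofTens, Nat.sub_self, shuffle_zero]; simp

theorem diff_symGen_mul (q : Kˣ) {n : ℕ} (a : Fin n) (v : OmegaAlg q n) :
    diff q n (symGen q a * v) =
      extGen q a * gradeSmul q n (fun p => (q : K) ^ (p.1 - p.2)) v + symGen q a * diff q n v := by
  rw [diff_mul, diff_symGen, symGen, gradeSmul_ofTens]; simp

/-- The symmetric degree is additive. The truncated subtraction is harmless, because the summands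
with `i > d` are zero. -/
theorem gradeSmul_mul (q : Kˣ) {n : ℕ} (u v : OmegaAlg q n) :
    gradeSmul q n (fun p => (q : K) ^ (p.1 - p.2)) (u * v) =
      gradeSmul q n (fun p => (q : K) ^ (p.1 - p.2)) u *
        gradeSmul q n (fun p => (q : K) ^ (p.1 - p.2)) v := by
  have := alg_ext q (n := n) (f := (LinearMap.mul K (OmegaAlg q n)).compr₂
      (gradeSmul q n (fun p => (q : K) ^ (p.1 - p.2))))
    (g := (LinearMap.mul K (OmegaAlg q n)).compl₁₂ 
        (gradeSmul q n (fun p => (q : K) ^ (p.1 - p.2)))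
        (gradeSmul q n (fun p => (q : K) ^ (p.1 - p.2))))
     fun d₁ i hi x => alg_ext q fun d₂ j hj y => ?_
  · exact LinearMap.congr_fun₂ this u v
  simp only [LinearMap.compr₂_apply, LinearMap.compl₁₂_apply,
    LinearMap.mul_apply', gradeSmul_ofTens]
  rw [ofTens_mul q hi hj, gradeSmul_ofTens, ← ofTens_mul q hi hj, smul_mul_smul_comm, ← pow_add]
  congr 2
  omega

theorem gradeSmul_symGen (q : Kˣ) {n : ℕ} (a : Fin n) :
    gradeSmul q n (fun p => (q : K) ^ (p.1 - p.2)) (symGen q a) = (q : K) • symGen q a := by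
  rw [symGen, gradeSmul_ofTens]; simp

theorem gradeSmul_extGen (q : Kˣ) {n : ℕ} (a : Fin n) :
    gradeSmul q n (fun p => (q : K) ^ (p.1 - p.2)) (extGen q a) = extGen q a := by
  rw [extGen, gradeSmul_ofTens]; simp

theorem gradeSmul_one (q : Kˣ) (n : ℕ) :
    gradeSmul q n (fun p => (q : K) ^ (p.1 - p.2)) 1 = 1 := by
  rw [← ofTens_zero q n Fin.elim0, gradeSmul_ofTens]; simp

theorem diff_one (q : Kˣ) (n : ℕ) : diff q n 1 = 0 := by
  have h := diff_mul q (1 : OmegaAlg q n) 1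
  have e : gradeSmul q n (fun p => (-(q : K)⁻¹) ^ p.2) 1 = 1 := by
    rw [← ofTens_zero q n Fin.elim0, gradeSmul_ofTens]; simp
  rw [gradeSmul_one, e, mul_one, mul_one, one_mul] at h
  simpa using h

end Differential
end QuantumDeRham

namespace QuantumDeRham

/-! ### Ordered monomials in q-commuting letters -/

noncomputable section Monomials

variable {K : Type*} [Field K] {R : Type*} [Ring R] [Algebra K R]

/-- The sum of the entries of `a` at the places below `s`. -/
def lowSum {n : ℕ} (a : Fin n → ℕ) (s : Fin n) : ℕ := ∑ j, if j < s then a j else 0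

/-- The sum of the entries of `a` at the places above `s`. -/
def highSum {n : ℕ} (a : Fin n → ℕ) (s : Fin n) : ℕ := ∑ j, if s < j then a j else 0

theorem lowSum_add {n : ℕ} (a b : Fin n → ℕ) (s : Fin n) :
    lowSum (a + b) s = lowSum a s + lowSum b s := by
  rw [lowSum, lowSum, lowSum, ← Finset.sum_add_distrib]
  refine Finset.sum_congr rfl fun j _ => ?_
  split_ifs <;> simp

theorem highSum_add {n : ℕ} (a b : Fin n → ℕ) (s : Fin n) :
    highSum (a + b) s = highSum a s + highSum b s := by
  rw [highSum, highSum, highSum, ← Finset.sum_add_distrib]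
  refine Finset.sum_congr rfl fun j _ => ?_
  split_ifs <;> simp

theorem lowSum_single {n : ℕ} (t s : Fin n) :
    lowSum (Pi.single t 1) s = if t < s then 1 else 0 := by
  rw [lowSum, Finset.sum_eq_single t]
  · simp
  · intro j _ hj; simp [hj]
  · simp

theorem highSum_single {n : ℕ} (t s : Fin n) :
    highSum (Pi.single t 1) s = if s < t then 1 else 0 := by
  rw [highSum, Finset.sum_eq_single t]
  · simp
  · intro j _ hj; simp [hj]
  · simp

theorem lowSum_eq_zero {n : ℕ} {a : Fin n → ℕ} {s : Fin n} (h : ∀ j < s, a j = 0) :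
    lowSum a s = 0 :=
  Finset.sum_eq_zero fun j _ => by split_ifs with hj; exacts [h j hj, rfl]

theorem sum_eq_add_highSum {n : ℕ} {a : Fin n → ℕ} {s : Fin n} (h : ∀ j < s, a j = 0) :
    ∑ j, a j = a s + highSum a s := by
  have : ∀ j, a j = (if j = s then a s else 0) + if s < j then a j else 0 := by
    intro j
    rcases lt_trichotomy j s with hj | hj | hj
    · simp [h j hj, hj.ne]
    · simp [hj]
    · simp [hj, hj.ne']
  rw [Finset.sum_congr rfl fun j _ => this j, Finset.sum_add_distrib, highSum]
  simp

/-- Induction on exponents that adds letters in decreasing order. -/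
theorem exponent_induction {n : ℕ} {p : (Fin n → ℕ) → Prop} (h0 : p 0)
    (h : ∀ a s, (∀ j < s, a j = 0) → p a → p (a + Pi.single s 1)) (a : Fin n → ℕ) : p a := by
  obtain ⟨m, hm⟩ : ∃ m, m = ∑ j, a j := ⟨_, rfl⟩
  induction m generalizing a with
  | zero =>
    have : a = 0 := funext fun j => Finset.sum_eq_zero_iff.1 hm.symm j (Finset.mem_univ j)
    rw [this]; exact h0
  | succ m ih =>
    have hne : (Finset.univ.filter fun j => a j ≠ 0).Nonempty := by
      by_contra hne
      rw [Finset.not_nonempty_iff_eq_empty, Finset.filter_eq_empty_iff] at hne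
      rw [Finset.sum_eq_zero fun j hj => not_not.1 (hne hj)] at hm
      omega
    -- Peeling off the smallest letter present means that putting it back on the left of a sorted
    -- monomial produces no scalar.
    set s := (Finset.univ.filter fun j => a j ≠ 0).min' hne with hs
    have h1 : a s ≠ 0 := (Finset.mem_filter.1 (Finset.min'_mem _ hne)).2
    have h2 : ∀ j < s, a j = 0 := fun j hj => by
      by_contra hj'
      exact absurd (Finset.min'_le _ j (Finset.mem_filter.2 ⟨Finset.mem_univ j, hj'⟩)) hj.not_ge
    have e : a = (a - Pi.single s 1) + Pi.single s 1 := by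
      funext j
      by_cases hj : j = s
      · subst hj; simp; omega
      · simp [hj]
    rw [e]
    refine h _ s (fun j hj => by simp [h2 j hj]) (ih _ ?_)
    rw [e] at hm
    simp only [Pi.add_apply, Finset.sum_add_distrib, Finset.sum_pi_single', Finset.mem_univ,
      if_true] at hm
    omega

/-- The ordered monomial `z_0 ^ a_0 * ⋯ * z_{n-1} ^ a_{n-1}`. -/
def ordMon {n : ℕ} (z : Fin n → R) (a : Fin n → ℕ) : R := (List.ofFn fun i => z i ^ a i).prod

theorem ordMon_zero {n : ℕ} (z : Fin n → R) : ordMon z 0 = 1 := by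
  simp [ordMon, List.ofFn_const]

theorem ordMon_succ {n : ℕ} (z : Fin (n + 1) → R) (a : Fin (n + 1) → ℕ) :
    ordMon z a = z 0 ^ a 0 * ordMon (fun i => z i.succ) (fun i => a i.succ) := by
  rw [ordMon, List.ofFn_succ, List.prod_cons]; rfl

theorem mul_pow_of_qcomm {r : K} {u v : R} (h : u * v = r • (v * u)) (m : ℕ) :
    u * v ^ m = r ^ m • (v ^ m * u) := by
  induction m with
  | zero => simp
  | succ m ih =>
    rw [pow_succ, ← mul_assoc, ih, smul_mul_assoc, mul_assoc, h, mul_smul_comm, smul_smul,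
      ← mul_assoc, ← pow_succ]

theorem pow_mul_of_qcomm {r : K} {u v : R} (h : u * v = r • (v * u)) (m : ℕ) :
    u ^ m * v = r ^ m • (v * u ^ m) := by
  induction m with
  | zero => simp
  | succ m ih =>
    rw [pow_succ, mul_assoc, h, mul_smul_comm, ← mul_assoc, ih, smul_mul_assoc, smul_smul,
      mul_assoc, pow_succ, mul_comm r]

/-- The new letter moves right past exactly the smaller letters, each of which contributes one
factor `r`. -/
theorem gen_mul_ordMon {r : K} {n : ℕ} {z : Fin n → R}
    (hz : ∀ i j, i < j → z j * z i = r • (z i * z j)) (s : Fin n) (a : Fin n → ℕ) :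
    z s * ordMon z a = r ^ lowSum a s • ordMon z (a + Pi.single s 1) := by
  induction n with
  | zero => exact s.elim0
  | succ n ih =>
    rw [ordMon_succ, ordMon_succ, lowSum, Fin.sum_univ_succ]
    induction s using Fin.cases with
    | zero =>
      simp only [Fin.not_lt_zero, if_false, Finset.sum_const_zero, add_zero, pow_zero, one_smul]
      rw [← mul_assoc, ← pow_succ']
      simp [Fin.succ_ne_zero]
    | succ t =>
      have e : (fun i : Fin n => (a + (Pi.single t.succ 1 : Fin (n + 1) → ℕ)) i.succ) =
          (fun i => a i.succ) + Pi.single t 1 := by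
        funext i
        simp [Pi.single_apply]
      rw [← mul_assoc, mul_pow_of_qcomm (hz 0 t.succ (Fin.succ_pos t)), smul_mul_assoc, mul_assoc,
        ih (fun i j hij => hz _ _ (Fin.succ_lt_succ_iff.2 hij)), mul_smul_comm, smul_smul, e,
        ← pow_add]
      simp [lowSum, (Fin.succ_ne_zero t).symm]

theorem gen_mul_ordMon_of_low {r : K} {n : ℕ} {z : Fin n → R}
    (hz : ∀ i j, i < j → z j * z i = r • (z i * z j)) {s : Fin n} {a : Fin n → ℕ}
    (h : ∀ j < s, a j = 0) : z s * ordMon z a = ordMon z (a + Pi.single s 1) := by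
  rw [gen_mul_ordMon hz, lowSum_eq_zero h, pow_zero, one_smul]

/-- Commutation is asked only for the powers that occur, so letters of exponent zero may fail to
q-commute with `w`. -/
theorem mul_ordMon_comm {n : ℕ} {z : Fin n → R} {a : Fin n → ℕ} {w : R} {r : Fin n → K}
    (h : ∀ j, w * z j ^ a j = r j • (z j ^ a j * w)) :
    w * ordMon z a = (∏ j, r j) • (ordMon z a * w) := by
  induction n with
  | zero => simp [ordMon]
  | succ n ih =>
    rw [ordMon_succ, ← mul_assoc, h 0, smul_mul_assoc, mul_assoc,
      ih (fun j => h j.succ), Fin.prod_univ_succ, mul_smul_comm, smul_smul, mul_assoc]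

theorem ordMon_eq_zero {n : ℕ} {z : Fin n → R} {a : Fin n → ℕ} (s : Fin n) (h : z s ^ a s = 0) :
    ordMon z a = 0 :=
  List.prod_eq_zero ((List.mem_ofFn).2 ⟨s, h⟩)

theorem ordMon_mem {n : ℕ} {z : Fin n → R} (P : Submonoid R) (h : ∀ i, z i ∈ P)
    (a : Fin n → ℕ) : ordMon z a ∈ P := by
  refine P.list_prod_mem fun x hx => ?_
  obtain ⟨i, rfl⟩ := (List.mem_ofFn).1 hx
  exact P.pow_mem (h i) _

theorem map_ordMon {R' : Type*} [Ring R'] (f : R →* R') {n : ℕ} (z : Fin n → R) (a : Fin n → ℕ) :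
    f (ordMon z a) = ordMon (fun i => f (z i)) a := by
  rw [ordMon, map_list_prod, List.map_ofFn]
  congr 2
  funext i
  simp

/-- The exponents of the squarefree monomial supported on `J`. -/
def ind {n : ℕ} (J : Finset (Fin n)) : Fin n → ℕ := fun i => if i ∈ J then 1 else 0

theorem ind_insert {n : ℕ} {J : Finset (Fin n)} {s : Fin n} (h : s ∉ J) :
    ind (insert s J) = ind J + Pi.single s 1 := by
  funext i
  by_cases hi : i = s
  · subst hi; simp [ind, h]
  · simp [ind, hi]

theorem ind_empty {n : ℕ} : ind (∅ : Finset (Fin n)) = 0 := by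
  funext i; simp [ind]

/-- `A` and `B` are the products of the entries outside the places `k` and `k + 1`. Comparing two
words that differ by an adjacent swap thus reduces to products of two letters. -/
theorem ofFn_prod_split {M : Type*} [Monoid M] {d k : ℕ} (h : k + 1 < d) (f : Fin d → M) :
    ∃ A B : M, ∀ g : Fin d → M, (∀ p : Fin d, (p : ℕ) ≠ k → (p : ℕ) ≠ k + 1 → g p = f p) →
      (List.ofFn g).prod = A * (g ⟨k, Nat.lt_of_succ_lt h⟩ * g ⟨k + 1, h⟩) * B := by
  induction d generalizing k with
  | zero => omega
  | succ d ih =>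
    cases k with
    | zero =>
      obtain ⟨d, rfl⟩ : ∃ d', d = d' + 1 := ⟨d - 1, by omega⟩
      refine ⟨1, (List.ofFn fun p : Fin d => f p.succ.succ).prod, fun g hg => ?_⟩
      rw [List.ofFn_succ, List.ofFn_succ, List.prod_cons, List.prod_cons, one_mul, ← mul_assoc]
      have : (fun p : Fin d => g p.succ.succ) = fun p => f p.succ.succ := by
        funext p; exact hg _ (by simp) (by simp)
      rw [this]
      rfl
    | succ k =>
      obtain ⟨A, B, hAB⟩ := ih (k := k) (by omega) (fun p => f p.succ)
      refine ⟨f 0 * A, B, fun g hg => ?_⟩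
      rw [List.ofFn_succ, List.prod_cons, hAB (fun p => g p.succ) fun p h1 h2 =>
        hg _ (by simpa using h1) (by simpa using h2), hg 0 (by simp) (by simp)]
      simp only [mul_assoc]
      rfl

end Monomials
end QuantumDeRham

namespace QuantumDeRham

/-! ### The basis of sorted monomials -/

noncomputable section Model

open DirectSum

variable {K : Type*} [Field K]

/-- The vector space with basis the pairs `(a, J)`, which stand for the monomials
`∏ e_i ^ a_i ⊗ ⋀_{j ∈ J} e_j`. -/
abbrev Model (K : Type*) [Field K] (n : ℕ) : Type _ := ((Fin n → ℕ) × Finset (Fin n)) →₀ K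

/-- A basis vector of `Model K n`. -/
abbrev mono (K : Type*) [Field K] {n : ℕ} (a : Fin n → ℕ) (J : Finset (Fin n)) : Model K n :=
  Finsupp.single (a, J) 1

theorem model_ext {n : ℕ} {N : Type*} [AddCommMonoid N] [Module K N] {f g : Model K n →ₗ[K] N}
    (h : ∀ a J, f (mono K a J) = g (mono K a J)) : f = g :=
  Finsupp.lhom_ext' fun p => LinearMap.ext_ring (h p.1 p.2)

/-- Multiplication by a symmetric generator, in terms of monomials. -/
def symOp (q : Kˣ) {n : ℕ} (s : Fin n) : Module.End K (Model K n) :=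
  Finsupp.linearCombination K fun p => (q : K) ^ lowSum p.1 s • mono K (p.1 + Pi.single s 1) p.2

/-- Multiplication by an exterior generator, in terms of monomials. -/
def extOp (q : Kˣ) {n : ℕ} (s : Fin n) : Module.End K (Model K n) :=
  Finsupp.linearCombination K fun p =>
    if s ∈ p.2 then 0 else (-(q : K)⁻¹) ^ lowSum (ind p.2) s • mono K p.1 (insert s p.2)

theorem symOp_mono (q : Kˣ) {n : ℕ} (s : Fin n) (a : Fin n → ℕ) (J : Finset (Fin n)) :
    symOp q s (mono K a J) = (q : K) ^ lowSum a s • mono K (a + Pi.single s 1) J := by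
  simp [symOp]

theorem extOp_mono (q : Kˣ) {n : ℕ} (s : Fin n) (a : Fin n → ℕ) (J : Finset (Fin n)) :
    extOp q s (mono K a J) =
      if s ∈ J then 0 else (-(q : K)⁻¹) ^ lowSum (ind J) s • mono K a (insert s J) := by
  simp [extOp]

/-- This and the next two lemmas check that the formal operators obey the relations of the
generators; this is what makes the normal form of a word compatible with the relations of Ω(n). -/
theorem symOp_comm (q : Kˣ) {n : ℕ} {a b : Fin n} (h : a < b) :
    symOp q b * symOp q a = (q : K) • (symOp q a * symOp q b) := by
  refine model_ext fun c J => ?_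
  simp only [Module.End.mul_apply, LinearMap.smul_apply, symOp_mono, map_smul, smul_smul,
    lowSum_add, lowSum_single, h, h.not_gt, if_true, if_false, add_zero]
  rw [add_right_comm]
  congr 1
  ring

theorem extOp_sq (q : Kˣ) {n : ℕ} (a : Fin n) : extOp q a * extOp q a = 0 := by
  refine model_ext fun c J => ?_
  simp only [Module.End.mul_apply, extOp_mono]
  split_ifs <;> simp [extOp_mono, -Finsupp.smul_single]

theorem extOp_comm (q : Kˣ) {n : ℕ} {a b : Fin n} (h : a < b) :
    extOp q b * extOp q a = (-(q : K)⁻¹) • (extOp q a * extOp q b) := by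
  refine model_ext fun c J => ?_
  simp only [Module.End.mul_apply, LinearMap.smul_apply, extOp_mono]
  by_cases ha : a ∈ J <;> by_cases hb : b ∈ J
  · simp [ha, hb]
  · simp [ha, hb, extOp_mono, -Finsupp.smul_single]
  · simp [ha, hb, extOp_mono, -Finsupp.smul_single]
  · simp only [ha, hb, if_false, map_smul, extOp_mono, Finset.mem_insert, h.ne, h.ne', or_self,
      ind_insert ha, ind_insert hb, lowSum_add, lowSum_single, h, h.not_gt, if_true, smul_smul,
      add_zero, Finset.insert_comm a b]
    congr 1
    ring

/-- The normal form of the word `I` in `S_q^{d-i} ⊗ Λ_q^i`. -/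
def wordForm (q : Kˣ) {n : ℕ} (d i : ℕ) (I : Fin d → Fin n) : Model K n :=
  (List.ofFn fun k : Fin d => if (k : ℕ) < d - i then symOp q (I k) else extOp q (I k)).prod
    (mono K 0 ∅)

theorem wordForm_cons_sym (q : Kˣ) {n d i : ℕ} (hi : i ≤ d) (a : Fin n) (I : Fin d → Fin n) :
    wordForm q (d + 1) i (Fin.cons a I : Fin (d + 1) → Fin n) = symOp q a (wordForm q d i I) := by
  have e : d + 1 - i = d - i + 1 := by omega
  rw [wordForm, List.ofFn_succ, List.prod_cons, Module.End.mul_apply]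
  simp only [e, Fin.val_zero, Nat.succ_pos, if_true, Fin.val_succ, Nat.add_lt_add_iff_right,
    Fin.cons_zero, Fin.cons_succ]
  rfl

theorem wordForm_cons_ext (q : Kˣ) {n d : ℕ} (a : Fin n) (I : Fin d → Fin n) :
    wordForm q (d + 1) (d + 1) (Fin.cons a I : Fin (d + 1) → Fin n) =
      extOp q a (wordForm q d d I) := by
  rw [wordForm, List.ofFn_succ, List.prod_cons, Module.End.mul_apply, wordForm]
  simp only [Nat.sub_self, Nat.not_lt_zero, if_false, Fin.cons_zero, Fin.cons_succ]

/-- A word is built from its right end: all exterior letters come before any symmetric one, so the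
exterior step only meets purely exterior words. -/
theorem word_induction {n : ℕ} {p : ∀ d _, (Fin d → Fin n) → Prop} (h0 : p 0 0 Fin.elim0)
    (hx : ∀ d i (a : Fin n) (I : Fin d → Fin n), i ≤ d → p d i I → p (d + 1) i (Fin.cons a I))
    (hy : ∀ d (a : Fin n) (I : Fin d → Fin n), p d d I → p (d + 1) (d + 1) (Fin.cons a I))
    {d i : ℕ} (hi : i ≤ d) (I : Fin d → Fin n) : p d i I := by
  induction d generalizing i with
  | zero =>
    obtain rfl : i = 0 := by omega
    rw [Subsingleton.elim I Fin.elim0]; exact h0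
  | succ d ih =>
    rw [← Fin.cons_self_tail I]
    rcases Nat.lt_or_ge d i with h | h
    · obtain rfl : i = d + 1 := by omega
      exact hy d _ _ (ih le_rfl _)
    · exact hx d i _ _ h (ih h _)

/-- The sorted monomial `∏ e_i ^ a_i ⊗ ⋀_{j ∈ J} e_j` of `Ω(n)`. -/
def monomial (q : Kˣ) {n : ℕ} (a : Fin n → ℕ) (J : Finset (Fin n)) : OmegaAlg q n :=
  ordMon (symGen q) a * ordMon (extGen q) (ind J)

/-- The map sending a basis vector to the sorted monomial. -/
def ofModel (q : Kˣ) (n : ℕ) : Model K n →ₗ[K] OmegaAlg q n :=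
  Finsupp.linearCombination K fun p => monomial q p.1 p.2

theorem ofModel_mono (q : Kˣ) {n : ℕ} (a : Fin n → ℕ) (J : Finset (Fin n)) :
    ofModel q n (mono K a J) = monomial q a J := by
  simp [ofModel]

theorem symGen_mul_monomial (q : Kˣ) {n : ℕ} (s : Fin n) (a : Fin n → ℕ) (J : Finset (Fin n)) :
    symGen q s * monomial q a J = (q : K) ^ lowSum a s • monomial q (a + Pi.single s 1) J := by
  rw [monomial, ← mul_assoc, gen_mul_ordMon (fun i j h => symGen_comm q h), smul_mul_assoc,
    monomial]

theorem extGen_mul_ordMon (q : Kˣ) {n : ℕ} (s : Fin n) (J : Finset (Fin n)) :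
    extGen q s * ordMon (extGen q) (ind J) = if s ∈ J then 0 else
      (-(q : K)⁻¹) ^ lowSum (ind J) s • ordMon (extGen q) (ind (insert s J)) := by
  rw [gen_mul_ordMon (fun i j h => extGen_comm q h)]
  split_ifs with h
  · rw [ordMon_eq_zero s, smul_zero]
    simp [ind, h, pow_two, extGen_sq]
  · rw [ind_insert h]

theorem ofModel_symOp (q : Kˣ) {n : ℕ} (s : Fin n) (m : Model K n) :
    ofModel q n (symOp q s m) = symGen q s * ofModel q n m := by
  have : ofModel q n ∘ₗ symOp q s = LinearMap.mulLeft K (symGen q s) ∘ₗ ofModel q n :=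
    model_ext fun a J => by
      simp only [LinearMap.comp_apply, LinearMap.mulLeft_apply, symOp_mono, map_smul,
        ofModel_mono, symGen_mul_monomial]
  exact LinearMap.congr_fun this m

/-- The span of the purely exterior monomials. -/
def extModel (K : Type*) [Field K] (n : ℕ) : Submodule K (Model K n) :=
  Submodule.span K (Set.range fun J => mono K 0 J)

/-- The operator `extOp` ignores the symmetric part, whereas ξ_s does not commute with it in Ω(n);
hence the restriction to purely exterior monomials. -/
theorem ofModel_extOp (q : Kˣ) {n : ℕ} (s : Fin n) {m : Model K n} (hm : m ∈ extModel K n) :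
    ofModel q n (extOp q s m) = extGen q s * ofModel q n m := by
  have : extModel K n ≤ LinearMap.eqLocus (ofModel q n ∘ₗ extOp q s)
      (LinearMap.mulLeft K (extGen q s) ∘ₗ ofModel q n) := by
    refine Submodule.span_le.2 ?_
    rintro _ ⟨J, rfl⟩
    simp only [SetLike.mem_coe, LinearMap.mem_eqLocus, LinearMap.comp_apply,
      LinearMap.mulLeft_apply, extOp_mono, ofModel_mono, monomial, ordMon_zero, one_mul,
      extGen_mul_ordMon]
    split_ifs
    · rw [map_zero]
    · rw [map_smul, ofModel_mono, monomial, ordMon_zero, one_mul]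
  exact this hm

theorem extOp_mem (q : Kˣ) {n : ℕ} (s : Fin n) {m : Model K n} (hm : m ∈ extModel K n) :
    extOp q s m ∈ extModel K n := by
  have : extModel K n ≤ (extModel K n).comap (extOp q s) := by
    refine Submodule.span_le.2 ?_
    rintro _ ⟨J, rfl⟩
    simp only [SetLike.mem_coe, Submodule.mem_comap, extOp_mono]
    split_ifs
    · exact zero_mem _
    · exact Submodule.smul_mem _ _ (Submodule.subset_span ⟨_, rfl⟩)
  exact this hm

/-- Sorting a word does not change its class, so the sorted monomials span. The second clause is
carried along to justify the exterior step of the induction. -/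
theorem ofModel_wordForm (q : Kˣ) {n d i : ℕ} (hi : i ≤ d) (I : Fin d → Fin n) :
    ofModel q n (wordForm q d i I) = ofTens q n d i (tens K I) ∧
      (i = d → wordForm q d i I ∈ extModel K n) := by
  refine word_induction (p := fun d i I => ofModel q n (wordForm q d i I) =
    ofTens q n d i (tens K I) ∧ (i = d → wordForm q d i I ∈ extModel K n)) ?_ ?_ ?_ hi I
  · rw [ofTens_zero]
    refine ⟨?_, fun _ => Submodule.subset_span ⟨∅, ?_⟩⟩
    · simp only [wordForm, List.ofFn_zero, List.prod_nil, Module.End.one_apply, ofModel_mono,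
        monomial, ordMon_zero, ind_empty, one_mul]
    · simp [wordForm]
  · intro d i a I h ih
    rw [wordForm_cons_sym q h, ofModel_symOp, ih.1, symGen_mul_ofTens q h]
    exact ⟨rfl, fun h' => by omega⟩
  · intro d a I ih
    rw [wordForm_cons_ext, ofModel_extOp q a (ih.2 rfl), ih.1, extGen_mul_ofTens]
    exact ⟨rfl, fun _ => extOp_mem q a (ih.2 rfl)⟩

theorem ofModel_surjective (q : Kˣ) (n : ℕ) : Function.Surjective (ofModel q n) := by
  rw [← LinearMap.range_eq_top]
  exact tens_mem_span q _ fun d i hi I => ⟨_, (ofModel_wordForm q hi I).1⟩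

theorem wordForm_swap (q : Kˣ) {n d i k : ℕ} (h : k + 1 < d) (I : Fin d → Fin n)
    (hI : I ⟨k, Nat.lt_of_succ_lt h⟩ < I ⟨k + 1, h⟩) :
    (k + 1 < d - i → wordForm q d i (swapAt h I) = (q : K) • wordForm q d i I) ∧
    (d - i ≤ k → wordForm q d i (swapAt h I) = (-(q : K)⁻¹) • wordForm q d i I) := by
  obtain ⟨A, B, hAB⟩ := ofFn_prod_split h (fun k : Fin d =>
    if (k : ℕ) < d - i then symOp q (I k) else extOp q (I k))
  have e1 := hAB _ fun _ _ _ => rfl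
  have e2 := hAB (fun k : Fin d => if (k : ℕ) < d - i then symOp q (swapAt h I k)
    else extOp q (swapAt h I k)) fun p h1 h2 => by rw [swapAt_ne h I p h1 h2]
  rw [swapAt_left, swapAt_right] at e2
  constructor <;> intro hk <;> rw [wordForm, wordForm, e1, e2]
  · rw [if_pos (show k < d - i by omega), if_pos hk, if_pos (show k < d - i by omega), if_pos hk,
      symOp_comm q hI, mul_smul_comm, smul_mul_assoc]
    rfl
  · have h1 : ¬ k < d - i := by omega
    have h2 : ¬ k + 1 < d - i := by omega
    simp only [h1, h2, if_false]
    rw [extOp_comm q hI, mul_smul_comm, smul_mul_assoc]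
    rfl

theorem wordForm_eq_zero (q : Kˣ) {n d i k : ℕ} (h : k + 1 < d) (I : Fin d → Fin n)
    (hI : I ⟨k, Nat.lt_of_succ_lt h⟩ = I ⟨k + 1, h⟩) (hk : d - i ≤ k) : wordForm q d i I = 0 := by
  obtain ⟨A, B, hAB⟩ := ofFn_prod_split h (fun k : Fin d =>
    if (k : ℕ) < d - i then symOp q (I k) else extOp q (I k))
  have h1 : ¬ k < d - i := by omega
  have h2 : ¬ k + 1 < d - i := by omega
  rw [wordForm, hAB _ fun _ _ _ => rfl]
  simp only [h1, h2, if_false]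
  rw [hI, extOp_sq, mul_zero, zero_mul, LinearMap.zero_apply]

theorem wordForm_heckeT_sym (q : Kˣ) {n d i k : ℕ} (hk : k + 1 < d - i) (x : TensorPow K n d) :
    Finsupp.linearCombination K (wordForm q d i) (heckeT (q : K) n d k x) =
      (q : K) • Finsupp.linearCombination K (wordForm q d i) x := by
  have h : k + 1 < d := by omega
  have := end_ext (f := Finsupp.linearCombination K (wordForm q (n := n) d i) ∘ₗ
      heckeT (q : K) n d k) (g := (q : K) • Finsupp.linearCombination K (wordForm q d i)) fun I => by
    rw [LinearMap.comp_apply, heckeT_tens _ h, LinearMap.smul_apply]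
    split_ifs with h1 h2
    · simp only [Finsupp.linearCombination_single, one_smul]
      exact (wordForm_swap q h I h1).1 hk
    · rw [map_smul]
    -- After the swap the two letters are ascending, so the normal form of `I` is `q` times that of
    -- the swapped word. The claim becomes q(q - q⁻¹) + 1 = q².
    · have h3 := (wordForm_swap q (i := i) h (swapAt h I) (by
        rw [swapAt_left, swapAt_right]; exact lt_of_le_of_ne (not_lt.1 h1) (Ne.symm h2))).1 hk
      rw [swapAt_swapAt] at h3
      simp only [map_add, map_smul, Finsupp.linearCombination_single, one_smul, h3]
      match_scalars
      field_simp
      ring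
  exact LinearMap.congr_fun this x

theorem wordForm_heckeT_ext (q : Kˣ) {n d i k : ℕ} (hk : d - i ≤ k) (h : k + 1 < d)
    (x : TensorPow K n d) :
    Finsupp.linearCombination K (wordForm q d i) (heckeT (q : K) n d k x) =
      (-(q : K)⁻¹) • Finsupp.linearCombination K (wordForm q d i) x := by
  have := end_ext (f := Finsupp.linearCombination K (wordForm q (n := n) d i) ∘ₗ
      heckeT (q : K) n d k) (g := (-(q : K)⁻¹) • Finsupp.linearCombination K (wordForm q d i))
    fun I => by
    rw [LinearMap.comp_apply, heckeT_tens _ h, LinearMap.smul_apply]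
    split_ifs with h1 h2
    · simp only [Finsupp.linearCombination_single, one_smul]
      exact (wordForm_swap q h I h1).2 hk
    · simp only [map_smul, Finsupp.linearCombination_single,
        wordForm_eq_zero q h I h2 hk, smul_zero]
    · have h3 := (wordForm_swap q (i := i) h (swapAt h I) (by
        rw [swapAt_left, swapAt_right]; exact lt_of_le_of_ne (not_lt.1 h1) (Ne.symm h2))).2 hk
      rw [swapAt_swapAt] at h3
      simp only [map_add, map_smul, Finsupp.linearCombination_single, one_smul, h3]
      match_scalars
      field_simp
      ring
  exact LinearMap.congr_fun this x

/-- At exterior places the normal form turns T_k into the scalar -q⁻¹, while a relation `x`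
satisfies T_k x = q x. So q + q⁻¹ annihilates the normal form of `x`, and the hypothesis makes this
scalar invertible. -/
theorem relSub_le_ker (q : Kˣ) (hq : (q : K) ^ 2 ≠ -1) {n d i : ℕ} (hi : i ≤ d) :
    relSub q n d i ≤ LinearMap.ker (Finsupp.linearCombination K (wordForm q (n := n) d i)) := by
  refine relSub_le q hi _ (fun k x hk => ?_) fun k x hk h hx => ?_
  · rw [LinearMap.mem_ker, map_sub, map_smul, wordForm_heckeT_sym q hk, sub_self]
  · have e := wordForm_heckeT_ext q hk h x
    rw [hx, map_smul, ← sub_eq_zero, ← sub_smul] at e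
    refine (smul_eq_zero.1 e).resolve_left fun h0 => hq ?_
    have := q.ne_zero
    field_simp at h0
    linear_combination h0

/-- The normal form of an element of `Ω(n)`. -/
def normalForm (q : Kˣ) (hq : (q : K) ^ 2 ≠ -1) (n : ℕ) : OmegaAlg q n →ₗ[K] Model K n :=
  toModule K (ℕ × ℕ) (Model K n) fun p => if h : p.2 ≤ p.1 then
    (relSub q n p.1 p.2).liftQ _ (relSub_le_ker q hq h) else 0

theorem normalForm_tens (q : Kˣ) (hq : (q : K) ^ 2 ≠ -1) {n d i : ℕ} (hi : i ≤ d)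
    (I : Fin d → Fin n) :
    normalForm q hq n (ofTens q n d i (tens K I)) = wordForm q d i I := by
  have : normalForm q hq n (ofTens q n d i (tens K I)) = (if h : i ≤ d then
    (relSub q n d i).liftQ _ (relSub_le_ker q hq h) else 0) (Omega.mk q n d i (tens K I)) :=
    toModule_lof K (d, i) _
  rw [this, dif_pos hi]
  exact ((relSub q n d i).liftQ_apply _ _).trans (by simp)

theorem normalForm_symGen_mul (q : Kˣ) (hq : (q : K) ^ 2 ≠ -1) {n : ℕ} (a : Fin n)
    (u : OmegaAlg q n) :
    normalForm q hq n (symGen q a * u) = symOp q a (normalForm q hq n u) := by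
  have := tens_mem_span q (LinearMap.eqLocus (normalForm q hq n ∘ₗ
    LinearMap.mulLeft K (symGen q a)) (symOp q a ∘ₗ normalForm q hq n)) fun d i hi I => by
      simp only [LinearMap.mem_eqLocus, LinearMap.comp_apply, LinearMap.mulLeft_apply]
      rw [symGen_mul_ofTens q hi, normalForm_tens q hq hi, normalForm_tens q hq (by omega),
        wordForm_cons_sym q hi]
  exact this.ge trivial

/-- The word lists `J` in increasing order, so no scalar appears when its letters are added from the
largest to the smallest. It starts the induction in `normalForm_ofModel`, where only symmetric
letters can be moved through the normal form. -/
theorem extMonomial_word (q : Kˣ) {n : ℕ} (J : Finset (Fin n)) :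
    ∃ (d : ℕ) (I : Fin d → Fin n), ordMon (extGen q) (ind J) = ofTens q n d d (tens K I) ∧
      wordForm q d d I = mono K 0 J := by
  induction J using Finset.induction_on_min with
  | empty => exact ⟨0, Fin.elim0, by rw [ind_empty, ordMon_zero, ofTens_zero], by simp [wordForm]⟩
  | insert s J hs ih =>
    obtain ⟨d, I, h1, h2⟩ := ih
    have hJ : s ∉ J := fun h => lt_irrefl _ (hs s h)
    have low : lowSum (ind J) s = 0 := lowSum_eq_zero fun j hj => by
      rw [ind, if_neg fun h => (hs j h).not_gt hj]
    refine ⟨d + 1, Fin.cons s I, ?_, ?_⟩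
    · have := extGen_mul_ordMon q s J
      rw [if_neg hJ, low, pow_zero, one_smul] at this
      rw [← this, h1, extGen_mul_ofTens]
    · rw [wordForm_cons_ext, h2, extOp_mono, if_neg hJ, low, pow_zero, one_smul]

/-- Linear independence of the sorted monomials: a monomial is its own normal form, by adding
symmetric letters in decreasing order to a purely exterior word. -/
theorem normalForm_ofModel (q : Kˣ) (hq : (q : K) ^ 2 ≠ -1) {n : ℕ} (m : Model K n) :
    normalForm q hq n (ofModel q n m) = m := by
  have : normalForm q hq n ∘ₗ ofModel q n = LinearMap.id := model_ext fun a J => by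
    rw [LinearMap.comp_apply, ofModel_mono, LinearMap.id_apply]
    induction a using exponent_induction with
    | h0 =>
      obtain ⟨d, I, h1, h2⟩ := extMonomial_word q J
      rw [monomial, ordMon_zero, one_mul, h1, normalForm_tens q hq le_rfl, h2]
    | h a s ha ih =>
      have := symGen_mul_monomial q s a J
      rw [lowSum_eq_zero ha, pow_zero, one_smul] at this
      rw [← this, normalForm_symGen_mul, ih, symOp_mono, lowSum_eq_zero ha, pow_zero, one_smul]
  exact LinearMap.congr_fun this m

theorem ofModel_normalForm (q : Kˣ) (hq : (q : K) ^ 2 ≠ -1) {n : ℕ} (u : OmegaAlg q n) :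
    ofModel q n (normalForm q hq n u) = u := by
  obtain ⟨m, rfl⟩ := ofModel_surjective q n u
  rw [normalForm_ofModel]

end Model
end QuantumDeRham

namespace QuantumDeRham

/-! ### The differential on monomials and its contracting homotopy -/

noncomputable section Homotopy

open DirectSum

variable {K : Type*} [Field K]

/-- The quantum integer `1 + q^2 + ⋯ + q^(2(m-1))`. -/
def qint (q : K) (m : ℕ) : K := ∑ r ∈ Finset.range m, (q ^ 2) ^ r

theorem qint_zero (q : K) : qint q 0 = 0 := by simp [qint]

theorem qint_succ (q : K) (m : ℕ) : qint q (m + 1) = qint q m + (q ^ 2) ^ m := by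
  rw [qint, Finset.sum_range_succ, qint]

theorem qint_mul (q : K) (m : ℕ) : qint q m * (q ^ 2 - 1) = (q ^ 2) ^ m - 1 := geom_sum_mul _ m

/-- As `l` is odd, q² is still a primitive root of order `l`, and it is not 1. So the geometric sum
vanishes exactly when q^(2m) = 1. -/
theorem qint_eq_zero {q : Kˣ} {l : ℕ} (hl : 1 < l) (hodd : Odd l) (hq : IsPrimitiveRoot q l)
    {m : ℕ} : qint (q : K) m = 0 ↔ l ∣ m := by
  have hQ : IsPrimitiveRoot ((q : K) ^ 2) l :=
    ((IsPrimitiveRoot.coe_units_iff (ζ := q)).2 hq).pow_of_coprime 2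
      (Nat.coprime_two_left.2 hodd)
  have h1 := hQ.ne_one hl
  have h := qint_mul (q : K) m
  rw [← hQ.pow_eq_one_iff_dvd, ← sub_eq_zero (b := (1 : K)), ← h, mul_eq_zero]
  simp [sub_eq_zero, h1]

/-- The order of q² is the odd number `l > 1`, whereas -1 has order at most two. This is the
hypothesis of the normal form. -/
theorem sq_ne_neg_one {q : Kˣ} {l : ℕ} (hl : 1 < l) (hodd : Odd l) (hq : IsPrimitiveRoot q l) :
    (q : K) ^ 2 ≠ -1 := by
  have hQ : IsPrimitiveRoot ((q : K) ^ 2) l :=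
    ((IsPrimitiveRoot.coe_units_iff (ζ := q)).2 hq).pow_of_coprime 2
      (Nat.coprime_two_left.2 hodd)
  intro h
  have h1 := hQ.dvd_of_pow_eq_one 2 (by rw [h]; norm_num)
  rcases (Nat.dvd_prime Nat.prime_two).1 h1 with h2 | h2
  · omega
  · subst h2; exact absurd hodd (by decide)

/-- The coefficients of the differential on monomials. -/
def diffCoeff (q : Kˣ) {n : ℕ} (a : Fin n → ℕ) (J : Finset (Fin n)) (i : Fin n) : K :=
  qint (q : K) (a i) * (q : K) ^ highSum a i * (-(q : K)⁻¹) ^ lowSum (ind J) i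

/-- The differential in terms of monomials. -/
def diffOp (q : Kˣ) (n : ℕ) : Module.End K (Model K n) :=
  Finsupp.linearCombination K fun p => ∑ i, if i ∈ p.2 then 0 else
    diffCoeff q p.1 p.2 i • mono K (p.1 - Pi.single i 1) (insert i p.2)

theorem diffOp_mono (q : Kˣ) {n : ℕ} (a : Fin n → ℕ) (J : Finset (Fin n)) :
    diffOp q n (mono K a J) = ∑ i, if i ∈ J then 0 else
      diffCoeff q a J i • mono K (a - Pi.single i 1) (insert i J) := by
  rw [diffOp, Finsupp.linearCombination_single, one_smul]

/-- The elements without symmetric part that are killed by the differential. -/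
def extCycles (q : Kˣ) (n : ℕ) : Submonoid (OmegaAlg q n) where
  carrier := {w | diff q n w = 0 ∧ gradeSmul q n (fun p => (q : K) ^ (p.1 - p.2)) w = w}
  one_mem' := ⟨diff_one q n, gradeSmul_one q n⟩
  mul_mem' {u v} hu hv := by
    refine ⟨?_, ?_⟩
    · rw [diff_mul, hu.1, hv.1, zero_mul, mul_zero, add_zero]
    · rw [gradeSmul_mul, hu.2, hv.2]

theorem extGen_mem_extCycles (q : Kˣ) {n : ℕ} (i : Fin n) : extGen q i ∈ extCycles q n :=
  ⟨diff_extGen q i, gradeSmul_extGen q i⟩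

theorem gradeSmul_ordMon_mul (q : Kˣ) {n : ℕ} (a : Fin n → ℕ) {w : OmegaAlg q n}
    (hw : w ∈ extCycles q n) :
    gradeSmul q n (fun p => (q : K) ^ (p.1 - p.2)) (ordMon (symGen q) a * w) =
      (q : K) ^ (∑ j, a j) • (ordMon (symGen q) a * w) := by
  induction a using exponent_induction with
  | h0 => rw [ordMon_zero, one_mul, hw.2]; simp
  | h a s ha ih =>
    rw [← gen_mul_ordMon_of_low (fun i j h => symGen_comm q h) ha, mul_assoc, gradeSmul_mul, ih,
      gradeSmul_symGen, smul_mul_smul_comm]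
    simp [Finset.sum_add_distrib, pow_succ']

/-- The letters smaller than `s`, which would create the extra term of `extGen_mul_symGen`, do not
occur. Larger letters commute with ξ_s, and each x_s contributes `q`. -/
theorem extGen_mul_symMon (q : Kˣ) {n : ℕ} {s : Fin n} {a : Fin n → ℕ} (ha : ∀ j < s, a j = 0) :
    extGen q s * ordMon (symGen q) a = (q : K) ^ a s • (ordMon (symGen q) a * extGen q s) := by
  rw [mul_ordMon_comm (r := fun j => if j = s then (q : K) ^ a s else 1) fun j => ?_]
  · simp
  have h := extGen_mul_symGen q s j
  rcases lt_trichotomy s j with h1 | h1 | h1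
  · rw [if_pos h1] at h
    rw [if_neg h1.ne', one_smul]
    have := mul_pow_of_qcomm (r := (1 : K)) (by rw [h, one_smul]) (a j)
    simpa using this
  · subst h1
    rw [if_neg (lt_irrefl _), if_pos rfl] at h
    rw [if_pos rfl, mul_pow_of_qcomm h]
  · rw [ha j h1]; simp [h1.ne]

/-- Induction on `a`, adding a smallest letter s. In the Leibniz rule, the term ξ_s x^a w gets
q^(a_s + highSum) from the grading operator and q^(a_s) from moving ξ_s to the right. This is the
increment q^(2a_s) that turns [a_s] into [a_s + 1]. -/
theorem diff_ordMon_mul (q : Kˣ) {n : ℕ} (a : Fin n → ℕ) {w : OmegaAlg q n}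
    (hw : w ∈ extCycles q n) :
    diff q n (ordMon (symGen q) a * w) = ∑ i, (qint (q : K) (a i) * (q : K) ^ highSum a i) •
      (ordMon (symGen q) (a - Pi.single i 1) * (extGen q i * w)) := by
  induction a using exponent_induction with
  | h0 => rw [ordMon_zero, one_mul, hw.1]; simp [qint_zero]
  | h a s ha ih =>
    have hx := gen_mul_ordMon_of_low (fun i j h => symGen_comm q (n := n) h) ha
    rw [← hx, mul_assoc, diff_symGen_mul, gradeSmul_ordMon_mul q a hw, ih, sum_eq_add_highSum ha,
      mul_smul_comm, ← mul_assoc, extGen_mul_symMon q ha, smul_mul_assoc, smul_smul, Finset.mul_sum,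
      ← Finset.add_sum_erase _ _ (Finset.mem_univ s), ← Finset.add_sum_erase _ _ (Finset.mem_univ s),
      ← add_assoc]
    congr 1
    · have e : symGen q s * (ordMon (symGen q) (a - Pi.single s 1) * (extGen q s * w)) =
          symGen q s * ordMon (symGen q) (a - Pi.single s 1) * (extGen q s * w) := by
        rw [mul_assoc]
      have e2 : a + Pi.single s 1 - Pi.single s 1 = a := by funext j; simp
      rw [e2, mul_smul_comm, e, mul_assoc]
      -- Multiplying back by x_s undoes the truncated subtraction only if `a s > 0`; otherwise the
      -- coefficient [0] vanishes.
      have e3 : (qint (q : K) (a s) * (q : K) ^ highSum a s) •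
          (symGen q s * ordMon (symGen q) (a - Pi.single s 1) * (extGen q s * w)) =
          (qint (q : K) (a s) * (q : K) ^ highSum a s) •
          (ordMon (symGen q) a * (extGen q s * w)) := by
        rcases Nat.eq_zero_or_pos (a s) with h0 | h0
        · rw [h0, qint_zero, zero_mul, zero_smul, zero_smul]
        · rw [gen_mul_ordMon_of_low (fun i j h => symGen_comm q h)
            (fun j hj => by simp [ha j hj])]
          congr 3
          funext j
          by_cases hj : j = s
          · subst hj; simp; omega
          · simp [hj]
      rw [e3, ← add_smul]
      congr 1
      rw [highSum_add, highSum_single, if_neg (lt_irrefl _)]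
      simp only [Pi.add_apply, Pi.single_eq_same, qint_succ]
      ring
    · refine Finset.sum_congr rfl fun i hi => ?_
      have his := Finset.ne_of_mem_erase hi
      simp only [Pi.add_apply, Pi.single_eq_of_ne his, add_zero, mul_smul_comm]
      rcases Nat.eq_zero_or_pos (a i) with h0 | h0
      · rw [h0, qint_zero, zero_mul, zero_smul, zero_mul, zero_smul]
      have hsi : s < i := lt_of_le_of_ne (not_lt.1 fun h => h0.ne' (ha i h)) his.symm
      rw [highSum_add, highSum_single, if_neg hsi.not_gt, add_zero, ← mul_assoc,
        gen_mul_ordMon_of_low (fun i j h => symGen_comm q h) (fun j hj => by simp [ha j hj])]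
      congr 3
      funext j
      by_cases hj : j = s
      · subst hj; simp [his.symm]
      · simp [hj]

theorem diff_monomial (q : Kˣ) {n : ℕ} (a : Fin n → ℕ) (J : Finset (Fin n)) :
    diff q n (monomial q a J) = ofModel q n (diffOp q n (mono K a J)) := by
  rw [diffOp_mono, monomial, diff_ordMon_mul q a
    (ordMon_mem _ (extGen_mem_extCycles q) _), map_sum]
  refine Finset.sum_congr rfl fun i _ => ?_
  rw [extGen_mul_ordMon]
  split_ifs
  · simp
  · rw [map_smul, ofModel_mono, mul_smul_comm, smul_smul, diffCoeff, monomial]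

theorem diff_ofModel (q : Kˣ) {n : ℕ} (m : Model K n) :
    diff q n (ofModel q n m) = ofModel q n (diffOp q n m) := by
  have : diff q n ∘ₗ ofModel q n = ofModel q n ∘ₗ diffOp q n := model_ext fun a J => by
    rw [LinearMap.comp_apply, LinearMap.comp_apply, ofModel_mono, diff_monomial]
  exact LinearMap.congr_fun this m

/-- Contraction with the letter `s`, inverse to the component of the differential at `s`. -/
def contract (q : Kˣ) {n : ℕ} (s : Fin n) : Module.End K (Model K n) :=
  Finsupp.linearCombination K fun p => if s ∈ p.2 then
    (diffCoeff q (p.1 + Pi.single s 1) (p.2.erase s) s)⁻¹ •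
      mono K (p.1 + Pi.single s 1) (p.2.erase s) else 0

theorem contract_mono (q : Kˣ) {n : ℕ} (s : Fin n) (a : Fin n → ℕ) (J : Finset (Fin n)) :
    contract q s (mono K a J) = if s ∈ J then
      (diffCoeff q (a + Pi.single s 1) (J.erase s) s)⁻¹ •
        mono K (a + Pi.single s 1) (J.erase s) else 0 := by
  rw [contract, Finsupp.linearCombination_single, one_smul]

/-- The components of the differential at two letters anticommute. The quantum integers of both
products agree; the order of the two steps matters by a factor q, for the larger letter in the
symmetric part, and by -q⁻¹, for the smaller letter in the exterior part. -/
theorem diffCoeff_anticomm (q : Kˣ) {n : ℕ} (a : Fin n → ℕ) {J : Finset (Fin n)} {i s : Fin n}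
    (hi : i ∉ J) (hs : s ∉ J) (his : i ≠ s) :
    diffCoeff q (a + Pi.single i 1) (insert s J) i *
        diffCoeff q (a + Pi.single i 1 + Pi.single s 1) J s +
      diffCoeff q (a + Pi.single i 1 + Pi.single s 1) J i *
        diffCoeff q (a + Pi.single s 1) (insert i J) s = 0 := by
  have hq := q.ne_zero
  simp only [diffCoeff, ind_insert hi, ind_insert hs, highSum_add, lowSum_add, highSum_single,
    lowSum_single, Pi.add_apply, Pi.single_eq_same, Pi.single_eq_of_ne his,
    Pi.single_eq_of_ne his.symm, lt_irrefl, if_false, add_zero]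
  rcases lt_or_gt_of_ne his with h | h
  · simp only [h, h.not_gt, if_true, if_false, add_zero, pow_succ]
    field_simp
    ring
  · simp only [h, h.not_gt, if_true, if_false, add_zero, pow_succ]
    field_simp
    ring

theorem diffCoeff_ne_zero (q : Kˣ) {n : ℕ} {a : Fin n → ℕ} {J : Finset (Fin n)} {s : Fin n}
    (h : qint (q : K) (a s) ≠ 0) : diffCoeff q a J s ≠ 0 :=
  mul_ne_zero (mul_ne_zero h (pow_ne_zero _ q.ne_zero))
    (pow_ne_zero _ (neg_ne_zero.2 (inv_ne_zero q.ne_zero)))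

/-- The component at `s` contributes the identity, through one of the two compositions according to
whether `s ∈ J`. When `s ∈ J`, the components at other letters cancel between them by
`diffCoeff_anticomm`; otherwise the contraction kills them. -/
theorem contract_homotopy (q : Kˣ) {n : ℕ} {s : Fin n} {a : Fin n → ℕ} {J : Finset (Fin n)}
    (h : qint (q : K) ((a + ind J) s) ≠ 0) :
    diffOp q n (contract q s (mono K a J)) + contract q s (diffOp q n (mono K a J)) =
      mono K a J := by
  by_cases hs : s ∈ J
  · obtain ⟨J, hJ, rfl⟩ : ∃ J', s ∉ J' ∧ insert s J' = J :=
      ⟨J.erase s, Finset.notMem_erase s J, Finset.insert_erase hs⟩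
    have h' : qint (q : K) (a s + 1) ≠ 0 := by
      simpa [ind] using h
    have hne : ∀ (b : Fin n → ℕ) (J' : Finset (Fin n)), b s = a s + 1 → diffCoeff q b J' s ≠ 0 :=
      fun b J' hb => diffCoeff_ne_zero q (by rw [hb]; exact h')
    rw [contract_mono, if_pos hs, Finset.erase_insert hJ, map_smul, diffOp_mono, diffOp_mono,
      map_sum, Finset.smul_sum, ← Finset.sum_add_distrib]
    rw [Finset.sum_eq_single s]
    · rw [if_neg hJ, if_pos hs, map_zero, add_zero, smul_smul, inv_mul_cancel₀ (hne _ _ (by simp)),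
        one_smul]
      congr 2
      funext j; simp
    · intro i _ his
      by_cases hi : i ∈ J
      · rw [if_pos hi, if_pos (Finset.mem_insert_of_mem hi), smul_zero, map_zero, add_zero]
      have hi2 : i ∉ insert s J := by simp [his, hi]
      rw [if_neg hi, if_neg hi2, map_smul, contract_mono, if_pos (by simp)]
      -- If `a i = 0` the subtraction truncates, but both coefficients contain [0] = 0.
      rcases Nat.eq_zero_or_pos (a i) with h0 | h0
      · have : ∀ (b : Fin n → ℕ) (J' : Finset (Fin n)), b i = 0 → diffCoeff q b J' i = 0 :=
          fun b J' hb => by rw [diffCoeff, hb, qint_zero, zero_mul, zero_mul]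
        rw [this _ _ h0, this _ _ (by simp [h0, his])]
        simp
      obtain ⟨a, rfl⟩ : ∃ a', a = a' + Pi.single i 1 := ⟨a - Pi.single i 1, by
        funext j
        by_cases hj : j = i
        · subst hj; simp; omega
        · simp [hj]⟩
      have e1 : a + Pi.single i 1 + Pi.single s 1 - Pi.single i 1 = a + Pi.single s 1 := by
        funext j; simp only [Pi.add_apply, Pi.sub_apply]; omega
      have e2 : a + Pi.single i 1 - Pi.single i 1 = a := by funext j; simp
      have e3 : (insert i (insert s J)).erase s = insert i J := by
        rw [Finset.insert_comm, Finset.erase_insert]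
        simp [his.symm, hJ]
      rw [e1, e2, e3, smul_smul, smul_smul, ← add_smul]
      refine smul_eq_zero.2 (Or.inl ?_)
      have n1 := hne (a + Pi.single i 1 + Pi.single s 1) J (by simp)
      have n2 := hne (a + Pi.single s 1) (insert i J) (by simp [his.symm])
      have e := diffCoeff_anticomm q a hi hJ his
      field_simp
      linear_combination e
    · simp
  · have h' : qint (q : K) (a s) ≠ 0 := by
      simpa [ind, hs] using h
    rw [contract_mono, if_neg hs, map_zero, zero_add, diffOp_mono, map_sum, Finset.sum_eq_single s]
    · have : 0 < a s := Nat.pos_of_ne_zero fun h0 => h' (by rw [h0, qint_zero])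
      have e : a - Pi.single s 1 + Pi.single s 1 = a := by
        funext j
        by_cases hj : j = s
        · subst hj; simp; omega
        · simp [hj]
      rw [if_neg hs, map_smul, contract_mono, if_pos (Finset.mem_insert_self s J),
        Finset.erase_insert hs, e, smul_smul, mul_inv_cancel₀ (diffCoeff_ne_zero q h'), one_smul]
    · intro i _ his
      split_ifs with hi
      · exact map_zero _
      · rw [map_smul, contract_mono, if_neg (by simp [his.symm, hs]), smul_zero]
    · simp

/-- A weight that is not divisible by `l`. -/
def Bad {n : ℕ} (l : ℕ) (a : Fin n → ℕ) : Prop := ∃ s, ¬ l ∣ a s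

open Classical in
/-- The projection onto the span of the monomials whose weight is divisible by `l`. -/
def divProj (K : Type*) [Field K] (n l : ℕ) : Module.End K (Model K n) :=
  Finsupp.linearCombination K fun p => if Bad l (p.1 + ind p.2) then 0 else mono K p.1 p.2

open Classical in
theorem divProj_mono {n l : ℕ} (a : Fin n → ℕ) (J : Finset (Fin n)) :
    divProj K n l (mono K a J) = if Bad l (a + ind J) then 0 else mono K a J := by
  rw [divProj, Finsupp.linearCombination_single, one_smul]

open Classical in
/-- The homotopy that contracts the part of weights not divisible by `l`. -/
def homotopy (q : Kˣ) (n l : ℕ) : Module.End K (Model K n) :=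
  Finsupp.linearCombination K fun p => if h : Bad l (p.1 + ind p.2) then
    contract q h.choose (mono K p.1 p.2) else 0

open Classical in
theorem homotopy_mono (q : Kˣ) {n l : ℕ} (a : Fin n → ℕ) (J : Finset (Fin n)) :
    homotopy q n l (mono K a J) = if h : Bad l (a + ind J) then
      contract q h.choose (mono K a J) else 0 := by
  rw [homotopy, Finsupp.linearCombination_single, one_smul]

/-- The letter used for contraction is chosen from the weight alone, so it is the same for a
monomial and for all terms of its differential. -/
theorem homotopy_of_weight (q : Kˣ) {n l : ℕ} {a b : Fin n → ℕ} {J : Finset (Fin n)}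
    (e : a + ind J = b) (h : Bad l b) :
    homotopy q n l (mono K a J) = contract q h.choose (mono K a J) := by
  subst e
  rw [homotopy_mono, dif_pos h]

theorem diffOp_term_weight {n : ℕ} {a : Fin n → ℕ} {J : Finset (Fin n)} {i : Fin n}
    (hi : i ∉ J) (ha : 0 < a i) : a - Pi.single i 1 + ind (insert i J) = a + ind J := by
  rw [ind_insert hi]
  funext j
  by_cases hj : j = i
  · subst hj; simp; omega
  · simp [hj]

/-- The differential preserves weights: a term whose weight would change because of the truncated
subtraction has coefficient zero. -/
theorem diffOp_congr (q : Kˣ) {n : ℕ} {N : Type*} [AddCommGroup N] [Module K N]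
    {f g : Model K n →ₗ[K] N} (a : Fin n → ℕ) (J : Finset (Fin n))
    (h : ∀ b J', b + ind J' = a + ind J → f (mono K b J') = g (mono K b J')) :
    f (diffOp q n (mono K a J)) = g (diffOp q n (mono K a J)) := by
  rw [diffOp_mono, map_sum, map_sum]
  refine Finset.sum_congr rfl fun i _ => ?_
  split_ifs with hi
  · rw [map_zero, map_zero]
  rw [map_smul, map_smul]
  rcases Nat.eq_zero_or_pos (a i) with h0 | h0
  · rw [diffCoeff, h0, qint_zero, zero_mul, zero_mul, zero_smul, zero_smul]
  · rw [h _ _ (diffOp_term_weight hi h0)]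

/-- For `i ∉ J` the weight at i is `a i` itself, so [a_i] = 0. -/
theorem diffOp_eq_zero {q : Kˣ} {l : ℕ} (hl : 1 < l) (hodd : Odd l) (hq : IsPrimitiveRoot q l)
    {n : ℕ} {a : Fin n → ℕ} {J : Finset (Fin n)} (h : ¬ Bad l (a + ind J)) :
    diffOp q n (mono K a J) = 0 := by
  rw [diffOp_mono]
  refine Finset.sum_eq_zero fun i _ => ?_
  split_ifs with hi
  · rfl
  have : l ∣ (a + ind J) i := by
    by_contra h'
    exact h ⟨i, h'⟩
  have h2 : l ∣ a i := by simpa [ind, hi] using this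
  rw [diffCoeff, (qint_eq_zero hl hodd hq).2 h2, zero_mul, zero_mul, zero_smul]

/-- Weight by weight: `contract_homotopy` where some entry is not divisible by `l`, and a zero
differential elsewhere. Thus the complex retracts onto the monomials of divisible weight. -/
theorem homotopy_formula {q : Kˣ} {l : ℕ} (hl : 1 < l) (hodd : Odd l) (hq : IsPrimitiveRoot q l)
    {n : ℕ} (m : Model K n) :
    diffOp q n (homotopy q n l m) + homotopy q n l (diffOp q n m) + divProj K n l m = m := by
  have : diffOp q n ∘ₗ homotopy q n l + homotopy q n l ∘ₗ diffOp q n + divProj K n l =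
      LinearMap.id := model_ext fun a J => by
    simp only [LinearMap.add_apply, LinearMap.comp_apply, LinearMap.id_apply, divProj_mono]
    by_cases h : Bad l (a + ind J)
    · rw [if_pos h, add_zero, homotopy_of_weight q rfl h,
        diffOp_congr q a J fun b J' e => homotopy_of_weight q e h]
      refine contract_homotopy q fun h0 => ?_
      rw [qint_eq_zero hl hodd hq] at h0
      exact h.choose_spec h0
    · rw [if_neg h, diffOp_eq_zero hl hodd hq h, homotopy_mono, dif_neg h]
      simp
  exact LinearMap.congr_fun this m

/-- Boundaries have no component of divisible weight; hence distinct combinations of such monomials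
have distinct classes. -/
theorem divProj_diffOp {q : Kˣ} {l : ℕ} (hl : 1 < l) (hodd : Odd l) (hq : IsPrimitiveRoot q l)
    {n : ℕ} (m : Model K n) : divProj K n l (diffOp q n m) = 0 := by
  have : divProj K n l ∘ₗ diffOp q n = 0 := model_ext fun a J => by
    rw [LinearMap.comp_apply]
    by_cases h : Bad l (a + ind J)
    · refine diffOp_congr (g := 0) q a J fun b J' e => ?_
      rw [divProj_mono, e, if_pos h, LinearMap.zero_apply]
    · rw [diffOp_eq_zero hl hodd hq h, map_zero, LinearMap.zero_apply]
  exact LinearMap.congr_fun this m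

end Homotopy
end QuantumDeRham

namespace QuantumDeRham

/-! ### The algebra map from the classical to the quantum de Rham algebra -/

noncomputable section Cartier

open DirectSum

variable {K : Type*} [Field K]

/-- The cycle `e_a ^ l ⊗ 1`. -/
def frobSym (q : Kˣ) (l : ℕ) {n : ℕ} (a : Fin n) : OmegaAlg q n := symGen q a ^ l

/-- The cycle `e_a ^ (l - 1) ⊗ e_a`. -/
def frobExt (q : Kˣ) (l : ℕ) {n : ℕ} (a : Fin n) : OmegaAlg q n :=
  symGen q a ^ (l - 1) * extGen q a

theorem unit_pow_eq_one {q : Kˣ} {l : ℕ} (hq : IsPrimitiveRoot q l) : (q : K) ^ l = 1 := by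
  rw [← Units.val_pow_eq_pow_val, hq.pow_eq_one, Units.val_one]

theorem commute_symGen_frobSym {q : Kˣ} {l : ℕ} (hq : IsPrimitiveRoot q l) {n : ℕ} (a b : Fin n) :
    Commute (symGen q a) (frobSym q l b) := by
  rcases lt_trichotomy a b with h | h | h
  · have := pow_mul_of_qcomm (symGen_comm q h) l
    rw [unit_pow_eq_one hq, one_smul] at this
    exact this.symm
  · subst h; exact Commute.self_pow _ _
  · have := mul_pow_of_qcomm (symGen_comm q h) l
    rw [unit_pow_eq_one hq, one_smul] at this
    exact this

/-- Each further x_b adds one correction term, and sorting it gives q^(m+1) twice: once from ξ_b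
past x_b, once from x_a past x_b. The powers q^(2(m+1)) add up to a quantum integer. -/
theorem extGen_mul_symGen_pow (q : Kˣ) {n : ℕ} {a b : Fin n} (h : b < a) (m : ℕ) :
    extGen q a * symGen q b ^ (m + 1) = symGen q b ^ (m + 1) * extGen q a +
      (((q : K) - (q : K)⁻¹) * qint (q : K) (m + 1)) •
        (symGen q b ^ m * (symGen q a * extGen q b)) := by
  have h1 := extGen_mul_symGen q a b
  rw [if_neg h.not_gt, if_neg h.ne'] at h1
  induction m with
  | zero =>
    rw [qint_succ, qint_zero]
    simp only [zero_add, pow_one, h1, pow_zero, one_mul, mul_one]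
    rw [add_comm]
  | succ m ih =>
    have h2 : extGen q b * symGen q b ^ (m + 1) =
        (q : K) ^ (m + 1) • (symGen q b ^ (m + 1) * extGen q b) := by
      refine mul_pow_of_qcomm ?_ _
      rw [extGen_mul_symGen, if_neg (lt_irrefl _), if_pos rfl]
    have h3 := mul_pow_of_qcomm (symGen_comm q h) (m + 1)
    rw [pow_succ', ← mul_assoc, h1, add_mul, smul_mul_assoc, mul_assoc (symGen q a), h2,
      mul_smul_comm, ← mul_assoc (symGen q a), h3, mul_assoc (symGen q b), ih, mul_add,
      mul_smul_comm, smul_mul_assoc, qint_succ _ (m + 1)]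
    simp only [← mul_assoc, ← pow_succ']
    match_scalars
    · ring
    · ring

/-- For `a < b` there is nothing to correct, for `a = b` the scalar is q^ℓ = 1, and for `a > b` the
correction has the factor [ℓ] = 0. -/
theorem commute_extGen_frobSym {q : Kˣ} {l : ℕ} (hl : 1 < l) (hodd : Odd l)
    (hq : IsPrimitiveRoot q l) {n : ℕ} (a b : Fin n) :
    Commute (extGen q a) (frobSym q l b) := by
  have h1 := extGen_mul_symGen q a b
  rcases lt_trichotomy a b with h | h | h
  · rw [if_pos h] at h1
    exact Commute.pow_right h1 l
  · subst h
    rw [if_neg (lt_irrefl _), if_pos rfl] at h1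
    have := mul_pow_of_qcomm h1 l
    rw [unit_pow_eq_one hq, one_smul] at this
    exact this
  · obtain ⟨m, rfl⟩ : ∃ m, l = m + 1 := ⟨l - 1, by omega⟩
    have := extGen_mul_symGen_pow q h m
    rw [(qint_eq_zero hl hodd hq).2 dvd_rfl, mul_zero, zero_smul, add_zero] at this
    exact this

theorem commute_frobSym {q : Kˣ} {l : ℕ} (hq : IsPrimitiveRoot q l) {n : ℕ} (a b : Fin n) :
    Commute (frobSym q l a) (frobSym q l b) :=
  (commute_symGen_frobSym hq a b).pow_left l

theorem commute_frobExt_frobSym {q : Kˣ} {l : ℕ} (hl : 1 < l) (hodd : Odd l)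
    (hq : IsPrimitiveRoot q l) {n : ℕ} (a b : Fin n) :
    Commute (frobExt q l a) (frobSym q l b) :=
  ((commute_symGen_frobSym hq a b).pow_left _).mul_left (commute_extGen_frobSym hl hodd hq a b)

/-- The correction terms end in ξ_b, so the final factor ξ_b kills them. -/
theorem extGen_mul_symGen_pow_mul (q : Kˣ) {n : ℕ} (a b : Fin n) (m : ℕ) :
    extGen q a * symGen q b ^ m * extGen q b = symGen q b ^ m * (extGen q a * extGen q b) := by
  have h1 := extGen_mul_symGen q a b
  rcases lt_trichotomy a b with h | h | h
  · rw [if_pos h] at h1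
    have : extGen q a * symGen q b ^ m = symGen q b ^ m * extGen q a := Commute.pow_right h1 m
    rw [this, mul_assoc]
  · subst h
    rw [if_neg (lt_irrefl _), if_pos rfl] at h1
    rw [mul_pow_of_qcomm h1, smul_mul_assoc, mul_assoc, extGen_sq, mul_zero, smul_zero]
  · cases m with
    | zero => simp
    | succ m =>
      rw [extGen_mul_symGen_pow q h, add_mul, smul_mul_assoc]
      simp only [mul_assoc]
      rw [extGen_sq]
      simp

theorem frobExt_mul_frobExt (q : Kˣ) (l : ℕ) {n : ℕ} (a b : Fin n) :
    frobExt q l a * frobExt q l b =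
      symGen q a ^ (l - 1) * symGen q b ^ (l - 1) * (extGen q a * extGen q b) := by
  rw [frobExt, frobExt, mul_assoc, ← mul_assoc (extGen q a), extGen_mul_symGen_pow_mul, ← mul_assoc]

theorem frobExt_sq (q : Kˣ) (l : ℕ) {n : ℕ} (a : Fin n) : frobExt q l a * frobExt q l a = 0 := by
  rw [frobExt_mul_frobExt, extGen_sq, mul_zero]

/-- Reordering the symmetric parts gives q^((ℓ-1)²) = q, since q^(ℓ-1) = q⁻¹; the exterior letters
give -q⁻¹. The product is -1. -/
theorem frobExt_comm_of_lt {q : Kˣ} {l : ℕ} (hl : 1 < l) (hq : IsPrimitiveRoot q l) {n : ℕ}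
    {a b : Fin n} (h : a < b) :
    frobExt q l b * frobExt q l a = -(frobExt q l a * frobExt q l b) := by
  obtain ⟨m, rfl⟩ : ∃ m, l = m + 1 := ⟨l - 1, by omega⟩
  have e1 : (q : K) ^ m = (q : K)⁻¹ := by
    have := unit_pow_eq_one hq
    rw [pow_succ] at this
    exact eq_inv_of_mul_eq_one_left this
  have e2 : ((q : K) ^ m) ^ m = q := by rw [e1, inv_pow, e1, inv_inv]
  rw [frobExt_mul_frobExt, frobExt_mul_frobExt, extGen_comm q h, Nat.add_sub_cancel,
    mul_pow_of_qcomm (pow_mul_of_qcomm (symGen_comm q h) m) m, e2, smul_mul_smul_comm,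
    mul_neg, mul_inv_cancel₀ q.ne_zero, neg_one_smul]

theorem frobExt_comm {q : Kˣ} {l : ℕ} (hl : 1 < l) (hq : IsPrimitiveRoot q l) {n : ℕ}
    (a b : Fin n) : frobExt q l b * frobExt q l a = -(frobExt q l a * frobExt q l b) := by
  rcases lt_trichotomy a b with h | h | h
  · exact frobExt_comm_of_lt hl hq h
  · subst h; rw [frobExt_sq, neg_zero]
  · rw [frobExt_comm_of_lt hl hq h, neg_neg]

/-- The product of the cycles that correspond to the letters of a word. -/
def frobWord (q : Kˣ) (l : ℕ) {n : ℕ} (d i : ℕ) (I : Fin d → Fin n) : OmegaAlg q n :=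
  (List.ofFn fun k : Fin d => if (k : ℕ) < d - i then frobSym q l (I k) else frobExt q l (I k)).prod

theorem frobWord_cons_sym (q : Kˣ) (l : ℕ) {n d i : ℕ} (hi : i ≤ d) (a : Fin n)
    (I : Fin d → Fin n) :
    frobWord q l (d + 1) i (Fin.cons a I : Fin (d + 1) → Fin n) =
      frobSym q l a * frobWord q l d i I := by
  have e : d + 1 - i = d - i + 1 := by omega
  rw [frobWord, List.ofFn_succ, List.prod_cons]
  simp only [e, Fin.val_zero, Nat.succ_pos, if_true, Fin.val_succ, Nat.add_lt_add_iff_right,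
    Fin.cons_zero, Fin.cons_succ]
  rfl

theorem frobWord_cons_ext (q : Kˣ) (l : ℕ) {n d : ℕ} (a : Fin n) (I : Fin d → Fin n) :
    frobWord q l (d + 1) (d + 1) (Fin.cons a I : Fin (d + 1) → Fin n) =
      frobExt q l a * frobWord q l d d I := by
  rw [frobWord, List.ofFn_succ, List.prod_cons, frobWord]
  simp only [Nat.sub_self, Nat.not_lt_zero, if_false, Fin.cons_zero, Fin.cons_succ]

/-- The third clause does not follow from the second in characteristic two. -/
theorem frobWord_swap {q : Kˣ} {l : ℕ} (hl : 1 < l) (hq : IsPrimitiveRoot q l) {n d i k : ℕ}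
    (h : k + 1 < d) (I : Fin d → Fin n) :
    (k + 1 < d - i → frobWord q l d i (swapAt h I) = frobWord q l d i I) ∧
    (d - i ≤ k → frobWord q l d i (swapAt h I) = -frobWord q l d i I) ∧
    (d - i ≤ k → I ⟨k, Nat.lt_of_succ_lt h⟩ = I ⟨k + 1, h⟩ → frobWord q l d i I = 0) := by
  obtain ⟨A, B, hAB⟩ := ofFn_prod_split h (fun k : Fin d =>
    if (k : ℕ) < d - i then frobSym q l (I k) else frobExt q l (I k))
  have e1 := hAB _ fun _ _ _ => rfl
  have e2 := hAB (fun k : Fin d => if (k : ℕ) < d - i then frobSym q l (swapAt h I k)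
    else frobExt q l (swapAt h I k)) fun p h1 h2 => by rw [swapAt_ne h I p h1 h2]
  rw [swapAt_left, swapAt_right] at e2
  refine ⟨fun hk => ?_, fun hk => ?_, fun hk hI => ?_⟩
  · rw [frobWord, frobWord, e1, e2, if_pos (show k < d - i by omega), if_pos hk,
      if_pos (show k < d - i by omega), if_pos hk, (commute_frobSym hq _ _).eq]
  · have h1 : ¬ k < d - i := by omega
    have h2 : ¬ k + 1 < d - i := by omega
    rw [frobWord, frobWord, e1, e2]
    simp only [h1, h2, if_false]
    rw [frobExt_comm hl hq, mul_neg, neg_mul]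
  · have h1 : ¬ k < d - i := by omega
    have h2 : ¬ k + 1 < d - i := by omega
    rw [frobWord, e1]
    simp only [h1, h2, if_false]
    rw [hI, frobExt_sq, mul_zero, zero_mul]

theorem heckeT_one_apply {n d k : ℕ} (h : k + 1 < d) (x : TensorPow K n d) (J : Fin d → Fin n) :
    heckeT (1 : K) n d k x J = x (swapAt h J) := by
  rw [← pair_tens, ← pair_heckeT, heckeT_one h, pair_tens]

/-- The argument of `relSub_le_ker` would divide by 1 + 1 here. Instead, an exterior relation at
parameter 1 is a tensor invariant under the swap, and its terms cancel in pairs. -/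
theorem frobWord_relSub {q : Kˣ} {l : ℕ} (hl : 1 < l) (hq : IsPrimitiveRoot q l) {n d i : ℕ}
    (hi : i ≤ d) : relSub (1 : Kˣ) n d i ≤
      LinearMap.ker (Finsupp.linearCombination K (frobWord q l (n := n) d i)) := by
  refine relSub_le 1 hi _ (fun k x hk => ?_) fun k x hk h hx => ?_
  · have h : k + 1 < d := by omega
    rw [LinearMap.mem_ker, map_sub, sub_eq_zero, Units.val_one, one_smul]
    have := end_ext (f := Finsupp.linearCombination K (frobWord q l (n := n) d i) ∘ₗ
      heckeT (1 : K) n d k) (g := Finsupp.linearCombination K (frobWord q l d i)) fun I => by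
        rw [LinearMap.comp_apply, heckeT_one h, Finsupp.linearCombination_single,
          Finsupp.linearCombination_single, (frobWord_swap hl hq h I).1 hk]
    exact LinearMap.congr_fun this x
  · rw [Units.val_one, one_smul] at hx
    rw [LinearMap.mem_ker, Finsupp.linearCombination_apply,
      Finsupp.sum_fintype x (fun I a => a • frobWord q l d i I) fun _ => zero_smul _ _]
    -- Words fixed by the swap have two equal exterior letters and contribute zero by themselves,
    -- which covers characteristic two.
    refine Finset.sum_involution (fun I _ => swapAt h I) (fun I _ => ?_) (fun I _ hI e => hI ?_)
      (fun I _ => Finset.mem_univ _) (fun I _ => swapAt_swapAt h I)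
    · have : x (swapAt h I) = x I := by rw [← heckeT_one_apply h, hx]
      rw [this, (frobWord_swap hl hq h I).2.1 hk, smul_neg, add_neg_cancel]
    · have e' := congrFun e ⟨k + 1, h⟩
      rw [swapAt_right] at e'
      rw [(frobWord_swap hl hq h I).2.2 hk e', smul_zero]

/-- The linear map underlying the inverse Cartier operator, with values in cycles. -/
def cartierLin {q : Kˣ} {l : ℕ} (hl : 1 < l) (hq : IsPrimitiveRoot q l) (n : ℕ) :
    OmegaAlg (1 : Kˣ) n →ₗ[K] OmegaAlg q n :=
  toModule K (ℕ × ℕ) (OmegaAlg q n) fun p => if h : p.2 ≤ p.1 then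
    (relSub (1 : Kˣ) n p.1 p.2).liftQ _ (frobWord_relSub hl hq h) else 0

theorem cartierLin_tens {q : Kˣ} {l : ℕ} (hl : 1 < l) (hq : IsPrimitiveRoot q l) {n d i : ℕ}
    (hi : i ≤ d) (I : Fin d → Fin n) :
    cartierLin hl hq n (ofTens 1 n d i (tens K I)) = frobWord q l d i I := by
  have : cartierLin hl hq n (ofTens 1 n d i (tens K I)) = (if h : i ≤ d then
    (relSub (1 : Kˣ) n d i).liftQ _ (frobWord_relSub hl hq h) else 0)
      (Omega.mk 1 n d i (tens K I)) := toModule_lof K (d, i) _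
  rw [this, dif_pos hi]
  exact ((relSub (1 : Kˣ) n d i).liftQ_apply _ _).trans (by simp)

theorem cartierLin_symGen_mul {q : Kˣ} {l : ℕ} (hl : 1 < l) (hq : IsPrimitiveRoot q l) {n : ℕ}
    (a : Fin n) (u : OmegaAlg (1 : Kˣ) n) :
    cartierLin hl hq n (symGen 1 a * u) = frobSym q l a * cartierLin hl hq n u := by
  have := tens_mem_span 1 (LinearMap.eqLocus (cartierLin hl hq n ∘ₗ
    LinearMap.mulLeft K (symGen 1 a)) (LinearMap.mulLeft K (frobSym q l a) ∘ₗ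
      cartierLin hl hq n)) fun d i hi I => by
      simp only [LinearMap.mem_eqLocus, LinearMap.comp_apply, LinearMap.mulLeft_apply]
      rw [symGen_mul_ofTens 1 hi, cartierLin_tens hl hq hi, cartierLin_tens hl hq (by omega),
        frobWord_cons_sym q l hi]
  exact this.ge trivial

theorem commute_gens_one {n : ℕ} (a b : Fin n) :
    Commute (extGen (1 : Kˣ) a) (symGen (1 : Kˣ) b) := by
  have h := extGen_mul_symGen (1 : Kˣ) a b
  simp only [Units.val_one, inv_one, sub_self, one_smul, zero_smul, zero_add] at h
  split_ifs at h with h1 h2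
  · exact h
  · subst h2; exact h
  · exact h

/-- On both sides the exterior element can be moved past the symmetric letters: classically because
the generators commute, in the target by `commute_frobExt_frobSym`. This reduces the claim to purely
exterior words. -/
theorem cartierLin_extGen_mul {q : Kˣ} {l : ℕ} (hl : 1 < l) (hodd : Odd l)
    (hq : IsPrimitiveRoot q l) {n : ℕ} (a : Fin n) (u : OmegaAlg (1 : Kˣ) n) :
    cartierLin hl hq n (extGen 1 a * u) = frobExt q l a * cartierLin hl hq n u := by
  have := tens_mem_span 1 (LinearMap.eqLocus (cartierLin hl hq n ∘ₗ
    LinearMap.mulLeft K (extGen 1 a)) (LinearMap.mulLeft K (frobExt q l a) ∘ₗ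
      cartierLin hl hq n)) fun d i hi I => by
      simp only [LinearMap.mem_eqLocus, LinearMap.comp_apply, LinearMap.mulLeft_apply]
      have ext : ∀ d (I : Fin d → Fin n), cartierLin hl hq n (extGen 1 a *
          ofTens 1 n d d (tens K I)) = frobExt q l a *
            cartierLin hl hq n (ofTens 1 n d d (tens K I)) := fun d I => by
        rw [extGen_mul_ofTens, cartierLin_tens hl hq le_rfl, cartierLin_tens hl hq le_rfl,
          frobWord_cons_ext]
      refine word_induction (p := fun d i I => cartierLin hl hq n (extGen 1 a *
          ofTens 1 n d i (tens K I)) = frobExt q l a *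
            cartierLin hl hq n (ofTens 1 n d i (tens K I))) (ext 0 _) ?_
        (fun d b I _ => ext (d + 1) _) hi I
      intro d i b I hi ih
      rw [← symGen_mul_ofTens 1 hi, ← mul_assoc, (commute_gens_one a b).eq, mul_assoc,
        cartierLin_symGen_mul, ih, cartierLin_symGen_mul, ← mul_assoc, ← mul_assoc,
        (commute_frobExt_frobSym hl hodd hq a b).eq]
  exact this.ge trivial

/-- The algebra map `e_a ⊗ 1 ↦ e_a ^ l ⊗ 1`, `1 ⊗ e_a ↦ e_a ^ (l - 1) ⊗ e_a` from the classical to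
the quantum de Rham algebra. -/
def cartier {q : Kˣ} {l : ℕ} (hl : 1 < l) (hodd : Odd l) (hq : IsPrimitiveRoot q l) (n : ℕ) :
    OmegaAlg (1 : Kˣ) n →ₐ[K] OmegaAlg q n :=
  AlgHom.ofLinearMap (cartierLin hl hq n)
    (by rw [← ofTens_zero 1 n Fin.elim0, cartierLin_tens hl hq le_rfl]; simp [frobWord])
    (fun u v => by
      have := tens_mem_span 1 (LinearMap.eqLocus (cartierLin hl hq n ∘ₗ LinearMap.mulRight K v)
        (LinearMap.mulRight K (cartierLin hl hq n v) ∘ₗ cartierLin hl hq n)) fun d i hi I => by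
          simp only [LinearMap.mem_eqLocus, LinearMap.comp_apply, LinearMap.mulRight_apply]
          refine word_induction (p := fun d i I => cartierLin hl hq n
            (ofTens 1 n d i (tens K I) * v) = cartierLin hl hq n (ofTens 1 n d i (tens K I)) *
              cartierLin hl hq n v) ?_ ?_ ?_ hi I
          · rw [cartierLin_tens hl hq le_rfl, ofTens_zero]; simp [frobWord]
          · intro d i a I hi ih
            rw [← symGen_mul_ofTens 1 hi, mul_assoc, cartierLin_symGen_mul, ih,
              cartierLin_symGen_mul, mul_assoc]
          · intro d a I ih
            rw [← extGen_mul_ofTens, mul_assoc, cartierLin_extGen_mul hl hodd, ih,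
              cartierLin_extGen_mul hl hodd, mul_assoc]
      exact this.ge trivial)

theorem cartier_tens {q : Kˣ} {l : ℕ} (hl : 1 < l) (hodd : Odd l) (hq : IsPrimitiveRoot q l)
    {n d i : ℕ} (hi : i ≤ d) (I : Fin d → Fin n) :
    cartier hl hodd hq n (ofTens 1 n d i (tens K I)) = frobWord q l d i I :=
  cartierLin_tens hl hq hi I

theorem cartier_symGen {q : Kˣ} {l : ℕ} (hl : 1 < l) (hodd : Odd l) (hq : IsPrimitiveRoot q l)
    {n : ℕ} (a : Fin n) : cartier hl hodd hq n (symGen 1 a) = frobSym q l a := by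
  rw [symGen, cartier_tens hl hodd hq (by omega)]; simp [frobWord]

theorem cartier_extGen {q : Kˣ} {l : ℕ} (hl : 1 < l) (hodd : Odd l) (hq : IsPrimitiveRoot q l)
    {n : ℕ} (a : Fin n) : cartier hl hodd hq n (extGen 1 a) = frobExt q l a := by
  rw [extGen, cartier_tens hl hodd hq le_rfl]; simp [frobWord]

theorem pow_mul_ordMon_of_low (q : Kˣ) {n : ℕ} {s : Fin n} {a : Fin n → ℕ}
    (ha : ∀ j < s, a j = 0) (m : ℕ) :
    symGen q s ^ m * ordMon (symGen q) a = ordMon (symGen q) (a + m • Pi.single s 1) := by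
  induction m with
  | zero => simp
  | succ m ih =>
    rw [pow_succ', mul_assoc, ih, gen_mul_ordMon_of_low (fun i j h => symGen_comm q h) (fun j hj => by
      simp [ha j hj, hj.ne]), succ_nsmul, add_assoc]

/-- The scalar is a power of `q`; its value is never needed, only that it does not vanish. -/
theorem ordMon_mul_ordMon (q : Kˣ) {n : ℕ} (a b : Fin n → ℕ) : ∃ r : K, r ≠ 0 ∧
    ordMon (symGen q) a * ordMon (symGen q) b = r • ordMon (symGen q) (a + b) := by
  induction a using exponent_induction with
  | h0 => exact ⟨1, one_ne_zero, by rw [ordMon_zero, one_mul, one_smul, zero_add]⟩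
  | h a s ha ih =>
    obtain ⟨r, hr, e⟩ := ih
    refine ⟨r * (q : K) ^ lowSum (a + b) s, mul_ne_zero hr (pow_ne_zero _ q.ne_zero), ?_⟩
    rw [← gen_mul_ordMon_of_low (fun i j h => symGen_comm q h) ha, mul_assoc, e, mul_smul_comm,
      gen_mul_ordMon (fun i j h => symGen_comm q h), smul_smul, add_right_comm]

/-- Inserting the letters of `J` in decreasing order, each new ξ_s only meets larger symmetric
letters, with which it commutes. So no scalar appears. -/
theorem ordMon_frobExt {q : Kˣ} {l : ℕ} (hl : 1 < l) (hq : IsPrimitiveRoot q l) {n : ℕ}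
    (J : Finset (Fin n)) : ordMon (frobExt q l) (ind J) =
      ordMon (symGen q) ((l - 1) • ind J) * ordMon (extGen q) (ind J) := by
  induction J using Finset.induction_on_min with
  | empty => rw [ind_empty, smul_zero, ordMon_zero, ordMon_zero, ordMon_zero, one_mul]
  | insert s J hs ih =>
    have hJ : s ∉ J := fun h => lt_irrefl _ (hs s h)
    have low : ∀ j < s, ind J j = 0 := fun j hj => if_neg fun h => (hs j h).not_gt hj
    have h0 : ind J s = 0 := if_neg hJ
    rw [ind_insert hJ, ← gen_mul_ordMon_of_low (r := (-1 : K))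
      (fun i j _ => by rw [frobExt_comm hl hq, neg_one_smul]) low, ih,
      ← gen_mul_ordMon_of_low (fun i j h => extGen_comm q h) low, frobExt, mul_assoc,
      ← mul_assoc (extGen q s), extGen_mul_symMon q (fun j hj => by simp [low j hj]), smul_add,
      ← pow_mul_ordMon_of_low q (fun j hj => by simp [low j hj])]
    simp only [Pi.smul_apply, h0, smul_zero, pow_zero, one_smul, mul_assoc]

/-- Up to scalars the algebra map is an injection on monomials, and the image exponents are exactly
those of divisible weight (`divisible_weight`, `not_bad`). -/
theorem cartier_monomial {q : Kˣ} {l : ℕ} (hl : 1 < l) (hodd : Odd l) (hq : IsPrimitiveRoot q l)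
    {n : ℕ} (a : Fin n → ℕ) (J : Finset (Fin n)) : ∃ r : K, r ≠ 0 ∧
      cartier hl hodd hq n (monomial 1 a J) = r • monomial q (l • a + (l - 1) • ind J) J := by
  obtain ⟨r, hr, e⟩ := ordMon_mul_ordMon q (l • a) ((l - 1) • ind J)
  refine ⟨r, hr, ?_⟩
  have h1 := map_ordMon (cartier hl hodd hq n : _ →* OmegaAlg q n) (symGen (1 : Kˣ)) a
  have h2 := map_ordMon (cartier hl hodd hq n : _ →* OmegaAlg q n) (extGen (1 : Kˣ)) (ind J)
  simp only [MonoidHom.coe_coe, cartier_symGen, cartier_extGen] at h1 h2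
  have h3 : ordMon (fun i => frobSym q l i) a = ordMon (symGen q) (l • a) := by
    rw [ordMon, ordMon]
    simp only [frobSym, ← pow_mul, Pi.smul_apply, smul_eq_mul]
  rw [monomial, map_mul, h1, h2, ordMon_frobExt hl hq, h3, ← mul_assoc, e, smul_mul_assoc, monomial]

end Cartier
end QuantumDeRham

namespace QuantumDeRham

/-! ### The isomorphism of algebras -/

noncomputable section Iso

open DirectSum

variable {K : Type*} [Field K]

/-- The weight is l(b + 1_J), which determines `b`. -/
theorem divisible_weight {n l : ℕ} (hl : 0 < l) {a : Fin n → ℕ} {J : Finset (Fin n)}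
    (h : ¬ Bad l (a + ind J)) : ∃ b : Fin n → ℕ, l • b + (l - 1) • ind J = a := by
  refine ⟨fun i => (a i + ind J i) / l - ind J i, funext fun i => ?_⟩
  obtain ⟨m, hm⟩ : l ∣ (a + ind J) i := by
    by_contra h'
    exact h ⟨i, h'⟩
  rw [Pi.add_apply] at hm
  simp only [Pi.add_apply, Pi.smul_apply, smul_eq_mul]
  rw [hm, Nat.mul_div_cancel_left m hl]
  by_cases hi : i ∈ J
  · simp only [ind, hi, if_true] at hm ⊢
    -- For `i ∈ J` the weight at i is at least one, so the quotient is positive and subtracting `ind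
    -- J i` does not truncate.
    obtain ⟨m, rfl⟩ : ∃ m', m = m' + 1 := ⟨m - 1, by
      rcases Nat.eq_zero_or_pos m with h0 | h0
      · subst h0; omega
      · omega⟩
    rw [Nat.add_sub_cancel]
    rw [Nat.mul_succ] at hm
    omega
  · simp only [ind, hi, if_false] at hm ⊢
    simp; omega

theorem not_bad {n l : ℕ} (hl : 0 < l) (b : Fin n → ℕ) (J : Finset (Fin n)) :
    ¬ Bad l (l • b + (l - 1) • ind J + ind J) := by
  rintro ⟨i, hi⟩
  refine hi ⟨b i + ind J i, ?_⟩
  obtain ⟨m, rfl⟩ : ∃ m, l = m + 1 := ⟨l - 1, by omega⟩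
  simp only [Pi.add_apply, Pi.smul_apply, smul_eq_mul, Nat.add_sub_cancel]
  ring

theorem divProj_mem_range {q : Kˣ} {l : ℕ} (hl : 1 < l) (hodd : Odd l) (hq : IsPrimitiveRoot q l)
    {n : ℕ} (m : Model K n) :
    ofModel q n (divProj K n l m) ∈ LinearMap.range (cartier hl hodd hq n).toLinearMap := by
  induction m using Finsupp.induction_linear with
  | zero => rw [map_zero, map_zero]; exact zero_mem _
  | add m m' h h' => rw [map_add, map_add]; exact add_mem h h'
  | single p c =>
    obtain ⟨a, J⟩ := p
    rw [← Finsupp.smul_single_one, map_smul, map_smul]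
    refine Submodule.smul_mem _ _ ?_
    rw [divProj_mono]
    split_ifs with h
    · rw [map_zero]; exact zero_mem _
    · obtain ⟨b, hb⟩ := divisible_weight (by omega) h
      obtain ⟨r, hr, e⟩ := cartier_monomial hl hodd hq b J
      refine ⟨r⁻¹ • monomial 1 b J, ?_⟩
      rw [map_smul, AlgHom.toLinearMap_apply, e, smul_smul, inv_mul_cancel₀ hr, one_smul, hb,
        ofModel_mono]

/-- Every cycle is the sum of a boundary and of an element of the image of the algebra map
`cartier`. -/
theorem exists_cartier_add_diff {q : Kˣ} {l : ℕ} (hl : 1 < l) (hodd : Odd l)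
    (hq : IsPrimitiveRoot q l) {n : ℕ} {u : OmegaAlg q n} (hu : diff q n u = 0) :
    ∃ w v, u = cartier hl hodd hq n w + diff q n v := by
  have h2 := sq_ne_neg_one hl hodd hq
  obtain ⟨m, rfl⟩ := ofModel_surjective q n u
  have hm : diffOp q n m = 0 := by
    rw [← normalForm_ofModel q h2 (diffOp q n m), ← diff_ofModel, hu, map_zero]
  obtain ⟨w, hw⟩ := divProj_mem_range hl hodd hq m
  refine ⟨w, ofModel q n (homotopy q n l m), ?_⟩
  -- For a cycle the formula has two terms left: a boundary, and the part of divisible weight, which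
  -- lies in the image of `cartier`.
  have e := homotopy_formula hl hodd hq m
  rw [hm, map_zero, add_zero] at e
  rw [AlgHom.toLinearMap_apply] at hw
  rw [hw, diff_ofModel, ← map_add, add_comm, e]

/-- No nonzero element of the image of `cartier` is a boundary. -/
theorem eq_zero_of_cartier_eq_diff {q : Kˣ} {l : ℕ} (hl : 1 < l) (hodd : Odd l)
    (hq : IsPrimitiveRoot q l) {n : ℕ} {w : OmegaAlg (1 : Kˣ) n} {v : OmegaAlg q n}
    (h : cartier hl hodd hq n w = diff q n v) : w = 0 := by
  have h2 := sq_ne_neg_one hl hodd hq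
  -- At parameter 1 only the spanning of monomials is used. The hypothesis of `normalForm` would be
  -- 1² ≠ -1, which fails in characteristic two.
  obtain ⟨m, rfl⟩ := ofModel_surjective 1 n w
  choose r hr e using fun p : (Fin n → ℕ) × Finset (Fin n) => cartier_monomial hl hodd hq p.1 p.2
  let φ : (Fin n → ℕ) × Finset (Fin n) → (Fin n → ℕ) × Finset (Fin n) := fun p =>
    (l • p.1 + (l - 1) • ind p.2, p.2)
  have hφ : Function.Injective φ := by
    rintro ⟨a, J⟩ ⟨b, J'⟩ h
    simp only [φ, Prod.mk.injEq] at h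
    obtain ⟨h1, rfl⟩ := h
    rw [add_left_inj] at h1
    congr 1
    funext i
    have := congrFun h1 i
    simp only [Pi.smul_apply, smul_eq_mul] at this
    exact Nat.eq_of_mul_eq_mul_left (by omega) this
  -- The map `cartier` in monomial coordinates: up to the nonzero scalars `r` it relabels basis
  -- vectors by the injection `φ`, so `E m` determines `m`.
  let E : Model K n →ₗ[K] Model K n :=
    normalForm q h2 n ∘ₗ (cartier hl hodd hq n).toLinearMap ∘ₗ ofModel 1 n
  have hE : ∀ a J, E (mono K a J) = r (a, J) • Finsupp.single (φ (a, J)) 1 := fun a J => by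
    simp only [E, LinearMap.comp_apply, AlgHom.toLinearMap_apply, ofModel_mono]
    rw [e (a, J), map_smul, ← ofModel_mono, normalForm_ofModel]
  have hproj : divProj K n l ∘ₗ E = E := model_ext fun a J => by
    rw [LinearMap.comp_apply, hE, map_smul]
    congr 1
    exact (divProj_mono _ _).trans (if_neg (not_bad (by omega) a J))
  have hcoord : ∀ p, Finsupp.lapply (φ p) ∘ₗ E = r p • Finsupp.lapply p := fun p =>
    model_ext fun a J => by
      rw [LinearMap.comp_apply, hE, LinearMap.smul_apply]
      simp only [map_smul, Finsupp.lapply_apply, Finsupp.single_apply, hφ.eq_iff]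
      split_ifs with h
      · rw [h]
      · simp
  -- Its values have divisible weight, so the projection fixes them; as a boundary, `E m` is killed
  -- by the projection.
  have hEm : E m = 0 := by
    rw [← hproj, LinearMap.comp_apply]
    have : E m = diffOp q n (normalForm q h2 n v) := by
      simp only [E, LinearMap.comp_apply, AlgHom.toLinearMap_apply]
      rw [h, ← normalForm_ofModel q h2 (diffOp q n (normalForm q h2 n v)), ← diff_ofModel,
        ofModel_normalForm]
    rw [this, divProj_diffOp hl hodd hq]
  have : m = 0 := Finsupp.ext fun p => by
    have := LinearMap.congr_fun (hcoord p) m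
    rw [LinearMap.comp_apply, hEm, map_zero, LinearMap.smul_apply, smul_eq_mul, eq_comm,
      mul_eq_zero] at this
    exact this.resolve_left (hr p)
  rw [this, map_zero]

/-- It is a monomial of divisible weight, on which the differential vanishes. -/
theorem diff_frobSym {q : Kˣ} {l : ℕ} (hl : 1 < l) (hodd : Odd l) (hq : IsPrimitiveRoot q l)
    {n : ℕ} (a : Fin n) : diff q n (frobSym q l a) = 0 := by
  have e : frobSym q l a = monomial q (l • Pi.single a 1) ∅ := by
    have := pow_mul_ordMon_of_low q (s := a) (a := 0) (fun _ _ => rfl) l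
    rw [ordMon_zero, mul_one, zero_add] at this
    rw [monomial, ind_empty, ordMon_zero, mul_one, ← this, frobSym]
  rw [e, diff_monomial, diffOp_eq_zero hl hodd hq, map_zero]
  have := not_bad (n := n) (l := l) (by omega) (Pi.single a 1) ∅
  simpa [ind_empty] using this

theorem diff_frobExt {q : Kˣ} {l : ℕ} (hl : 1 < l) (hodd : Odd l) (hq : IsPrimitiveRoot q l)
    {n : ℕ} (a : Fin n) : diff q n (frobExt q l a) = 0 := by
  have e : frobExt q l a = monomial q (l • 0 + (l - 1) • ind {a}) {a} := by
    have h := ordMon_frobExt hl hq (n := n) {a}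
    have h1 : ind ({a} : Finset (Fin n)) = 0 + Pi.single a 1 := by
      rw [← insert_empty_eq, ind_insert (Finset.notMem_empty a), ind_empty]
    have h2 := gen_mul_ordMon_of_low (r := (-1 : K)) (z := frobExt q l) (s := a) (a := 0)
      (fun i j _ => by rw [frobExt_comm hl hq, neg_one_smul]) (fun _ _ => rfl)
    rw [monomial, smul_zero, zero_add, ← h, h1, ← h2, ordMon_zero, mul_one]
  rw [e, diff_monomial, diffOp_eq_zero hl hodd hq (not_bad (by omega) _ _), map_zero]

/-- The subalgebra of cycles. -/
def cycleAlg (q : Kˣ) (n : ℕ) : Subalgebra K (OmegaAlg q n) where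
  carrier := {u | diff q n u = 0}
  zero_mem' := map_zero _
  add_mem' {u v} hu hv := by
    change diff q n u = 0 at hu
    change diff q n v = 0 at hv
    change diff q n (u + v) = 0
    rw [map_add, hu, hv, add_zero]
  mul_mem' {u v} hu hv := by
    change diff q n u = 0 at hu
    change diff q n v = 0 at hv
    change diff q n (u * v) = 0
    rw [diff_mul, hu, hv, zero_mul, mul_zero, add_zero]
  algebraMap_mem' r := by
    change diff q n (algebraMap K _ r) = 0
    rw [Algebra.algebraMap_eq_smul_one, map_smul, diff_one, smul_zero]

theorem mem_cycleAlg (q : Kˣ) {n : ℕ} {u : OmegaAlg q n} :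
    u ∈ cycleAlg q n ↔ diff q n u = 0 := Iff.rfl

theorem frobSym_mem {q : Kˣ} {l : ℕ} (hl : 1 < l) (hodd : Odd l) (hq : IsPrimitiveRoot q l)
    {n : ℕ} (a : Fin n) : frobSym q l a ∈ cycleAlg q n := diff_frobSym hl hodd hq a

theorem frobExt_mem {q : Kˣ} {l : ℕ} (hl : 1 < l) (hodd : Odd l) (hq : IsPrimitiveRoot q l)
    {n : ℕ} (a : Fin n) : frobExt q l a ∈ cycleAlg q n := diff_frobExt hl hodd hq a

theorem cartier_mem {q : Kˣ} {l : ℕ} (hl : 1 < l) (hodd : Odd l) (hq : IsPrimitiveRoot q l)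
    {n : ℕ} (w : OmegaAlg (1 : Kˣ) n) : cartier hl hodd hq n w ∈ cycleAlg q n := by
  have := tens_mem_span 1 ((Subalgebra.toSubmodule (cycleAlg q n)).comap
    (cartier hl hodd hq n).toLinearMap) fun d i hi I => by
      rw [Submodule.mem_comap, AlgHom.toLinearMap_apply, cartier_tens hl hodd hq hi, frobWord]
      refine (cycleAlg q n).list_prod_mem fun x hx => ?_
      obtain ⟨k, rfl⟩ := (List.mem_ofFn).1 hx
      split_ifs
      · exact frobSym_mem hl hodd hq _
      · exact frobExt_mem hl hodd hq _
  exact Submodule.mem_comap.1 (this.ge (Submodule.mem_top (x := w)))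

/-! ### Passing from cycles to homology classes -/

section Classes

/-- Over a field the class map extends to all forms. The extension is arbitrary and its values
matter only on cycles, but it allows computing in Ω(n) without subtypes. -/
theorem exists_class (q : Kˣ) (n : ℕ) (p : ℕ × ℕ) : ∃ f : OmegaGr q n p →ₗ[K] HomologyGr q n p,
    f ∘ₗ (cycles q n p.1 p.2).subtype = Homology.mk q n p.1 p.2 :=
  LinearMap.exists_extend _

/-- A linear extension of the projection from cycles to homology classes. -/
def classGr (q : Kˣ) (n : ℕ) (p : ℕ × ℕ) : OmegaGr q n p →ₗ[K] HomologyGr q n p :=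
  (exists_class q n p).choose

theorem classGr_apply (q : Kˣ) {n : ℕ} {p : ℕ × ℕ} (x : cycles q n p.1 p.2) :
    classGr q n p x.1 = Homology.mk q n p.1 p.2 x :=
  LinearMap.congr_fun (exists_class q n p).choose_spec x

/-- The class of a cycle of `Ω(n)`, extended linearly to `Ω(n)`. -/
def classLin (q : Kˣ) (n : ℕ) : OmegaAlg q n →ₗ[K] HomologyAlg q n :=
  DirectSum.lmap (classGr q n)

theorem classLin_of (q : Kˣ) {n : ℕ} {p : ℕ × ℕ} (x : OmegaGr q n p)
    (hx : x ∈ cycles q n p.1 p.2) : classLin q n (of (OmegaGr q n) p x) =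
      of (HomologyGr q n) p (Homology.mk q n p.1 p.2 ⟨x, hx⟩) := by
  rw [← classGr_apply]
  exact DirectSum.lmap_lof (classGr q n) p x

/-- Each component of `diff q n u` comes from a single component of `u`, so the homogeneous
components of a cycle are cycles. -/
theorem diff_apply (q : Kˣ) {n : ℕ} (u : OmegaAlg q n) (p : ℕ × ℕ) :
    diff q n u (p.1, p.2 + 1) = delta q n p.1 p.2 (u p) := by
  induction u using DirectSum.induction_on with
  | zero => rw [map_zero]; exact (map_zero _).symm
  | add u v hu hv => rw [map_add, DirectSum.add_apply, DirectSum.add_apply, hu, hv, map_add]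
  | of p' x =>
    rw [diff_of]
    by_cases h : p' = p
    · subst h; rw [of_eq_same, of_eq_same]
    · rw [of_eq_of_ne _ _ _ (Ne.symm h), of_eq_of_ne, map_zero]
      intro e
      exact h (Prod.ext (Prod.mk.inj e).1.symm (by have := (Prod.mk.inj e).2; omega))

theorem mem_cycles_of_mem (q : Kˣ) {n : ℕ} {u : OmegaAlg q n} (hu : u ∈ cycleAlg q n)
    (p : ℕ × ℕ) : u p ∈ cycles q n p.1 p.2 := by
  rw [mem_cycleAlg] at hu
  rw [cycles, LinearMap.mem_ker, ← diff_apply, hu]; rfl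

theorem of_mem_cycleAlg (q : Kˣ) {n : ℕ} {p : ℕ × ℕ} {x : OmegaGr q n p}
    (hx : x ∈ cycles q n p.1 p.2) : of (OmegaGr q n) p x ∈ cycleAlg q n := by
  rw [mem_cycleAlg, diff_of]
  rw [cycles, LinearMap.mem_ker] at hx
  rw [hx, map_zero]

theorem cycle_induction (q : Kˣ) {n : ℕ} {P : OmegaAlg q n → Prop} (h0 : P 0)
    (hadd : ∀ u v, P u → P v → P (u + v))
    (hof : ∀ (p : ℕ × ℕ) (x : OmegaGr q n p), x ∈ cycles q n p.1 p.2 → P (of (OmegaGr q n) p x))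
    {u : OmegaAlg q n} (hu : u ∈ cycleAlg q n) : P u := by
  classical
  rw [← DirectSum.sum_support_of u]
  exact Finset.sum_induction _ P hadd h0 fun p _ => hof p _ (mem_cycles_of_mem q hu p)

/-- By bilinearity both factors may be taken to be homogeneous cycles, where this is the definition
of the product in homology. -/
theorem classLin_mul (q : Kˣ) {n : ℕ} {u v : OmegaAlg q n} (hu : u ∈ cycleAlg q n)
    (hv : v ∈ cycleAlg q n) : classLin q n (u * v) = classLin q n u * classLin q n v := by
  refine cycle_induction q (P := fun u => classLin q n (u * v) = classLin q n u * classLin q n v)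
    ?_ (fun u u' h h' => ?_) (fun p x hx => ?_) hu
  · rw [zero_mul, map_zero, zero_mul]
  · rw [add_mul, map_add, h, h', map_add, add_mul]
  refine cycle_induction q (P := fun v => classLin q n (of (OmegaGr q n) p x * v) =
    classLin q n (of (OmegaGr q n) p x) * classLin q n v)
    ?_ (fun u u' h h' => ?_) (fun p' y hy => ?_) hv
  · rw [mul_zero, map_zero, mul_zero]
  · rw [mul_add, map_add, h, h', map_add, mul_add]
  have e := classLin_of q (p := p + p') (Omega.mul q n p.1 p.2 p'.1 p'.2 x y)
    (mul_mem_cycles q hx hy)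
  have e1 : of (OmegaGr q n) p x * of (OmegaGr q n) p' y =
    of (OmegaGr q n) (p + p') (Omega.mul q n p.1 p.2 p'.1 p'.2 x y) := of_mul_of _ _
  have e2 : of (HomologyGr q n) p (Homology.mk q n p.1 p.2 ⟨x, hx⟩) *
    of (HomologyGr q n) p' (Homology.mk q n p'.1 p'.2 ⟨y, hy⟩) =
    of (HomologyGr q n) (p + p') (Homology.mul q n p.1 p.2 p'.1 p'.2
      (Homology.mk q n p.1 p.2 ⟨x, hx⟩) (Homology.mk q n p'.1 p'.2 ⟨y, hy⟩)) := of_mul_of _ _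
  rw [classLin_of q x hx, classLin_of q y hy, e1, e2, Homology.mul_mk]
  exact e

theorem classLin_one (q : Kˣ) (n : ℕ) : classLin q n 1 = 1 :=
  classLin_of q (p := 0) _ (one_mem_cycles q n)

theorem classLin_diff (q : Kˣ) {n : ℕ} (u : OmegaAlg q n) : classLin q n (diff q n u) = 0 := by
  induction u using DirectSum.induction_on with
  | zero => rw [map_zero, map_zero]
  | add u v hu hv => rw [map_add, map_add, hu, hv, add_zero]
  | of p x =>
    obtain ⟨d, i⟩ := p
    have hc : delta q n d i x ∈ cycles q n d (i + 1) :=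
      LinearMap.congr_fun (delta_delta q n d i) x
    have h0 : Homology.mk q n d (i + 1) ⟨delta q n d i x, hc⟩ = 0 :=
      (Homology.mk_eq_zero q).2 ⟨x, rfl⟩
    rw [diff_of, classLin_of q (p := (d, i + 1)) (delta q n d i x) hc]
    exact (congrArg _ h0).trans (map_zero _)

theorem classLin_apply (q : Kˣ) {n : ℕ} (u : OmegaAlg q n) (p : ℕ × ℕ) :
    classLin q n u p = classGr q n p (u p) := rfl

/-- Every component of `u` is a boundary in its own bidegree; the finitely many nonzero ones are
then summed. In degree `i = 0` being a boundary means being zero. -/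
theorem exists_diff_eq (q : Kˣ) {n : ℕ} {u : OmegaAlg q n} (hu : u ∈ cycleAlg q n)
    (h : classLin q n u = 0) : ∃ v, u = diff q n v := by
  classical
  have key : ∀ p : ℕ × ℕ, of (OmegaGr q n) p (u p) ∈ LinearMap.range (diff q n) := by
    rintro ⟨d, i⟩
    have h1 : Homology.mk q n d i ⟨u (d, i), mem_cycles_of_mem q hu (d, i)⟩ = 0 := by
      rw [← classGr_apply q (p := (d, i)), ← classLin_apply, h]; rfl
    rw [Homology.mk_eq_zero] at h1
    cases i with
    | zero =>
      rw [boundaries, Submodule.mem_bot] at h1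
      have h1 : u (d, 0) = 0 := h1
      rw [h1, map_zero]; exact zero_mem _
    | succ i =>
      obtain ⟨x, hx⟩ := h1
      exact ⟨of (OmegaGr q n) (d, i) x, by rw [diff_of, hx]⟩
  have : u ∈ LinearMap.range (diff q n) := by
    rw [← DirectSum.sum_support_of u]
    exact Submodule.sum_mem _ fun p _ => key p
  obtain ⟨v, hv⟩ := this
  exact ⟨v, hv.symm⟩

theorem classLin_surjective (q : Kˣ) {n : ℕ} (h : HomologyAlg q n) :
    ∃ u ∈ cycleAlg q n, classLin q n u = h := by
  induction h using DirectSum.induction_on with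
  | zero => exact ⟨0, zero_mem _, map_zero _⟩
  | add g h hg hh =>
    obtain ⟨u, hu, rfl⟩ := hg
    obtain ⟨v, hv, rfl⟩ := hh
    exact ⟨u + v, add_mem hu hv, map_add _ _ _⟩
  | of p y =>
    obtain ⟨⟨x, hx⟩, rfl⟩ := Homology.mk_surjective q n p.1 p.2 y
    exact ⟨_, of_mem_cycleAlg q hx, classLin_of q x hx⟩

end Classes

/-- The inverse Cartier operator as an isomorphism of algebras. -/
def cartierEquiv {q : Kˣ} {l : ℕ} (hl : 1 < l) (hodd : Odd l) (hq : IsPrimitiveRoot q l) (n : ℕ) :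
    OmegaAlg (1 : Kˣ) n ≃ₐ[K] HomologyAlg q n :=
  AlgEquiv.ofBijective
    (AlgHom.ofLinearMap (classLin q n ∘ₗ (cartier hl hodd hq n).toLinearMap)
      (by simp [classLin_one])
      (fun u v => by
        simp only [LinearMap.comp_apply, AlgHom.toLinearMap_apply, map_mul]
        exact classLin_mul q (cartier_mem hl hodd hq u) (cartier_mem hl hodd hq v)))
    (by
      constructor
      · refine (injective_iff_map_eq_zero _).2 fun w hw => ?_
        obtain ⟨v, hv⟩ := exists_diff_eq q (cartier_mem hl hodd hq w) hw
        exact eq_zero_of_cartier_eq_diff hl hodd hq hv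
      · intro h
        obtain ⟨u, hu, rfl⟩ := classLin_surjective q h
        obtain ⟨w, v, rfl⟩ := exists_cartier_add_diff hl hodd hq hu
        refine ⟨w, ?_⟩
        rw [map_add, classLin_diff, add_zero]
        rfl)

theorem cartierEquiv_apply {q : Kˣ} {l : ℕ} (hl : 1 < l) (hodd : Odd l) (hq : IsPrimitiveRoot q l)
    {n : ℕ} (u : OmegaAlg (1 : Kˣ) n) :
    cartierEquiv hl hodd hq n u = classLin q n (cartier hl hodd hq n u) := rfl

end Iso
end QuantumDeRham

namespace QuantumDeRham

/-! ### Blocks of ℓ tensor factors and naturality -/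

noncomputable section Naturality

open DirectSum

variable {K : Type*} [Field K]

/-- The braid that, in a product of `i` blocks of `l` strands starting at the strand `s`, moves the
last strand of each block to the end. -/
def braidExt {M : Type*} [Monoid M] (T : ℕ → M) (l : ℕ) : ℕ → ℕ → M
  | 0, _ => 1
  -- The factor on the right acts first and sorts the following `i` blocks. Their `i * l - i`
  -- symmetric strands are then the ones that the last strand of the first block must cross.
  | i + 1, s => up T (s + (l - 1)) (i * l - i) * braidExt T l i (s + l)

/-- The braid is a product of Hecke generators independent of the word, which is why representatives
of the cycles are written with it. -/
theorem schur_braidExt {q : Kˣ} {n m d : ℕ} (f : schur q n m d) (l i s : ℕ)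
    (x : TensorPow K n d) :
    f.1 (braidExt (heckeT (q : K) n d) l i s x) = braidExt (heckeT (q : K) m d) l i s (f.1 x) := by
  induction i generalizing s with
  | zero => rfl
  | succ i ih => simp only [braidExt, Module.End.mul_apply]; rw [schur_up, ih]

theorem braidExt_tmul_right (q : K) {n d₁ d₂ l i s : ℕ} (x : TensorPow K n d₁)
    (y : TensorPow K n d₂) :
    braidExt (heckeT q n (d₁ + d₂)) l i (d₁ + s) (tmul K n d₁ d₂ x y) =
      tmul K n d₁ d₂ x (braidExt (heckeT q n d₂) l i s y) := by
  induction i generalizing s with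
  | zero => rfl
  | succ i ih =>
    simp only [braidExt, Module.End.mul_apply]
    rw [add_assoc d₁ s l, add_assoc d₁ s (l - 1), ih, up_tmul_right]

theorem castT_braidExt (q : K) {n d d' : ℕ} (h : d = d') (l i s : ℕ) (x : TensorPow K n d) :
    castT h (braidExt (heckeT q n d) l i s x) = braidExt (heckeT q n d') l i s (castT h x) := by
  subst h; simp only [castT_rfl]

theorem castT_up (q : K) {n d d' : ℕ} (h : d = d') (s m : ℕ) (x : TensorPow K n d) :
    castT h (up (heckeT q n d) s m x) = up (heckeT q n d') s m (castT h x) := by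
  subst h; simp only [castT_rfl]

theorem castT_block_cons {n d l : ℕ} (h : l + d * l = (d + 1) * l) (x : Fin l → Fin n)
    (F : Fin d → Fin l → Fin n) :
    castT h (tmul K n l (d * l) (tens K x) (tens K (blockEquiv n d l F))) =
      tens K (blockEquiv n (d + 1) l (Fin.cons x F : Fin (d + 1) → Fin l → Fin n)) := by
  rw [tmul_tens, castT_tens]
  congr 1
  funext p
  obtain ⟨p, rfl⟩ : ∃ p', Fin.cast h p' = p := ⟨Fin.cast h.symm p, rfl⟩
  rw [Function.comp_apply, blockEquiv_apply]
  change Fin.append x (blockEquiv n d l F) p = _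
  induction p using Fin.addCases with
  | left p =>
    have e1 : (Fin.cast h (Fin.castAdd (d * l) p)).divNat = 0 := by
      apply Fin.ext; simp only [Fin.divNat]; exact Nat.div_eq_of_lt p.2
    have e2 : (Fin.cast h (Fin.castAdd (d * l) p)).modNat = p := by
      apply Fin.ext; simp only [Fin.modNat]; exact Nat.mod_eq_of_lt p.2
    rw [Fin.append_left, e1, e2, Fin.cons_zero]
  | right p =>
    have hl : 0 < l := by
      rcases Nat.eq_zero_or_pos l with h0 | h0
      · subst h0; exact absurd p.2 (by simp)
      · exact h0
    have e1 : (Fin.cast h (Fin.natAdd l p)).divNat = p.divNat.succ := by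
      apply Fin.ext; simp only [Fin.divNat, Fin.val_cast, Fin.val_natAdd, Fin.val_succ]
      rw [Nat.add_div_left _ hl]
    have e2 : (Fin.cast h (Fin.natAdd l p)).modNat = p.modNat := by
      apply Fin.ext; simp only [Fin.modNat, Fin.val_cast, Fin.val_natAdd]
      rw [Nat.add_mod_left]
    rw [Fin.append_right, blockEquiv_apply, e1, e2, Fin.cons_succ]

/-- A product of blocks, computed in a tensor power. -/
theorem prod_blocks (q : Kˣ) {n l : ℕ} (hl : 0 < l) {d i : ℕ} (hi : i ≤ d)
    (F : Fin d → Fin l → Fin n) :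
    ofTens q n (d * l) i (braidExt (heckeT (q : K) n (d * l)) l i ((d - i) * l)
      (tens K (blockEquiv n d l F))) = (List.ofFn fun t : Fin d =>
        ofTens q n l (if (t : ℕ) < d - i then 0 else 1) (tens K (F t))).prod := by
  induction d generalizing i with
  | zero =>
    obtain rfl : i = 0 := by omega
    have h0 : (0 : ℕ) = 0 * l := (zero_mul l).symm
    have e := ofTens_cast q (i := 0) (i' := 0) h0 rfl (tens K (Fin.elim0 : Fin 0 → Fin n))
    rw [ofTens_zero, castT_tens] at e
    rw [List.ofFn_zero, List.prod_nil, e]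
    change ofTens q n (0 * l) 0 (tens K _) = _
    congr 2
    funext p
    exact absurd p.2 (by simp)
  | succ d ih =>
    have hc : l + d * l = (d + 1) * l := by ring
    have hdl : d ≤ d * l := Nat.le_mul_of_pos_right d hl
    rw [List.ofFn_succ, List.prod_cons]
    have hF : F = (Fin.cons (F 0) (fun t => F t.succ) : Fin (d + 1) → Fin l → Fin n) :=
      (Fin.cons_self_tail F).symm
    rcases Nat.lt_or_ge d i with h | h
    · obtain rfl : i = d + 1 := by omega
      have e := ih le_rfl fun t => F t.succ
      simp only [Nat.sub_self, Nat.not_lt_zero, if_false] at e ⊢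
      -- The first block has one exterior strand, so the braid of the product is the single cycle
      -- `up` by which `braidExt` is extended. In the other case below that block has no exterior
      -- strand and the braid is trivial.
      rw [← e, ofTens_mul q hl hdl, mulRep_apply, blk_one, ← braidExt_tmul_right,
        ofTens_cast q hc (add_comm 1 d), castT_up, castT_braidExt, castT_block_cons, ← hF]
      simp only [braidExt, Module.End.mul_apply, zero_mul, zero_add, add_zero]
    · have e := ih h fun t => F t.succ
      have e1 : d + 1 - i = d - i + 1 := by omega
      simp only [e1, Fin.val_zero, Nat.succ_pos, if_true, Fin.val_succ, Nat.add_lt_add_iff_right]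
      rw [← e, ofTens_mul q (Nat.zero_le l) (h.trans hdl), mulRep_apply, blk_zero_left,
        Module.End.one_apply, ← braidExt_tmul_right, ofTens_cast q hc (zero_add i), castT_braidExt,
        castT_block_cons, ← hF]
      congr 3
      ring

/-- Each factor is the class of a constant block of length `l`, in exterior degree 0 or 1, so
`prod_blocks` applies to the blocks of I^ℓ. -/
theorem frobWord_eq_ofTens (q : Kˣ) {n l : ℕ} (hl : 0 < l) {d i : ℕ} (hi : i ≤ d)
    (I : Fin d → Fin n) :
    frobWord q l d i I = ofTens q n (d * l) i (braidExt (heckeT (q : K) n (d * l)) l i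
      ((d - i) * l) (tens K (rep l I))) := by
  have e := prod_blocks q hl hi fun t _ => I t
  have e2 : blockEquiv n d l (fun t _ => I t) = rep l I := rfl
  rw [e2] at e
  rw [e, frobWord]
  congr 2
  funext t
  split_ifs
  · rw [ofTens_const]; rfl
  · obtain ⟨m, rfl⟩ : ∃ m, l = m + 1 := ⟨l - 1, by omega⟩
    rw [ofTens_const_one]; rfl

/-- Sums of noncommutative products can be compared one slot at a time. -/
theorem sum_smul_prod_congr {R : Type*} [Ring R] [Algebra K R] {X : Type*} [Fintype X] {d : ℕ}
    (V : (Fin d → X) → K) (α β : Fin d → X → R)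
    (h : ∀ t F, ∑ x, V (Function.update F t x) • α t x = ∑ x, V (Function.update F t x) • β t x) :
    ∑ F, V F • (List.ofFn fun t => α t (F t)).prod =
      ∑ F, V F • (List.ofFn fun t => β t (F t)).prod := by
  induction d with
  | zero => simp
  | succ d ih =>
    rw [← Fintype.sum_equiv (Fin.consEquiv fun _ => X) _ _ fun y => rfl,
      ← Fintype.sum_equiv (Fin.consEquiv fun _ => X) _ _ fun y => rfl,
      Fintype.sum_prod_type, Fintype.sum_prod_type]
    have e : ∀ (γ : Fin (d + 1) → X → R) (x : X) (F : Fin d → X),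
        V (Fin.consEquiv (fun _ => X) (x, F)) •
          (List.ofFn fun t => γ t (Fin.consEquiv (fun _ => X) (x, F) t)).prod =
        γ 0 x * (V (Fin.cons (α := fun _ => X) x F) •
          (List.ofFn fun t : Fin d => γ t.succ (F t)).prod) := fun γ x F => by
      rw [List.ofFn_succ, List.prod_cons, mul_smul_comm]
      rfl
    simp only [e]
    -- With the first letter fixed, the other slots are exchanged by induction; then the first slot
    -- is exchanged with the others fixed.
    have h1 : ∀ x, ∑ F : Fin d → X, V (Fin.cons (α := fun _ => X) x F) •
          (List.ofFn fun t : Fin d => α t.succ (F t)).prod =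
        ∑ F : Fin d → X, V (Fin.cons (α := fun _ => X) x F) •
          (List.ofFn fun t : Fin d => β t.succ (F t)).prod := fun x => by
      refine ih (fun F => V (Fin.cons (α := fun _ => X) x F)) (fun t => α t.succ)
        (fun t => β t.succ) fun t F => ?_
      have := h t.succ (Fin.cons (α := fun _ => X) x F)
      simpa only [Fin.cons_update] using this
    simp only [← Finset.mul_sum, h1]
    simp only [Finset.mul_sum]
    rw [Finset.sum_comm, Finset.sum_comm (γ := X)]
    refine Finset.sum_congr rfl fun F _ => ?_
    simp only [mul_smul_comm, ← smul_mul_assoc]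
    rw [← Finset.sum_mul, ← Finset.sum_mul]
    congr 1
    rcases isEmpty_or_nonempty X with hX | ⟨⟨x0⟩⟩
    · simp
    have := h 0 (Fin.cons (α := fun _ => X) x0 F)
    simpa only [Fin.update_cons_zero] using this

/-- The tensors on which every `T_k` acts as `q`, in coordinates. -/
def invSub (q : Kˣ) (n l : ℕ) : Submodule K (TensorPow K n l) where
  carrier := {w | ∀ (k : ℕ) (h : k + 1 < l) (u : Fin l → Fin n),
    u ⟨k, Nat.lt_of_succ_lt h⟩ < u ⟨k + 1, h⟩ → w (swapAt h u) = q * w u}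
  zero_mem' k h u hu := by simp
  add_mem' {v w} hv hw k h u hu := by
    rw [Finsupp.add_apply, Finsupp.add_apply, hv k h u hu, hw k h u hu, mul_add]
  smul_mem' c w hw k h u hu := by
    rw [Finsupp.smul_apply, Finsupp.smul_apply, hw k h u hu, smul_eq_mul, smul_eq_mul,
      mul_left_comm]

/-- Prescribing the coordinates at ascents is enough: equal letters are automatic, and a descent is
the ascent condition for the swapped word. -/
theorem heckeT_of_mem_invSub {q : Kˣ} {n l k : ℕ} {w : TensorPow K n l} (hw : w ∈ invSub q n l)
    (h : k + 1 < l) : heckeT (q : K) n l k w = (q : K) • w := by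
  refine Finsupp.ext fun u => ?_
  rw [← pair_tens, ← pair_heckeT, heckeT_tens _ h, Finsupp.smul_apply, smul_eq_mul]
  split_ifs with h1 h2
  · rw [pair_tens, hw k h u h1]
  · rw [map_smul, LinearMap.smul_apply, pair_tens, smul_eq_mul]
  · have e := hw k h (swapAt h u) (by
      rw [swapAt_left, swapAt_right]; exact lt_of_le_of_ne (not_lt.1 h1) (Ne.symm h2))
    rw [swapAt_swapAt] at e
    rw [map_add, map_smul, LinearMap.add_apply, LinearMap.smul_apply, pair_tens, pair_tens, e,
      smul_eq_mul]
    have := q.ne_zero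
    field_simp
    ring

theorem apply_swapAt_of_eigen {q : Kˣ} {n l k : ℕ} {w : TensorPow K n l} (h : k + 1 < l)
    (hw : heckeT (q : K) n l k w = (q : K) • w) {u : Fin l → Fin n}
    (hu : u ⟨k, Nat.lt_of_succ_lt h⟩ < u ⟨k + 1, h⟩) : w (swapAt h u) = q * w u := by
  have e : heckeT (q : K) n l k (tens K u) = tens K (swapAt h u) := by
    rw [heckeT_tens _ h, if_pos hu]
  rw [← pair_tens, ← e, pair_heckeT, hw, map_smul, pair_tens, smul_eq_mul]

theorem up_of_mem_invSub {q : Kˣ} {n l : ℕ} {w : TensorPow K n l} (hw : w ∈ invSub q n l)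
    {s m : ℕ} (h : s + m < l) : up (heckeT (q : K) n l) s m w = (q : K) ^ m • w := by
  induction m with
  | zero => simp [up]
  | succ m ih =>
    simp only [up, Module.End.mul_apply]
    rw [ih (by omega), map_smul, heckeT_of_mem_invSub hw (by omega), smul_smul, pow_succ]

theorem shuffle_of_mem_invSub {q : Kˣ} {n l : ℕ} {w : TensorPow K n l} (hw : w ∈ invSub q n l)
    {m : ℕ} (h : m ≤ l) : shuffle (q : K) n l m w = qint (q : K) m • w := by
  rw [shuffle, qint, ← Finset.sum_range_reflect, LinearMap.sum_apply, Finset.sum_smul]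
  refine Finset.sum_congr rfl fun p hp => ?_
  rw [Finset.mem_range] at hp
  rw [LinearMap.smul_apply, up_of_mem_invSub hw (by omega), smul_smul, ← pow_mul, two_mul, pow_add,
    show m - 1 - (m - 1 - p) = p by omega]

/-- The shuffle sum multiplies a q-symmetric tensor by [ℓ - i]. For `i = 0` this scalar is [ℓ] = 0.
For `i = 1` the tensor is an eigenvector of the generator on the last two factors with eigenvalue q,
so it dies in Λ². -/
theorem ofTens_mem_cycleAlg {q : Kˣ} {l : ℕ} (hl : 1 < l) (hodd : Odd l)
    (hq : IsPrimitiveRoot q l) {n i : ℕ} (hi : i ≤ 1) {w : TensorPow K n l}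
    (hw : w ∈ invSub q n l) : ofTens q n l i w ∈ cycleAlg q n := by
  rw [mem_cycleAlg, diff_ofTens, shuffle_of_mem_invSub hw (Nat.sub_le l i), map_smul]
  interval_cases i
  · rw [Nat.sub_zero, (qint_eq_zero hl hodd hq).2 dvd_rfl, zero_smul]
  · rw [ofTens_of_mem q (ext_mem q (k := l - 2) (by omega) (by omega) w
      (heckeT_of_mem_invSub hw (by omega))), smul_zero]

/-- The number of occurrences of each letter in a word. -/
def content {n d : ℕ} (I : Fin d → Fin n) : Fin n → ℕ := ∑ k, Pi.single (I k) 1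

theorem content_cons {n d : ℕ} (a : Fin n) (I : Fin d → Fin n) :
    content (Fin.cons a I : Fin (d + 1) → Fin n) = Pi.single a 1 + content I := by
  rw [content, Fin.sum_univ_succ]; simp [content]

/-- The span of the monomials of a given weight. -/
def weightSub (K : Type*) [Field K] {n : ℕ} (b : Fin n → ℕ) : Submodule K (Model K n) :=
  Submodule.span K {m | ∃ a J, a + ind J = b ∧ mono K a J = m}

theorem symOp_mem_weightSub (q : Kˣ) {n : ℕ} {b : Fin n → ℕ} (s : Fin n) :
    weightSub K b ≤ (weightSub K (Pi.single s 1 + b)).comap (symOp q s) := by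
  refine Submodule.span_le.2 ?_
  rintro _ ⟨a, J, rfl, rfl⟩
  rw [SetLike.mem_coe, Submodule.mem_comap, symOp_mono]
  exact Submodule.smul_mem _ _ (Submodule.subset_span ⟨_, J, by abel, rfl⟩)

theorem extOp_mem_weightSub (q : Kˣ) {n : ℕ} {b : Fin n → ℕ} (s : Fin n) :
    weightSub K b ≤ (weightSub K (Pi.single s 1 + b)).comap (extOp q s) := by
  refine Submodule.span_le.2 ?_
  rintro _ ⟨a, J, rfl, rfl⟩
  rw [SetLike.mem_coe, Submodule.mem_comap, extOp_mono]
  split_ifs with h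
  · exact zero_mem _
  · exact Submodule.smul_mem _ _ (Submodule.subset_span ⟨a, _, by rw [ind_insert h]; abel, rfl⟩)

theorem wordForm_mem_weightSub (q : Kˣ) {n d i : ℕ} (hi : i ≤ d) (I : Fin d → Fin n) :
    wordForm q d i I ∈ weightSub K (content I) := by
  refine word_induction (p := fun d i I => wordForm q d i I ∈ weightSub K (content I)) ?_ ?_ ?_ hi I
  · exact Submodule.subset_span ⟨0, ∅, by simp [ind_empty, content], by simp [wordForm]⟩
  · intro d i a I hi ih
    rw [wordForm_cons_sym q hi, content_cons]
    exact symOp_mem_weightSub q a ih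
  · intro d a I ih
    rw [wordForm_cons_ext, content_cons]
    exact extOp_mem_weightSub q a ih

theorem divProj_weightSub {n l : ℕ} {b : Fin n → ℕ} (hb : Bad l b) :
    weightSub K b ≤ LinearMap.ker (divProj K n l) := by
  refine Submodule.span_le.2 ?_
  rintro _ ⟨a, J, rfl, rfl⟩
  rw [SetLike.mem_coe, LinearMap.mem_ker, divProj_mono, if_pos hb]

/-- The first letter occurs at least once; if the number of its occurrences among `l` places is
divisible by `l`, it fills the word. -/
theorem bad_content {n l : ℕ} (hl : 0 < l) {u : Fin l → Fin n} (hu : ∀ a, u ≠ fun _ => a) :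
    Bad l (content u) := by
  by_contra h
  refine hu (u ⟨0, hl⟩) (funext fun k => ?_)
  have hc : content u (u ⟨0, hl⟩) = (Finset.univ.filter fun k => u k = u ⟨0, hl⟩).card := by
    simp [content, Finset.sum_apply, Pi.single_apply, eq_comm]
  have hd : l ∣ content u (u ⟨0, hl⟩) := by
    by_contra h'
    exact h ⟨_, h'⟩
  have hpos : 0 < content u (u ⟨0, hl⟩) := by
    rw [hc]; exact Finset.card_pos.2 ⟨⟨0, hl⟩, by simp⟩
  have hle := Nat.le_of_dvd hpos hd
  rw [hc] at hle
  have huniv : (Finset.univ.filter fun k => u k = u ⟨0, hl⟩) = Finset.univ :=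
    Finset.eq_univ_of_card _ (le_antisymm (Finset.card_le_univ _) (by simpa using hle))
  have := Finset.mem_univ k
  rw [← huniv, Finset.mem_filter] at this
  exact this.2

/-- Only nonconstant words occur, so all weights are non-divisible and the projection vanishes. For
a cycle the homotopy formula then exhibits a primitive. -/
theorem classLin_ofTens_eq_zero {q : Kˣ} {l : ℕ} (hl : 1 < l) (hodd : Odd l)
    (hq : IsPrimitiveRoot q l) {n i : ℕ} (hi : i ≤ 1) {w : TensorPow K n l}
    (hw : w ∈ invSub q n l) (h : ∀ a : Fin n, w (fun _ => a) = 0) :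
    classLin q n (ofTens q n l i w) = 0 := by
  have h2 := sq_ne_neg_one hl hodd hq
  have hz := ofTens_mem_cycleAlg hl hodd hq hi hw
  rw [mem_cycleAlg] at hz
  set u := ofTens q n l i w with hu
  have hm : diffOp q n (normalForm q h2 n u) = 0 := by
    rw [← normalForm_ofModel q h2 (diffOp q n _), ← diff_ofModel, ofModel_normalForm, hz, map_zero]
  have hp : divProj K n l (normalForm q h2 n u) = 0 := by
    rw [hu, ← Finsupp.univ_sum_single w, map_sum, map_sum, map_sum]
    refine Finset.sum_eq_zero fun I _ => ?_
    rw [← Finsupp.smul_single_one, map_smul, map_smul, map_smul,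
      normalForm_tens q h2 (by omega)]
    by_cases hI : ∃ a, I = fun _ => a
    · obtain ⟨a, rfl⟩ := hI
      rw [h a, zero_smul]
    · have := divProj_weightSub (K := K) (bad_content (by omega) (not_exists.1 hI))
        (wordForm_mem_weightSub q (by omega : i ≤ l) I)
      rw [LinearMap.mem_ker] at this
      rw [this, smul_zero]
  have e := homotopy_formula hl hodd hq (normalForm q h2 n u)
  rw [hm, hp, map_zero, add_zero, add_zero] at e
  rw [← ofModel_normalForm q h2 u, ← e, ← diff_ofModel, classLin_diff]

theorem const_mem_invSub (q : Kˣ) {n l : ℕ} (a : Fin n) :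
    tens K (fun _ : Fin l => a) ∈ invSub q n l := by
  intro k h u hu
  have h1 : u ≠ fun _ => a := by rintro rfl; exact lt_irrefl _ hu
  have h2 : swapAt h u ≠ fun _ => a := fun e => by
    have e1 := swapAt_swapAt h u
    rw [e] at e1
    exact h1 (e1.symm.trans (swapAt_eq h _ rfl))
  rw [Finsupp.single_apply, Finsupp.single_apply, if_neg h1.symm, if_neg h2.symm, mul_zero]

/-- Subtracting the constant words, which are themselves q-symmetric, leaves a tensor to which the
previous vanishing applies. -/
theorem classLin_ofTens {q : Kˣ} {l : ℕ} (hl : 1 < l) (hodd : Odd l)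
    (hq : IsPrimitiveRoot q l) {n i : ℕ} (hi : i ≤ 1) {w : TensorPow K n l}
    (hw : w ∈ invSub q n l) : classLin q n (ofTens q n l i w) =
      ∑ a : Fin n, w (fun _ => a) • classLin q n (ofTens q n l i (tens K fun _ => a)) := by
  have e := classLin_ofTens_eq_zero hl hodd hq hi
    (sub_mem hw (sum_mem fun (a : Fin n) (_ : a ∈ Finset.univ) =>
      (invSub q n l).smul_mem (w fun _ => a) (const_mem_invSub q a))) fun b => by
      rw [Finsupp.sub_apply, Finsupp.finsetSum_apply, Finset.sum_eq_single b]
      · simp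
      · intro a _ hab
        have : (fun _ : Fin l => a) ≠ fun _ => b := fun e => hab (congrFun e ⟨0, by omega⟩)
        rw [Finsupp.smul_apply, Finsupp.single_eq_of_ne this.symm, smul_zero]
      · simp
  rw [map_sub, map_sub, sub_eq_zero] at e
  rw [e, map_sum, map_sum]
  simp only [map_smul]

theorem classLin_list_prod (q : Kˣ) {n : ℕ} (L : List (OmegaAlg q n))
    (h : ∀ u ∈ L, u ∈ cycleAlg q n) : classLin q n L.prod = (L.map (classLin q n)).prod := by
  induction L with
  | nil => exact classLin_one q n
  | cons u L ih =>
    rw [List.prod_cons, classLin_mul q (h u List.mem_cons_self)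
      ((cycleAlg q n).list_prod_mem fun v hv => h v (List.mem_cons_of_mem u hv)),
      ih fun v hv => h v (List.mem_cons_of_mem u hv), List.map_cons, List.prod_cons]

theorem exists_projection {V : Type*} [AddCommGroup V] [Module K V] (W : Submodule K V) :
    ∃ π : V →ₗ[K] V, (∀ x, π x ∈ W) ∧ ∀ w ∈ W, π w = w := by
  obtain ⟨g, hg⟩ := LinearMap.exists_extend (p := W) LinearMap.id
  exact ⟨W.subtype ∘ₗ g, fun x => (g x).2, fun w hw =>
    congrArg Subtype.val (LinearMap.congr_fun hg ⟨w, hw⟩)⟩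

open Classical in
/-- The class of a product of blocks only depends on the coordinates at the words `J^l`. -/
theorem classLin_blocks {q : Kˣ} {l : ℕ} (hl : 1 < l) (hodd : Odd l)
    (hq : IsPrimitiveRoot q l) {n d i : ℕ} (hi : i ≤ d) (v : TensorPow K n (d * l))
    (hv : ∀ (t k : ℕ), t < d → t * l ≤ k → k + 1 < (t + 1) * l →
      heckeT (q : K) n (d * l) k v = (q : K) • v) :
    classLin q n (ofTens q n (d * l) i (braidExt (heckeT (q : K) n (d * l)) l i ((d - i) * l) v)) =
      ∑ J : Fin d → Fin n, v (rep l J) • classLin q n (frobWord q l d i J) := by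
  -- A single block word need not be a cycle, so classes cannot be multiplied word by word.
  -- Projecting each block onto the q-symmetric tensors turns every factor into a cycle.
  obtain ⟨π, hπ, hπ'⟩ := exists_projection (V := TensorPow K n l) (invSub q n l)
  let ε : Fin d → ℕ := fun t => if (t : ℕ) < d - i then 0 else 1
  have hε : ∀ t, ε t ≤ 1 := fun t => by simp only [ε]; split_ifs <;> omega
  let V : (Fin d → Fin l → Fin n) → K := fun F => v (blockEquiv n d l F)
  -- The tensor obtained from `v` by fixing all blocks except the one at `t`; by `hv` it is
  -- q-symmetric, hence fixed by `π`.
  let slice : Fin d → (Fin d → Fin l → Fin n) → TensorPow K n l := fun t F =>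
    ∑ x, V (Function.update F t x) • tens K x
  have slice_apply : ∀ t F x, slice t F x = V (Function.update F t x) := fun t F x => by
    simp only [slice, Finsupp.finsetSum_apply, Finsupp.smul_apply, Finsupp.single_apply]
    simp
  have slice_mem : ∀ t F, slice t F ∈ invSub q n l := fun t F k h u hu => by
    rw [slice_apply, slice_apply]
    have hb : ((t : ℕ) + 1) * l ≤ d * l := Nat.mul_le_mul_right _ t.2
    have e0 : ((t : ℕ) + 1) * l = t * l + l := by ring
    have h' : (t : ℕ) * l + k + 1 < d * l := by omega
    have e := swapAt_blockEquiv (Function.update F t u) t h h'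
    rw [Function.update_self, Function.update_idem] at e
    simp only [V]
    rw [← e]
    refine apply_swapAt_of_eigen h' (hv t _ t.2 (by omega) (by omega)) ?_
    rw [blockEquiv_apply, blockEquiv_apply]
    have hl0 : 0 < l := by omega
    have d1 : (⟨t * l + k, Nat.lt_of_succ_lt h'⟩ : Fin (d * l)).divNat = t := by
      apply Fin.ext; simp only [Fin.divNat]
      rw [Nat.mul_comm, Nat.mul_add_div hl0, Nat.div_eq_of_lt (by omega), add_zero]
    have d2 : (⟨t * l + k + 1, h'⟩ : Fin (d * l)).divNat = t := by
      apply Fin.ext; simp only [Fin.divNat]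
      rw [add_assoc, Nat.mul_comm, Nat.mul_add_div hl0, Nat.div_eq_of_lt h, add_zero]
    have m1 : (⟨t * l + k, Nat.lt_of_succ_lt h'⟩ : Fin (d * l)).modNat =
        ⟨k, Nat.lt_of_succ_lt h⟩ := by
      apply Fin.ext; simp only [Fin.modNat]; rw [Nat.mul_add_mod', Nat.mod_eq_of_lt (by omega)]
    have m2 : (⟨t * l + k + 1, h'⟩ : Fin (d * l)).modNat = ⟨k + 1, h⟩ := by
      apply Fin.ext; simp only [Fin.modNat]; rw [add_assoc, Nat.mul_add_mod', Nat.mod_eq_of_lt h]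
    rw [d1, d2, m1, m2, Function.update_self]
    exact hu
  have step1 : ofTens q n (d * l) i (braidExt (heckeT (q : K) n (d * l)) l i ((d - i) * l) v) =
      ∑ F, V F • (List.ofFn fun t => ofTens q n l (ε t) (tens K (F t))).prod := by
    conv_lhs => rw [← Finsupp.univ_sum_single v]
    rw [map_sum, map_sum, ← Fintype.sum_equiv (blockEquiv n d l) _ _ fun y => rfl]
    refine Finset.sum_congr rfl fun F _ => ?_
    rw [← Finsupp.smul_single_one, map_smul, map_smul, prod_blocks q (by omega) hi]
  have step2 : ∑ F, V F • (List.ofFn fun t => ofTens q n l (ε t) (tens K (F t))).prod =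
      ∑ F, V F • (List.ofFn fun t => ofTens q n l (ε t) (π (tens K (F t)))).prod := by
    refine sum_smul_prod_congr V (fun t x => ofTens q n l (ε t) (tens K x))
      (fun t x => ofTens q n l (ε t) (π (tens K x))) fun t F => ?_
    have e : π (slice t F) = slice t F := hπ' _ (slice_mem t F)
    have e1 := congrArg (ofTens q n l (ε t)) e
    simp only [slice, map_sum, map_smul] at e1
    exact e1.symm
  -- By `classLin_ofTens`, on slices the class may be replaced by the function that keeps constant
  -- block words and forgets the others.
  let χ : Fin d → (Fin l → Fin n) → HomologyAlg q n := fun t x =>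
    if ∃ a, x = fun _ => a then classLin q n (ofTens q n l (ε t) (tens K x)) else 0
  have step3 : ∑ F, V F • (List.ofFn fun t =>
      classLin q n (ofTens q n l (ε t) (π (tens K (F t))))).prod =
      ∑ F, V F • (List.ofFn fun t => χ t (F t)).prod := by
    refine sum_smul_prod_congr V (fun t x => classLin q n (ofTens q n l (ε t) (π (tens K x))))
      χ fun t F => ?_
    have e : π (slice t F) = slice t F := hπ' _ (slice_mem t F)
    have e1 := congrArg (fun w => classLin q n (ofTens q n l (ε t) w)) e
    change classLin q n _ = classLin q n _ at e1
    rw [classLin_ofTens hl hodd hq (hε t) (slice_mem t F)] at e1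
    simp only [slice_apply] at e1
    simp only [slice, map_sum, map_smul] at e1
    rw [e1]
    refine Finset.sum_of_injOn (fun a _ => a) (fun a _ b _ h => congrFun h ⟨0, by omega⟩)
      (fun a _ => Finset.mem_coe.2 (Finset.mem_univ _)) (fun x _ hx => ?_) fun a _ => ?_
    · have : ¬ ∃ a, x = fun _ => a := fun ⟨a, ha⟩ => hx ⟨a, by simp, ha.symm⟩
      simp only [χ, if_neg this, smul_zero]
    · simp only [χ]
      rw [if_pos ⟨a, rfl⟩]
  -- A product survives only if all its blocks are constant, that is, if the word is of the form
  -- J^ℓ.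
  have step4 : ∑ F, V F • (List.ofFn fun t => χ t (F t)).prod =
      ∑ J : Fin d → Fin n, v (rep l J) • classLin q n (frobWord q l d i J) := by
    symm
    refine Finset.sum_of_injOn (fun J t _ => J t)
      (fun I _ J _ h => funext fun t => congrFun (congrFun h t) ⟨0, by omega⟩)
      (fun a _ => Finset.mem_coe.2 (Finset.mem_univ _)) (fun F _ hF => ?_) fun J _ => ?_
    · have : ∃ t, ¬ ∃ a, F t = fun _ => a := by
        by_contra hc
        simp only [not_exists, not_forall, not_not] at hc
        choose J hJ using hc
        exact hF ⟨J, by simp, funext fun t => (hJ t).symm⟩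
      obtain ⟨t, ht⟩ := this
      rw [List.prod_eq_zero, smul_zero]
      rw [List.mem_ofFn]
      exact ⟨t, if_neg ht⟩
    · have e : frobWord q l d i J =
          (List.ofFn fun t : Fin d => ofTens q n l (ε t) (tens K fun _ => J t)).prod := by
        rw [frobWord_eq_ofTens q (by omega) hi]
        exact prod_blocks q (by omega) hi fun t _ => J t
      rw [e, classLin_list_prod, List.map_ofFn]
      · have e2 : (classLin q n ∘ fun t : Fin d => ofTens q n l (ε t) (tens K fun _ => J t)) =
            fun t => χ t fun _ => J t := by
          funext t
          simp only [χ, Function.comp_apply]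
          rw [if_pos ⟨J t, rfl⟩]
        rw [e2]
        rfl
      · intro u hu
        obtain ⟨t, rfl⟩ := (List.mem_ofFn).1 hu
        exact ofTens_mem_cycleAlg hl hodd hq (hε t) (const_mem_invSub q _)
  rw [step1, step2, ← step4, ← step3, map_sum]
  refine Finset.sum_congr rfl fun F _ => ?_
  rw [map_smul, classLin_list_prod, List.map_ofFn]
  · rfl
  · intro u hu
    obtain ⟨t, rfl⟩ := (List.mem_ofFn).1 hu
    exact ofTens_mem_cycleAlg hl hodd hq (hε t) (hπ _)

end Naturality
end QuantumDeRham

namespace QuantumDeRham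

/-! ### Components in each bidegree and their naturality -/

noncomputable section Component

open DirectSum

variable {K : Type*} [Field K] {q : Kˣ} {l : ℕ}

theorem exists_cartierEquiv_of (hl : 1 < l) (hodd : Odd l) (hq : IsPrimitiveRoot q l)
    {n d i : ℕ} (x : Omega (1 : Kˣ) n d i) : ∃ y : Homology q n (d * l) i,
      cartierEquiv hl hodd hq n (of (OmegaGr (1 : Kˣ) n) (d, i) x) =
        of (HomologyGr q n) (d * l, i) y := by
  rcases Nat.lt_or_ge d i with h | h
  · refine ⟨0, ?_⟩
    rw [Omega.eq_zero_of_lt 1 h x]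
    exact (congrArg _ (map_zero (of (OmegaGr (1 : Kˣ) n) (d, i)))).trans
      ((map_zero _).trans (map_zero (of (HomologyGr q n) (d * l, i))).symm)
  obtain ⟨x, rfl⟩ := Omega.mk_surjective 1 n d i x
  rw [← ofTens_apply]
  induction x using Finsupp.induction_linear with
  | zero => exact ⟨0, by rw [map_zero, map_zero]; exact (map_zero _).symm⟩
  | add x x' hx hx' =>
    obtain ⟨y, hy⟩ := hx
    obtain ⟨y', hy'⟩ := hx'
    exact ⟨y + y', by rw [map_add, map_add, hy, hy']; exact (map_add _ _ _).symm⟩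
  | single I c =>
    -- The representative provided by `frobWord_eq_ofTens` has bidegree `(d * l, i)`.
    refine ⟨c • classGr q n (d * l, i) (Omega.mk q n (d * l) i
      (braidExt (heckeT (q : K) n (d * l)) l i ((d - i) * l) (tens K (rep l I)))), ?_⟩
    rw [← Finsupp.smul_single_one, map_smul, map_smul, cartierEquiv_apply,
      cartier_tens hl hodd hq h, frobWord_eq_ofTens q (by omega) h, ofTens_apply]
    refine (congrArg (c • ·) (DirectSum.lmap_lof (classGr q n) (d * l, i) _)).trans ?_
    exact ((lof K _ (HomologyGr q n) (d * l, i)).map_smul c _).symm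

/-- The component `S^{d-i} ⊗ Λ^i → H^i(Ω_{dl})` of the isomorphism of algebras. -/
def cartierComponent (hl : 1 < l) (hodd : Odd l) (hq : IsPrimitiveRoot q l) (n d i : ℕ) :
    Omega (1 : Kˣ) n d i →ₗ[K] Homology q n (d * l) i :=
  DirectSum.component K _ (HomologyGr q n) (d * l, i) ∘ₗ (cartierEquiv hl hodd hq n).toLinearMap ∘ₗ
    lof K _ (OmegaGr (1 : Kˣ) n) (d, i)

theorem of_cartierComponent (hl : 1 < l) (hodd : Odd l) (hq : IsPrimitiveRoot q l) {n d i : ℕ}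
    (x : Omega (1 : Kˣ) n d i) :
    of (HomologyGr q n) (d * l, i) (cartierComponent hl hodd hq n d i x) =
      cartierEquiv hl hodd hq n (of (OmegaGr (1 : Kˣ) n) (d, i) x) := by
  obtain ⟨y, hy⟩ := exists_cartierEquiv_of hl hodd hq x
  have : cartierComponent hl hodd hq n d i x = y := by
    change (cartierEquiv hl hodd hq n (of (OmegaGr (1 : Kˣ) n) (d, i) x)) (d * l, i) = y
    rw [hy]
    exact of_eq_same (β := HomologyGr q n) (d * l, i) y
  rw [this, hy]

/-- Since `l > 0`, distinct bidegrees go to distinct bidegrees, so no other summand contributes.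
This gives surjectivity of the components: a preimage of a homogeneous class may be replaced by its
homogeneous part. -/
theorem cartierEquiv_coord (hl : 1 < l) (hodd : Odd l) (hq : IsPrimitiveRoot q l) {n : ℕ}
    (w : OmegaAlg (1 : Kˣ) n) (d i : ℕ) :
    cartierEquiv hl hodd hq n w (d * l, i) = cartierComponent hl hodd hq n d i (w (d, i)) := by
  induction w using DirectSum.induction_on with
  | zero => rw [map_zero]; exact (map_zero _).symm
  | add u v hu hv => rw [map_add, DirectSum.add_apply, DirectSum.add_apply, hu, hv, map_add]
  | of p x =>
    obtain ⟨d', i'⟩ := p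
    by_cases h : (d', i') = (d, i)
    · obtain ⟨rfl, rfl⟩ := Prod.mk.inj h
      rw [of_eq_same]; rfl
    · rw [← of_cartierComponent, of_eq_of_ne _ _ _ (Ne.symm h), of_eq_of_ne, map_zero]
      intro e
      obtain ⟨e1, e2⟩ := Prod.mk.inj e
      exact h (Prod.ext (Nat.eq_of_mul_eq_mul_right (by omega) e1.symm) e2.symm)

theorem cartierComponent_bijective (hl : 1 < l) (hodd : Odd l) (hq : IsPrimitiveRoot q l)
    (n d i : ℕ) : Function.Bijective (cartierComponent hl hodd hq n d i) := by
  constructor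
  · intro x x' h
    have e := congrArg (of (HomologyGr q n) (d * l, i)) h
    rw [of_cartierComponent, of_cartierComponent] at e
    exact of_injective (β := OmegaGr (1 : Kˣ) n) (d, i) ((cartierEquiv hl hodd hq n).injective e)
  · intro y
    obtain ⟨w, hw⟩ := (cartierEquiv hl hodd hq n).surjective (of (HomologyGr q n) (d * l, i) y)
    refine ⟨w (d, i), ?_⟩
    rw [← cartierEquiv_coord, hw]
    exact of_eq_same (β := HomologyGr q n) (d * l, i) y

theorem Homology.map_mk {n m d i : ℕ} (f : schur q n m d) {x : Omega q n d i} {y : Omega q m d i}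
    (e : Omega.map i f x = y) (hx : x ∈ cycles q n d i) (hy : y ∈ cycles q m d i) :
    Homology.map i f (Homology.mk q n d i ⟨x, hx⟩) = Homology.mk q m d i ⟨y, hy⟩ := by
  subst e; rfl

theorem mk_map_mem_cycles {n m d i : ℕ} (f : schur q n m d) {x : TensorPow K n d}
    (hx : Omega.mk q n d i x ∈ cycles q n d i) : Omega.mk q m d i (f.1 x) ∈ cycles q m d i := by
  have := map_mem_cycles f hx
  rw [Submodule.mem_comap, Omega.map_mk] at this
  exact this

theorem classLin_ofTens_of_mem {n d i : ℕ} {x : TensorPow K n d}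
    (hx : Omega.mk q n d i x ∈ cycles q n d i) : classLin q n (ofTens q n d i x) =
      of (HomologyGr q n) (d, i) (Homology.mk q n d i ⟨_, hx⟩) :=
  classLin_of q (p := (d, i)) _ hx

theorem eq_mk_of_classLin {n d i : ℕ} {y : Homology q n d i} {x : TensorPow K n d}
    (hx : Omega.mk q n d i x ∈ cycles q n d i)
    (h : of (HomologyGr q n) (d, i) y = classLin q n (ofTens q n d i x)) :
    y = Homology.mk q n d i ⟨_, hx⟩ :=
  of_injective (β := HomologyGr q n) (d, i) (h.trans (classLin_ofTens_of_mem hx))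

/-- Functoriality of homology, for classes of cycles given by tensors. -/
theorem of_homologyMap {n m d i : ℕ} (f : schur q n m d) {y : Homology q n d i}
    {x : TensorPow K n d} (hx : Omega.mk q n d i x ∈ cycles q n d i)
    (h : of (HomologyGr q n) (d, i) y = classLin q n (ofTens q n d i x)) :
    of (HomologyGr q m) (d, i) (Homology.map i f y) = classLin q m (ofTens q m d i (f.1 x)) := by
  have hx' := mk_map_mem_cycles f hx
  have e : Homology.map i f y = Homology.mk q m d i ⟨_, hx'⟩ := by
    rw [eq_mk_of_classLin hx h]
    exact Homology.map_mk f (Omega.map_mk i f x) hx hx'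
  rw [classLin_ofTens_of_mem hx']
  exact congrArg _ e

/-- On a word I, the map `f` passes through the braid and acts on I^ℓ. By `classLin_blocks` the
resulting class is determined by the coordinates of f(I^ℓ) at the words J^ℓ, which are the entries
of Fr(f). -/
theorem cartierComponent_natural (hl : 1 < l) (hodd : Odd l) (hq : IsPrimitiveRoot q l)
    {n m d i : ℕ} (f : schur q n m (d * l)) (x : Omega (1 : Kˣ) n d i) :
    Homology.map i f (cartierComponent hl hodd hq n d i x) =
      cartierComponent hl hodd hq m d i (Omega.map i ⟨frobLin f.1, frobLin_mem hq hodd.pos f⟩ x) := by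
  rcases Nat.lt_or_ge d i with h | h
  · rw [Omega.eq_zero_of_lt 1 h x]; simp only [map_zero]
  obtain ⟨x, rfl⟩ := Omega.mk_surjective 1 n d i x
  refine LinearMap.congr_fun (f := Homology.map i f ∘ₗ cartierComponent hl hodd hq n d i ∘ₗ
    Omega.mk 1 n d i) (g := cartierComponent hl hodd hq m d i ∘ₗ
    Omega.map i ⟨frobLin f.1, frobLin_mem hq hodd.pos f⟩ ∘ₗ Omega.mk 1 n d i)
    (end_ext fun I => ?_) x
  simp only [LinearMap.comp_apply]
  apply of_injective (β := HomologyGr q m) (d * l, i)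
  have e := of_cartierComponent hl hodd hq (Omega.mk 1 n d i (tens K I))
  have hb : cartier hl hodd hq n (of (OmegaGr (1 : Kˣ) n) (d, i) (Omega.mk 1 n d i (tens K I))) =
      ofTens q n (d * l) i (braidExt (heckeT (q : K) n (d * l)) l i ((d - i) * l)
        (tens K (rep l I))) := by
    rw [← ofTens_apply, cartier_tens hl hodd hq h, frobWord_eq_ofTens q (by omega) h]
  rw [cartierEquiv_apply, hb] at e
  have hc := mem_cycles_of_mem q (cartier_mem hl hodd hq
    (of (OmegaGr (1 : Kˣ) n) (d, i) (Omega.mk 1 n d i (tens K I)))) (d * l, i)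
  rw [hb, ofTens_apply, of_eq_same] at hc
  rw [of_homologyMap f hc e, schur_braidExt, classLin_blocks hl hodd hq h, of_cartierComponent,
    Omega.map_mk, ← ofTens_apply]
  · change _ = cartierEquiv hl hodd hq m (ofTens 1 m d i (frobLin f.1 (tens K I)))
    conv_rhs => rw [← Finsupp.univ_sum_single (frobLin f.1 (tens K I))]
    rw [map_sum, map_sum]
    refine Finset.sum_congr rfl fun J _ => ?_
    rw [← Finsupp.smul_single_one, map_smul, map_smul, cartierEquiv_apply,
      cartier_tens hl hodd hq h, frobLin_apply]
  -- Inside a block all letters of I^ℓ agree, so T_k acts there by `q`, and this passes to the image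
  -- under `f`.
  · intro t k ht h1 h2
    rw [← schur_apply f.2, heckeT_rep _ I t h1 h2 ht, map_smul]

theorem exists_symClass (hl : 1 < l) (hodd : Odd l) (hq : IsPrimitiveRoot q l) {n : ℕ}
    (a : Fin n) : ∃ h : Omega.mk q n l 0 (tens K fun _ => a) ∈ cycles q n l 0,
      cartierEquiv hl hodd hq n
        (of (OmegaGr (1 : Kˣ) n) (1, 0) (Omega.mk 1 n 1 0 (tens K fun _ => a))) =
        of (HomologyGr q n) (l, 0) (Homology.mk q n l 0 ⟨_, h⟩) := by
  have e : cartier hl hodd hq n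
      (of (OmegaGr (1 : Kˣ) n) (1, 0) (Omega.mk 1 n 1 0 (tens K fun _ => a))) =
      of (OmegaGr q n) (l, 0) (Omega.mk q n l 0 (tens K fun _ => a)) :=
    (cartier_symGen hl hodd hq a).trans (ofTens_const q l a).symm
  have h := mem_cycles_of_mem q (cartier_mem hl hodd hq
    (of (OmegaGr (1 : Kˣ) n) (1, 0) (Omega.mk 1 n 1 0 (tens K fun _ => a)))) (l, 0)
  rw [e, of_eq_same] at h
  exact ⟨h, by rw [cartierEquiv_apply, e]; exact classLin_of q (p := (l, 0)) _ h⟩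

theorem exists_extClass (hl : 1 < l) (hodd : Odd l) (hq : IsPrimitiveRoot q l) {n : ℕ}
    (a : Fin n) : ∃ h : Omega.mk q n l 1 (tens K fun _ => a) ∈ cycles q n l 1,
      cartierEquiv hl hodd hq n
        (of (OmegaGr (1 : Kˣ) n) (1, 1) (Omega.mk 1 n 1 1 (tens K fun _ => a))) =
        of (HomologyGr q n) (l, 1) (Homology.mk q n l 1 ⟨_, h⟩) := by
  have e0 : ofTens q n l 1 (tens K fun _ => a) = frobExt q l a := by
    obtain ⟨m, rfl⟩ : ∃ m, l = m + 1 := ⟨l - 1, by omega⟩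
    rw [ofTens_const_one]; rfl
  have e : cartier hl hodd hq n
      (of (OmegaGr (1 : Kˣ) n) (1, 1) (Omega.mk 1 n 1 1 (tens K fun _ => a))) =
      of (OmegaGr q n) (l, 1) (Omega.mk q n l 1 (tens K fun _ => a)) :=
    (cartier_extGen hl hodd hq a).trans e0.symm
  have h := mem_cycles_of_mem q (cartier_mem hl hodd hq
    (of (OmegaGr (1 : Kˣ) n) (1, 1) (Omega.mk 1 n 1 1 (tens K fun _ => a)))) (l, 1)
  rw [e, of_eq_same] at h
  exact ⟨h, by rw [cartierEquiv_apply, e]; exact classLin_of q (p := (l, 1)) _ h⟩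

end Component

/-! ### The isomorphism of functors -/

noncomputable section CartierIso

open CategoryTheory

universe v

variable {K : Type v} [Field K] {q : Kˣ} {l : ℕ}

/-- The inverse Cartier isomorphism of quantum polynomial functors. -/
def cartierNatIso (hl : 1 < l) (hodd : Odd l) (hq : IsPrimitiveRoot q l) (d i : ℕ) :
    frobenius hq hodd d ⋙ omegaFunctor (1 : Kˣ) d i ≅ homologyFunctor q (d * l) i :=
  NatIso.ofComponents
    (fun X => (LinearEquiv.ofBijective (cartierComponent hl hodd hq X.rank d i)
      (cartierComponent_bijective hl hodd hq X.rank d i)).toModuleIso)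
    (fun {X Y} f => by
      ext x
      exact (cartierComponent_natural hl hodd hq f x).symm)

end CartierIso
end QuantumDeRham

open QuantumDeRham CategoryTheory DirectSum

theorem mainTheorem4 {K : Type*} [Field K] (q : Kˣ) (l : ℕ) (hl : 1 < l) (hodd : Odd l)
    (hq : IsPrimitiveRoot q l) :
    ∃ (c : ∀ n : ℕ+, OmegaAlg (1 : Kˣ) n ≃ₐ[K] HomologyAlg q n)
      (η : ∀ d i : ℕ, frobenius hq hodd d ⋙ omegaFunctor (1 : Kˣ) d i ≅
        homologyFunctor q (d * l) i),
      (∀ (n : ℕ+) (a : Fin n),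
        ∃ h : Omega.mk q n l 0 (tens K fun _ => a) ∈ cycles q n l 0,
          c n (of (OmegaGr (1 : Kˣ) n) (1, 0) (Omega.mk 1 n 1 0 (tens K fun _ => a))) =
            of (HomologyGr q n) (l, 0) (Homology.mk q n l 0 ⟨_, h⟩)) ∧
      (∀ (n : ℕ+) (a : Fin n),
        ∃ h : Omega.mk q n l 1 (tens K fun _ => a) ∈ cycles q n l 1,
          c n (of (OmegaGr (1 : Kˣ) n) (1, 1) (Omega.mk 1 n 1 1 (tens K fun _ => a))) =
            of (HomologyGr q n) (l, 1) (Homology.mk q n l 1 ⟨_, h⟩)) ∧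
      (∀ (n : ℕ+) (d i : ℕ) (x : Omega (1 : Kˣ) n d i),
        c n (of (OmegaGr (1 : Kˣ) n) (d, i) x) =
          of (HomologyGr q n) (d * l, i) ((η d i).hom.app ⟨n⟩ x)) :=
  ⟨fun n => cartierEquiv hl hodd hq n, cartierNatIso hl hodd hq,
    fun _ a => exists_symClass hl hodd hq a, fun _ a => exists_extClass hl hodd hq a,
    fun _ _ _ x => (of_cartierComponent hl hodd hq x).symm⟩
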